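/- Let $p$ be a prime. A fusion system on a finite $p$-group $S$ is a category whose objects are the subgroups of $S$, whose morphisms are injective homomorphisms including all those induced by conjugation in $S$, and in which every morphism is an isomorphism of the category followed by an inclusion. A morphism from a fusion system $\mathcal F$ on $S$ to a fusion system $\mathcal E$ on $T$ is a homomorphism $\varphi\colon S\to T$ such that for every $\alpha\in\operatorname{Hom}_{\mathcal F}(P,R)$ there is $\beta\in\operatorname{Hom}_{\mathcal E}(P\varphi,R\varphi)$ with $\alpha\circ\varphi|_R=\varphi|_P\circ\beta$ (maps are written on the right). $\mathcal F$ is saturated if (i) every fully $\mathcal F$-normalised $P\le S$ is fully $\mathcal F$-centralised and $\operatorname{Aut}_S(P)\in\operatorname{Syl}_p(\operatorname{Aut}_{\mathcal F}(P))$, and (ii) every $\varphi\in\operatorname{Hom}_{\mathcal F}(P,S)$ with $P\varphi$ fully $\mathcal F$-centralised extends to a morphism in $\operatorname{Hom}_{\mathcal F}(N_\varphi,S)$, where $N_\varphi=\{g\in N_S(P)\mid \varphi^{-1}c_g\varphi\in\operatorname{Aut}_S(P\varphi)\}$. $P$ is $\mathcal F$-centric if $C_S(Q)=Z(Q)$ for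 every $\mathcal F$-conjugate $Q$ of $P$, and $\mathcal F$-essential if it is $\mathcal F$-centric and $\operatorname{Out}_{\mathcal F}(P)=\operatorname{Aut}_{\mathcal F}(P)/\operatorname{Inn}(P)$ has a strongly $p$-embedded subgroup (a proper subgroup $H$ containing a Sylow $p$-subgroup of the group and such that $H\cap H^g$ is a $p'$-group for every $g\notin H$). A tree of fusion systems $(\mathcal T,\mathcal F,\mathcal S)$ consists of a tree $\mathcal T$, finite $p$-groups $\mathcal S(v)$, $\mathcal S(e)$ and fusion systems $\mathcal F(v)$, $\mathcal F(e)$ on them, for all vertices $v$ and edges $e$, and, for every vertex $v$ of an edge $e$, a monomorphism $\mathcal S(e)\to\mathcal S(v)$ that is an injective morphism $\mathcal F(e)\to\mathcal F(v)$. Its completion is the colimit of $\mathcal F$ in the category of fusion systems on finite $p$-groups. Hypothesis $(H)$ says that there is a vertex $v_*$ such that for every vertex $v\ne v_*$ we have $\mathcal S(e)\cong\mathcal S(v)$, where $e$ is the edge incident to $v$ in the path from $v$ to $v_*$. **Theorem B.** Let $(\mathcal T,\mathcal F,\mathcal S)$ be a tree of fusion systems satisfying $(H)$, with $\mathcal F(v)$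 saturated for every vertex $v$, and write $S:=\mathcal S(v_*)$. Then $(\mathcal T,\mathcal F,\mathcal S)$ has a completion $\mathcal F_{\mathcal T}$ that is a fusion system on $S$, with canonical map $\mathcal S(v_*)\to S$ the identity; identify the groups $\mathcal S(v)$, $\mathcal S(e)$ with their images in $S$. For $P\le S$ and $r$ a vertex or edge of $\mathcal T$ let $\operatorname{Rep}_{\mathcal F_{\mathcal T}}(P,\mathcal F(r))$ be the set of classes of $\operatorname{Hom}_{\mathcal F_{\mathcal T}}(P,\mathcal S(r))$ under the relation $\alpha\sim\beta$ if $\beta=\alpha\circ\gamma$ for some $\gamma\in\operatorname{Iso}_{\mathcal F(r)}(P\alpha,P\beta)$. Let the $P$-orbit graph $\operatorname{Rep}_{\mathcal F_{\mathcal T}}(P,\mathcal F)$ be the graph (possibly with multiple edges) whose vertices are the elements of the sets $\operatorname{Rep}_{\mathcal F_{\mathcal T}}(P,\mathcal F(v))$ and whose edges are the elements of the sets $\operatorname{Rep}_{\mathcal F_{\mathcal T}}(P,\mathcal F(e))$, where the edge $[\gamma]_{\mathcal F(e)}$, $e=(v,w)$, joins $[\gamma]_{\mathcal F(v)}$ to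 $[\gamma]_{\mathcal F(w)}$. Assume that for every $P\le S$: (a) if $P$ is $\mathcal F_{\mathcal T}$-conjugate to an $\mathcal F(v)$-essential subgroup for some vertex $v$, or $P=\mathcal S(v)$ for some vertex $v$, then $P$ is $\mathcal F_{\mathcal T}$-centric; (b) if $P$ is $\mathcal F_{\mathcal T}$-centric, then $\operatorname{Rep}_{\mathcal F_{\mathcal T}}(P,\mathcal F)$ is a tree. Then $\mathcal F_{\mathcal T}$ is a saturated fusion system on $S$. -/

import Mathlib

universe u w

/-! ### Fusion systems on finite `p`-groups -/

/-- A fusion system on a finite `p`-group `S`: a category whose objects are the subgroups of `S`,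
given by its sets of morphisms. Inclusions, and in particular identities, are
morphisms, because they are induced by conjugation by `1`. -/
structure FusionSystem (p : ℕ) (S : Type w) [Group S] where
  finite : Finite S
  isPGroup : IsPGroup p S
  /-- the set of morphisms from `P` to `Q` -/
  Hom : (P Q : Subgroup S) → Set (P →* Q)
  comp_mem : ∀ {P Q R : Subgroup S} {φ : P →* Q} {ψ : Q →* R},
    φ ∈ Hom P Q → ψ ∈ Hom Q R → ψ.comp φ ∈ Hom P R
  /-- every homomorphism induced by conjugation by an element of `S` is a morphism -/
  conj_mem : ∀ {P Q : Subgroup S} (s : S) (φ : P →* Q),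
    (∀ x : P, (φ x : S) = s * x * s⁻¹) → φ ∈ Hom P Q
  injective : ∀ {P Q : Subgroup S} {φ : P →* Q}, φ ∈ Hom P Q → Function.Injective φ
  /-- every morphism is an isomorphism of the category followed by an inclusion -/
  factor : ∀ {P Q : Subgroup S} {φ : P →* Q}, φ ∈ Hom P Q →
    ∃ (R : Subgroup S) (hR : R ≤ Q) (ψ : P ≃* R), ψ.toMonoidHom ∈ Hom P R ∧
      ψ.symm.toMonoidHom ∈ Hom R P ∧ φ = (Subgroup.inclusion hR).comp ψ.toMonoidHom

namespace FusionSystem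

variable {p : ℕ} {S : Type w} [Group S]

/-- `Iso_F(P, Q)`: the isomorphisms from `P` to `Q` in the category `F`. -/
def Iso (F : FusionSystem p S) (P Q : Subgroup S) : Set (P ≃* Q) :=
  {γ | γ.toMonoidHom ∈ F.Hom P Q ∧ γ.symm.toMonoidHom ∈ F.Hom Q P}

theorem refl_mem_iso (F : FusionSystem p S) (P : Subgroup S) : MulEquiv.refl P ∈ F.Iso P P :=
  ⟨F.conj_mem 1 _ fun x => by simp, F.conj_mem 1 _ fun x => by simp⟩

theorem symm_mem_iso (F : FusionSystem p S) {P Q : Subgroup S} {γ : P ≃* Q}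
    (h : γ ∈ F.Iso P Q) : γ.symm ∈ F.Iso Q P :=
  ⟨h.2, h.1⟩

theorem trans_mem_iso (F : FusionSystem p S) {P Q R : Subgroup S} {γ : P ≃* Q} {δ : Q ≃* R}
    (h : γ ∈ F.Iso P Q) (h' : δ ∈ F.Iso Q R) : γ.trans δ ∈ F.Iso P R :=
  ⟨F.comp_mem h.1 h'.1, F.comp_mem h'.2 h.2⟩

/-- `P` and `Q` are `F`-conjugate. -/
def Conj (F : FusionSystem p S) (P Q : Subgroup S) : Prop :=
  (F.Iso P Q).Nonempty

/-- `Aut_F(P)`, as a subgroup of the group of all automorphisms of `P`. -/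
def aut (F : FusionSystem p S) (P : Subgroup S) : Subgroup (MulAut P) where
  carrier := F.Iso P P
  mul_mem' h h' := F.trans_mem_iso h' h
  one_mem' := F.refl_mem_iso P
  inv_mem' h := F.symm_mem_iso h

/-- `Aut_S(P)`: the automorphisms of `P` induced by conjugation by elements of `N_S(P)`. -/
def autAmbient (P : Subgroup S) : Subgroup (MulAut P) :=
  P.normalizerMonoidHom.range

/-- `Inn(P)`, as a subgroup of `Aut_F(P)`. -/
def inn (F : FusionSystem p S) (P : Subgroup S) : Subgroup (F.aut P) :=
  (MulAut.conj : P →* MulAut P).range.subgroupOf (F.aut P)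

instance inn_normal (F : FusionSystem p S) (P : Subgroup S) : (F.inn P).Normal := by
  refine ⟨?_⟩
  rintro ⟨a, ha⟩ ⟨x, hx⟩ ⟨b, hb⟩
  refine ⟨b x, ?_⟩
  have hx' : MulAut.conj x = a := hx
  subst hx'
  ext y
  simp [MulAut.mul_apply]

/-- `Out_F(P) = Aut_F(P) / Inn(P)`. -/
abbrev Out (F : FusionSystem p S) (P : Subgroup S) : Type w :=
  F.aut P ⧸ F.inn P

def FullyNormalised (F : FusionSystem p S) (P : Subgroup S) : Prop :=
  ∀ R : Subgroup S, F.Conj P R →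
    Nat.card (Subgroup.normalizer (R : Set S)) ≤ Nat.card (Subgroup.normalizer (P : Set S))

def FullyCentralised (F : FusionSystem p S) (P : Subgroup S) : Prop :=
  ∀ R : Subgroup S, F.Conj P R →
    Nat.card (Subgroup.centralizer (R : Set S)) ≤ Nat.card (Subgroup.centralizer (P : Set S))

/-- `Aut_S(P)` is a Sylow `p`-subgroup of `Aut_F(P)`. -/
def FullyAutomised (F : FusionSystem p S) (P : Subgroup S) : Prop :=
  ∃ Q : Sylow p (F.aut P), (Q : Subgroup (F.aut P)).map (F.aut P).subtype = autAmbient P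

/-- The image `Pφ` of `φ : P → Q`, as a subgroup of `S`. -/
def image {P Q : Subgroup S} (φ : P →* Q) : Subgroup S :=
  (Q.subtype.comp φ).range

/-- `N_φ`: the elements `g` of `N_S(P)` such that `φ` transports the automorphism of `P` induced
by conjugation by `g` to an element of `Aut_S(Pφ)`. -/
def extender {P Q : Subgroup S} (φ : P →* Q) : Subgroup S where
  carrier := {g | ∃ hg : g ∈ Subgroup.normalizer (P : Set S),
    ∃ h ∈ Subgroup.normalizer (image φ : Set S), ∀ x : P,
      (φ (P.normalizerMonoidHom ⟨g, hg⟩ x) : S) = h * φ x * h⁻¹}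
  mul_mem' := by
    rintro a b ⟨ha, h, hh, hφ⟩ ⟨hb, k, hk, kφ⟩
    refine ⟨mul_mem ha hb, h * k, mul_mem hh hk, fun x => ?_⟩
    have hab : P.normalizerMonoidHom ⟨a * b, mul_mem ha hb⟩ x =
        P.normalizerMonoidHom ⟨a, ha⟩ (P.normalizerMonoidHom ⟨b, hb⟩ x) := by
      rw [← MulAut.mul_apply, ← map_mul]
      rfl
    rw [hab, hφ, kφ]
    group
  one_mem' := by
    refine ⟨one_mem _, 1, one_mem _, fun x => ?_⟩
    have h1 : P.normalizerMonoidHom ⟨1, one_mem _⟩ = 1 := map_one P.normalizerMonoidHom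
    rw [h1]
    simp
  inv_mem' := by
    rintro a ⟨ha, h, hh, hφ⟩
    refine ⟨inv_mem ha, h⁻¹, inv_mem hh, fun x => ?_⟩
    have key := hφ (P.normalizerMonoidHom ⟨a⁻¹, inv_mem ha⟩ x)
    have hinv : P.normalizerMonoidHom ⟨a, ha⟩ (P.normalizerMonoidHom ⟨a⁻¹, inv_mem ha⟩ x) = x := by
      rw [← MulAut.mul_apply, ← map_mul]
      have h1 : (⟨a, ha⟩ * ⟨a⁻¹, inv_mem ha⟩ : Subgroup.normalizer (P : Set S)) = 1 := by
        ext
        simp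
      rw [h1, map_one]
      rfl
    rw [hinv] at key
    rw [key]
    group

/-- Saturated fusion systems. -/
structure IsSaturated (F : FusionSystem p S) : Prop where
  sylow : ∀ P : Subgroup S, F.FullyNormalised P → F.FullyCentralised P ∧ F.FullyAutomised P
  extension : ∀ (P : Subgroup S) (φ : P →* (⊤ : Subgroup S)), φ ∈ F.Hom P ⊤ →
    F.FullyCentralised (image φ) →
    ∃ ψ ∈ F.Hom (extender φ) ⊤, ∀ (x : S) (hx : x ∈ P) (hx' : x ∈ extender φ),
      (ψ ⟨x, hx'⟩ : S) = φ ⟨x, hx⟩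

/-- `F`-centric subgroups: `C_S(Q) = Z(Q)` for every `F`-conjugate `Q` of `P`. -/
def IsCentric (F : FusionSystem p S) (P : Subgroup S) : Prop :=
  ∀ Q : Subgroup S, F.Conj P Q →
    Subgroup.centralizer (Q : Set S) = (Subgroup.center Q).map Q.subtype

/-- A strongly `p`-embedded subgroup `H` of a finite group `G`: `H` is proper, contains a Sylow
`p`-subgroup of `G`, and `H ∩ H ^ g` is a `p'`-group for every `g ∈ G \ H`. -/
def IsStronglyEmbedded (p : ℕ) {G : Type w} [Group G] (H : Subgroup G) : Prop :=
  H < ⊤ ∧ (∃ Q : Sylow p G, (Q : Subgroup G) ≤ H) ∧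
    ∀ g : G, g ∉ H →
      ¬ p ∣ Nat.card (H ⊓ H.map (MulAut.conj g⁻¹).toMonoidHom : Subgroup G)

/-- `F`-essential subgroups. -/
def IsEssential (F : FusionSystem p S) (P : Subgroup S) : Prop :=
  F.IsCentric P ∧ ∃ H : Subgroup (F.Out P), IsStronglyEmbedded p H

/-- The homomorphism `φ : S → T` is a morphism of fusion systems from `F` to `E`. -/
def IsMorphism {T : Type*} [Group T] (F : FusionSystem p S) (E : FusionSystem p T)
    (φ : S →* T) : Prop :=
  ∀ (P R : Subgroup S), ∀ α ∈ F.Hom P R, ∃ β ∈ E.Hom (P.map φ) (R.map φ),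
    (φ.subgroupMap R).comp α = β.comp (φ.subgroupMap P)

/-- The morphism `φ` from `F` to `E` is injective: for every `P` the induced map from
`Hom_F(P, S)` to `Hom_E(Pφ, T)`, which sends `α` to the `β` with `φ ∘ α = β ∘ φ` on `P`,
is injective. -/
def IsInjectiveMorphism {T : Type*} [Group T] (F : FusionSystem p S) (E : FusionSystem p T)
    (φ : S →* T) : Prop :=
  F.IsMorphism E φ ∧
    ∀ (P : Subgroup S), ∀ α ∈ F.Hom P ⊤, ∀ α' ∈ F.Hom P ⊤, ∀ β ∈ E.Hom (P.map φ) ⊤,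
      (∀ x : P, (β (φ.subgroupMap P x) : T) = φ (α x)) →
      (∀ x : P, (β (φ.subgroupMap P x) : T) = φ (α' x)) → α = α'

/-- The relation `α ∼ β` on homomorphisms `P → S`, meaning that `β` is the composite of `α`
with an element of `Iso_F(Pα, Pβ)`. -/
def RepRel (F : FusionSystem p S) {P : Type*} [Group P] (α β : P →* S) : Prop :=
  ∃ γ ∈ F.Iso α.range β.range, ∀ x : P, γ (α.rangeRestrict x) = β.rangeRestrict x

theorem repRel_equivalence (F : FusionSystem p S) (P : Type*) [Group P] :
    Equivalence (F.RepRel (P := P)) where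
  refl α := ⟨_, F.refl_mem_iso _, fun _ => rfl⟩
  symm := by
    rintro α β ⟨γ, hγ, h⟩
    exact ⟨γ.symm, F.symm_mem_iso hγ, fun x => by rw [← h x]; simp⟩
  trans := by
    rintro α β δ ⟨γ, hγ, h⟩ ⟨γ', hγ', h'⟩
    exact ⟨γ.trans γ', F.trans_mem_iso hγ hγ', fun x => by
      rw [MulEquiv.trans_apply, h x, h' x]⟩

/-- Morphisms of fusion systems respect the relation `∼`. -/
theorem RepRel.map {T : Type*} [Group T] {F : FusionSystem p S} {E : FusionSystem p T}
    {φ : S →* T} (hφ : F.IsMorphism E φ) {P : Type*} [Group P] {α β : P →* S}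
    (h : F.RepRel α β) : E.RepRel (φ.comp α) (φ.comp β) := by
  obtain ⟨γ, hγ, h⟩ := h
  obtain ⟨b, hb, hbγ⟩ := hφ _ _ _ hγ.1
  obtain ⟨c, hc, hcγ⟩ := hφ _ _ _ hγ.2
  have hb' : ∀ y, b (φ.subgroupMap _ y) = φ.subgroupMap _ (γ y) :=
    fun y => (DFunLike.congr_fun hbγ y).symm
  have hc' : ∀ y, c (φ.subgroupMap _ y) = φ.subgroupMap _ (γ.symm y) :=
    fun y => (DFunLike.congr_fun hcγ y).symm
  have hcb : ∀ y, c (b y) = y := by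
    intro y
    obtain ⟨z, rfl⟩ := φ.subgroupMap_surjective _ y
    rw [hb', hc', MulEquiv.symm_apply_apply]
  have hbc : ∀ y, b (c y) = y := by
    intro y
    obtain ⟨z, rfl⟩ := φ.subgroupMap_surjective _ y
    rw [hc', hb', MulEquiv.apply_symm_apply]
  suffices key : ∀ A B : Subgroup T, A = α.range.map φ → B = β.range.map φ →
      ∃ δ ∈ E.Iso A B, ∀ (x : P) (hx : φ (α x) ∈ A), (δ ⟨φ (α x), hx⟩ : T) = φ (β x) by
    obtain ⟨δ, hδ, hx⟩ := key _ _ (MonoidHom.range_comp φ α) (MonoidHom.range_comp φ β)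
    exact ⟨δ, hδ, fun x => Subtype.ext (hx x _)⟩
  rintro A B rfl rfl
  refine ⟨⟨⟨b, c, hcb, hbc⟩, map_mul b⟩, ⟨hb, hc⟩, fun x hx => ?_⟩
  have h1 := congrArg Subtype.val (hb' (α.rangeRestrict x))
  rw [h x] at h1
  exact h1

end FusionSystem

/-! ### Trees of fusion systems and their completions -/

/-- A tree of `p`-fusion systems. The tree is regarded as a category whose objects are its vertices
and edges, with one morphism `f_ev : e → v` for every vertex `v` of an edge `e`; a functor on it
is the same as its values on the objects and on the morphisms `f_ev`. -/
structure TreeOfFusionSystems (p : ℕ) (V : Type u) where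
  graph : SimpleGraph V
  isTree : graph.IsTree
  /-- the groups `S(v)` and `S(e)` -/
  grp : V ⊕ graph.edgeSet → Type w
  [group : ∀ r, Group (grp r)]
  /-- the fusion systems `F(v)` on `S(v)` and `F(e)` on `S(e)` -/
  fus : ∀ r, FusionSystem p (grp r)
  /-- the homomorphism `S(e) → S(v)` for a vertex `v` of the edge `e` -/
  map : ∀ (e : graph.edgeSet) (v : V), v ∈ e.1 → grp (Sum.inr e) →* grp (Sum.inl v)
  map_injective : ∀ e v h, Function.Injective (map e v h)
  map_isInjectiveMorphism : ∀ e v h,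
    (fus (Sum.inr e)).IsInjectiveMorphism (fus (Sum.inl v)) (map e v h)

namespace TreeOfFusionSystems

variable {p : ℕ} {V : Type u} (𝓣 : TreeOfFusionSystems.{u, w} p V)

instance instGroupGrp (r : V ⊕ 𝓣.graph.edgeSet) : Group (𝓣.grp r) := 𝓣.group r

/-- Hypothesis (H) for the vertex `v₀`: for every vertex `v`, if `e` is the edge incident to `v` in
the path from `v` to `v₀`, then `S(e) ≅ S(v)`. (For `v = v₀` there is no such edge.) -/
def HypothesisH (v₀ : V) : Prop :=
  ∀ (v : V) (c : 𝓣.graph.Walk v v₀), c.IsPath →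
    ∀ e : 𝓣.graph.edgeSet, e.1 ∈ c.edges → v ∈ e.1 →
      Nonempty (𝓣.grp (Sum.inr e) ≃* 𝓣.grp (Sum.inl v))

/-- The homomorphisms `ι` from the groups `S(v)` and `S(e)` to `K` form a cocone under the
diagram of fusion systems, with vertex the fusion system `E` on `K`. -/
structure IsCocone {K : Type w} [Group K] (E : FusionSystem p K) (ι : ∀ r, 𝓣.grp r →* K) :
    Prop where
  isMorphism : ∀ r, (𝓣.fus r).IsMorphism E (ι r)
  comm : ∀ e v h, (ι (Sum.inl v)).comp (𝓣.map e v h) = ι (Sum.inr e)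

/-- The fusion system `E` on `K` with the homomorphisms `ι` is a completion of the tree of
fusion systems: a colimit of the diagram in the category of fusion systems. -/
structure IsCompletion {K : Type w} [Group K] (E : FusionSystem p K) (ι : ∀ r, 𝓣.grp r →* K) :
    Prop extends 𝓣.IsCocone E ι where
  universal : ∀ (L : Type w) [Group L] (D : FusionSystem p L) (j : ∀ r, 𝓣.grp r →* L),
    𝓣.IsCocone D j → ∃! φ : K →* L, E.IsMorphism D φ ∧ ∀ r, φ.comp (ι r) = j r

variable {𝓣} {K : Type w} [Group K] {E : FusionSystem p K} {ι : ∀ r, 𝓣.grp r →* K}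

/-- `Hom_E(P, S(r))` for a subgroup `P` of `K`, where `S(r)` is identified with its image
in `K` under `ι r`. -/
def HomTo (E : FusionSystem p K) (ι : ∀ r, 𝓣.grp r →* K) (P : Subgroup K)
    (r : V ⊕ 𝓣.graph.edgeSet) : Type w :=
  {α : P →* 𝓣.grp r // (ι r).rangeRestrict.comp α ∈ E.Hom P (ι r).range}

instance repSetoid (E : FusionSystem p K) (ι : ∀ r, 𝓣.grp r →* K) (P : Subgroup K)
    (r : V ⊕ 𝓣.graph.edgeSet) : Setoid (HomTo E ι P r) where
  r α β := (𝓣.fus r).RepRel α.1 β.1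
  iseqv := ((𝓣.fus r).repRel_equivalence P).comap Subtype.val

/-- `Rep_E(P, F(r))`, the set of classes of elements of `Hom_E(P, S(r))` under the relation
`∼` of the fusion system `F(r)`. -/
def Rep (E : FusionSystem p K) (ι : ∀ r, 𝓣.grp r →* K) (P : Subgroup K)
    (r : V ⊕ 𝓣.graph.edgeSet) : Type w :=
  Quotient (repSetoid E ι P r)

/-- Composition with the inclusion `S(e) → S(v)`. -/
def homToMap (hι : 𝓣.IsCocone E ι) (P : Subgroup K) (e : 𝓣.graph.edgeSet) (v : V) (h : v ∈ e.1)
    (α : HomTo E ι P (Sum.inr e)) : HomTo E ι P (Sum.inl v) :=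
  ⟨(𝓣.map e v h).comp α.1, by
    have hle : (ι (Sum.inr e)).range ≤ (ι (Sum.inl v)).range := by
      rw [← hι.comm e v h]
      rintro _ ⟨x, rfl⟩
      exact ⟨_, rfl⟩
    have hinc : Subgroup.inclusion hle ∈ E.Hom _ _ := E.conj_mem 1 _ fun x => by simp
    have := E.comp_mem α.2 hinc
    convert this using 1
    ext x
    simpa using DFunLike.congr_fun (hι.comm e v h) (α.1 x)⟩

/-- The map `Rep_E(P, F(e)) → Rep_E(P, F(v))` induced by `f_ev`. -/
def repMap (hι : 𝓣.IsCocone E ι) (P : Subgroup K) (e : 𝓣.graph.edgeSet) (v : V) (h : v ∈ e.1) :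
    Rep E ι P (Sum.inr e) → Rep E ι P (Sum.inl v) :=
  Quotient.map (homToMap hι P e v h) fun _ _ hαβ =>
    FusionSystem.RepRel.map (𝓣.map_isInjectiveMorphism e v h).1 hαβ

/-- The `P`-orbit graph `Rep_E(P, F)`, the homotopy colimit of the functor `Rep_E(P, F(-))` of
sets on the tree: it has one point for every element of the sets `Rep_E(P, F(v))` and
`Rep_E(P, F(e))`, and one segment joining each `x` in `Rep_E(P, F(e))` to its image in
`Rep_E(P, F(v))`, for each of the two vertices `v` of `e`. Thus it is the graph with vertices the
elements of the sets `Rep_E(P, F(v))` and one (possibly multiple) edge for every element of the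
sets `Rep_E(P, F(e))`, where the midpoint of every edge has been made a vertex. -/
def orbitGraph (hι : 𝓣.IsCocone E ι) (P : Subgroup K) :
    SimpleGraph (Σ r : V ⊕ 𝓣.graph.edgeSet, Rep E ι P r) :=
  SimpleGraph.fromRel fun a b => ∃ (e : 𝓣.graph.edgeSet) (v : V) (h : v ∈ e.1)
    (x : Rep E ι P (Sum.inr e)), a = ⟨Sum.inr e, x⟩ ∧ b = ⟨Sum.inl v, repMap hι P e v h x⟩

end TreeOfFusionSystems

/-!
Every saturated fusion system is generated by its morphisms on the whole group and on the conjugates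
of its essential subgroups (`FusionSystem.gen_isEssentialMor`, the theorem of Alperin and Goldschmidt).
Under hypothesis (H) the groups of the tree embed compatibly into `S = S(v₀)`
(`HypothesisH.exists_homs`, `HypothesisH.injective`), and the completion is the fusion system on `S`
generated by the images of the fusion systems `F(v)` (`HypothesisH.exists_isCompletion`,
`IsCompletion.gen`). By condition (a) it is therefore generated by morphisms between centric
subgroups, and for such a fusion system it is enough to verify saturation at the centric subgroups:
this is `FusionSystem.saturatedAt_of_centric`, proved by induction along decreasing orders. Here
saturation is used in the form `FusionSystem.SaturatedAt`: every subgroup has a conjugate that is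
both fully automised and receptive.

For a centric subgroup `P` both properties come from the tree `Rep_E(P, F)` of condition (b), on
which `Aut_E(P)` acts by precomposition.

* A `p`-subgroup of `Aut_E(P)` fixes a point of this tree, since a finite group that acts on a tree
  and preserves a bipartition fixes a vertex. It therefore acts on some conjugate of `P` inside
  a group `S(v)` by automorphisms of `F(v)`, and as `F(v)` is saturated it can be moved into the
  automorphisms induced by `S(v)` (`HasOrbitTrees.exists_lift`). For a Sylow `p`-subgroup
  this yields a fully automised conjugate.
* A morphism `φ` from `P` is extended to `N_φ` along the path from the class of the inclusion to
  the class of `φ`. The group `N_φ` fixes both ends, hence all of the path, and in each step an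
  extension is found in one of the saturated fusion systems `F(v)`
  (`HasOrbitTrees.exists_isRep_of_adj`, `HasOrbitTrees.receptive`).

To pass through an edge `e` in the second argument one has to move a `p`-group of automorphisms in
`F(e)` into the automorphisms induced by `S(e)`, although `F(e)` is not assumed to be saturated.
This is `HasOrbitTrees.exists_edge_lift`: an automorphism in `F(e)` of a subgroup of `S(e)` that
extends to its normaliser `M` in `S(e)` in the fusion systems at both ends of `e` extends in `F(e)`,
because `Rep_E(M, F)` has no cycles; and if the subgroup is its own normaliser, it is `S(e)`, which
by (H) is the group of one of the ends.

Morphisms of fusion systems are handled as functions on the ambient group together with a subgroup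
on which they are considered (`IsEmb`, `FusionSystem.IsMor`), so that restrictions and composites
involve no coercions between subgroups.
-/

/-! ### Embeddings of subgroups, as functions on the ambient group -/

section Embeddings

variable {G : Type*} {H : Type*} {K : Type*} [Group G] [Group H] [Group K]

/-- The function `f : G → H` restricts to an injective homomorphism on the subgroup `P`.
Morphisms of fusion systems are handled as such functions, whose values outside `P` do not matter,
so that restriction and composition do not change the types involved. -/
structure IsEmb (P : Subgroup G) (f : G → H) : Prop where
  map_mul : ∀ x ∈ P, ∀ y ∈ P, f (x * y) = f x * f y
  injOn : Set.InjOn f P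

/-- The image of the subgroup `P` under a function `f` that is multiplicative on `P`; the closure
makes it a subgroup for every `f`. -/
def img (P : Subgroup G) (f : G → H) : Subgroup H :=
  Subgroup.closure (f '' P)

/-- The inverse of the restriction of `f` to `P`, as a function on the ambient group. -/
noncomputable def pinv (P : Subgroup G) (f : G → H) : H → G :=
  Function.invFunOn f P

theorem img_mono {P Q : Subgroup G} (h : P ≤ Q) (f : G → H) : img P f ≤ img Q f :=
  Subgroup.closure_mono (Set.image_mono h)

theorem img_congr {P : Subgroup G} {f g : G → H} (h : ∀ x ∈ P, f x = g x) : img P f = img P g := by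
  unfold img
  rw [Set.image_congr h]

theorem mem_img_of_mem {P : Subgroup G} (f : G → H) {x : G} (hx : x ∈ P) : f x ∈ img P f :=
  Subgroup.subset_closure ⟨x, hx, rfl⟩

theorem img_le_iff {P : Subgroup G} {f : G → H} {Q : Subgroup H} :
    img P f ≤ Q ↔ ∀ x ∈ P, f x ∈ Q := by
  unfold img
  rw [Subgroup.closure_le]
  exact Set.image_subset_iff

theorem lt_sup_of_not_le {P C : Subgroup G} (h : ¬ C ≤ P) : P < P ⊔ C :=
  lt_of_le_of_ne le_sup_left fun e => h (e ▸ le_sup_right)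

namespace IsEmb

variable {P Q : Subgroup G} {f : G → H}

theorem map_one (h : IsEmb P f) : f 1 = 1 := by
  have := h.map_mul 1 P.one_mem 1 P.one_mem
  rw [mul_one] at this
  exact (mul_eq_left.mp this.symm)

theorem map_inv (h : IsEmb P f) {x : G} (hx : x ∈ P) : f x⁻¹ = (f x)⁻¹ := by
  have := h.map_mul x⁻¹ (P.inv_mem hx) x hx
  rw [inv_mul_cancel, h.map_one] at this
  exact eq_inv_of_mul_eq_one_left this.symm

theorem map_conj (h : IsEmb P f) {g x : G} (hg : g ∈ P) (hx : x ∈ P) :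
    f (g * x * g⁻¹) = f g * f x * (f g)⁻¹ := by
  rw [h.map_mul _ (P.mul_mem hg hx) _ (P.inv_mem hg), h.map_mul _ hg _ hx, h.map_inv hg]

theorem of_le (h : IsEmb P f) (hQ : Q ≤ P) : IsEmb Q f :=
  ⟨fun x hx y hy => h.map_mul x (hQ hx) y (hQ hy), h.injOn.mono hQ⟩

theorem congr (h : IsEmb P f) {g : G → H} (hg : ∀ x ∈ P, g x = f x) : IsEmb P g := by
  refine ⟨fun x hx y hy => ?_, fun x hx y hy e => h.injOn hx hy ?_⟩
  · rw [hg _ hx, hg _ hy, hg _ (P.mul_mem hx hy), h.map_mul x hx y hy]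
  · rwa [hg x hx, hg y hy] at e

theorem mem_img (h : IsEmb P f) {y : H} : y ∈ img P f ↔ ∃ x ∈ P, f x = y := by
  constructor
  · intro hy
    induction hy using Subgroup.closure_induction with
    | mem y hy => exact hy
    | one => exact ⟨1, P.one_mem, h.map_one⟩
    | mul a b _ _ ha hb =>
      obtain ⟨x, hx, rfl⟩ := ha
      obtain ⟨y, hy, rfl⟩ := hb
      exact ⟨x * y, P.mul_mem hx hy, h.map_mul x hx y hy⟩
    | inv a _ ha =>
      obtain ⟨x, hx, rfl⟩ := ha
      exact ⟨x⁻¹, P.inv_mem hx, h.map_inv hx⟩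
  · rintro ⟨x, hx, rfl⟩
    exact mem_img_of_mem f hx

theorem mem_img_of_le (h : IsEmb P f) (hQ : Q ≤ P) {y : H} : y ∈ img Q f ↔ ∃ x ∈ Q, f x = y :=
  (h.of_le hQ).mem_img

theorem mem_img_iff (h : IsEmb P f) (hQ : Q ≤ P) {x : G} (hx : x ∈ P) :
    f x ∈ img Q f ↔ x ∈ Q := by
  rw [h.mem_img_of_le hQ]
  constructor
  · rintro ⟨y, hy, e⟩
    rwa [← h.injOn (hQ hy) hx e]
  · exact fun hx => ⟨x, hx, rfl⟩

theorem coe_img (h : IsEmb P f) : (img P f : Set H) = f '' P := by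
  ext y
  exact h.mem_img

theorem card_img (h : IsEmb P f) : Nat.card (img P f) = Nat.card P := by
  have : Nat.card (f '' (P : Set G)) = Nat.card (P : Set G) :=
    Nat.card_image_of_injOn h.injOn
  rw [← h.coe_img] at this
  exact this

theorem pinv_apply (h : IsEmb P f) {x : G} (hx : x ∈ P) : pinv P f (f x) = x :=
  h.injOn.leftInvOn_invFunOn hx

theorem apply_pinv (h : IsEmb P f) {y : H} (hy : y ∈ img P f) : f (pinv P f y) = y := by
  obtain ⟨x, hx, rfl⟩ := h.mem_img.mp hy
  rw [h.pinv_apply hx]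

theorem pinv_mem (h : IsEmb P f) {y : H} (hy : y ∈ img P f) : pinv P f y ∈ P := by
  obtain ⟨x, hx, rfl⟩ := h.mem_img.mp hy
  rwa [h.pinv_apply hx]

protected theorem pinv (h : IsEmb P f) : IsEmb (img P f) (pinv P f) := by
  refine ⟨fun x hx y hy => ?_, fun x hx y hy e => ?_⟩
  · obtain ⟨x, hx', rfl⟩ := h.mem_img.mp hx
    obtain ⟨y, hy', rfl⟩ := h.mem_img.mp hy
    rw [← h.map_mul x hx' y hy', h.pinv_apply hx', h.pinv_apply hy',
      h.pinv_apply (P.mul_mem hx' hy')]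
  · rw [← h.apply_pinv hx, ← h.apply_pinv hy, e]

theorem img_pinv (h : IsEmb P f) (hQ : Q ≤ P) : img (img Q f) (_root_.pinv P f) = Q := by
  ext y
  rw [h.pinv.mem_img_of_le (img_mono hQ f)]
  constructor
  · rintro ⟨_, hz, rfl⟩
    obtain ⟨x, hx, rfl⟩ := (h.mem_img_of_le hQ).mp hz
    rwa [h.pinv_apply (hQ hx)]
  · exact fun hy => ⟨f y, mem_img_of_mem f hy, h.pinv_apply (hQ hy)⟩

theorem comp (h : IsEmb P f) {R : Subgroup H} {g : H → K} (hg : IsEmb R g) (hR : img P f ≤ R) :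
    IsEmb P (fun x => g (f x)) := by
  rw [img_le_iff] at hR
  refine ⟨fun x hx y hy => ?_, fun x hx y hy e => ?_⟩
  · rw [h.map_mul x hx y hy, hg.map_mul _ (hR x hx) _ (hR y hy)]
  · exact h.injOn hx hy (hg.injOn (hR x hx) (hR y hy) e)

theorem img_comp (h : IsEmb P f) {R : Subgroup H} {g : H → K} (hg : IsEmb R g)
    (hR : img P f ≤ R) : img P (fun x => g (f x)) = img (img P f) g := by
  ext y
  rw [(h.comp hg hR).mem_img, hg.mem_img_of_le hR]
  constructor
  · rintro ⟨x, hx, rfl⟩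
    exact ⟨f x, mem_img_of_mem f hx, rfl⟩
  · rintro ⟨z, hz, rfl⟩
    obtain ⟨x, hx, rfl⟩ := h.mem_img.mp hz
    exact ⟨x, hx, rfl⟩

theorem img_lt (h : IsEmb P f) (hQ : Q < P) : img Q f < img P f := by
  refine lt_of_le_of_ne (img_mono hQ.le f) fun e => hQ.not_ge fun x hx => ?_
  rw [← h.mem_img_iff hQ.le hx, e]
  exact mem_img_of_mem f hx

theorem img_le_normalizer (h : IsEmb P f) (hQ : Q ≤ P)
    (hP : P ≤ Subgroup.normalizer (Q : Set G)) :
    img P f ≤ Subgroup.normalizer (img Q f : Set H) := by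
  rw [Subgroup.le_normalizer_iff] at hP ⊢
  intro y hy z hz
  obtain ⟨y, hy', rfl⟩ := h.mem_img.mp hy
  obtain ⟨z, hz', rfl⟩ := (h.mem_img_of_le hQ).mp hz
  rw [← h.map_conj hy' (hQ hz')]
  exact mem_img_of_mem f (hP y hy' z hz')

/-- An embedding maps elements centralising `Q` to elements centralising the image of `Q`. -/
theorem map_mem_centralizer (h : IsEmb P f) (hQ : Q ≤ P) {c : G} (hc : c ∈ P)
    (hcQ : c ∈ Subgroup.centralizer (Q : Set G)) :
    f c ∈ Subgroup.centralizer (img Q f : Set H) := by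
  rw [Subgroup.mem_centralizer_iff] at hcQ ⊢
  intro y hy
  obtain ⟨y, hy', rfl⟩ := (h.mem_img_of_le hQ).mp hy
  rw [← h.map_mul _ (hQ hy') _ hc, ← h.map_mul _ hc _ (hQ hy'), hcQ y hy']

end IsEmb

theorem MonoidHom.isEmb (φ : G →* H) (hφ : Function.Injective φ) (P : Subgroup G) : IsEmb P φ :=
  ⟨fun x _ y _ => map_mul φ x y, hφ.injOn⟩

theorem img_eq_map (φ : G →* H) (P : Subgroup G) : img P φ = P.map φ := by
  unfold img
  rw [← Subgroup.coe_map, Subgroup.closure_eq]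

theorem conj_isEmb (s : G) (P : Subgroup G) : IsEmb P (fun x => s * x * s⁻¹) :=
  (MulAut.conj s).toMonoidHom.isEmb (MulAut.conj s).injective P

theorem id_isEmb (P : Subgroup G) : IsEmb P (fun x => x) :=
  (MonoidHom.id G).isEmb Function.injective_id P

theorem img_id (P : Subgroup G) : img P (fun x => x) = P := by
  simp [img]

theorem conj_mem_of_mem_normalizer {P : Subgroup G} {g x : G}
    (hg : g ∈ Subgroup.normalizer (P : Set G)) (hx : x ∈ P) : g * x * g⁻¹ ∈ P :=
  (Subgroup.mem_normalizer_iff.mp hg x).mp hx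

theorem inv_conj_mem_of_mem_normalizer {P : Subgroup G} {g x : G}
    (hg : g ∈ Subgroup.normalizer (P : Set G)) (hx : x ∈ P) : g⁻¹ * x * g ∈ P := by
  simpa using conj_mem_of_mem_normalizer (inv_mem hg) hx

theorem mem_normalizer_of_forall_conj_mem [Finite G] {P : Subgroup G} {g : G}
    (h : ∀ x ∈ P, g * x * g⁻¹ ∈ P) : g ∈ Subgroup.normalizer (P : Set G) := by
  rw [Subgroup.mem_normalizer_iff_map_conj_eq]
  have hle : P.map (MulAut.conj g).toMonoidHom ≤ P := by
    rintro _ ⟨x, hx, rfl⟩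
    exact h x hx
  have hfin : Finite P := inferInstance
  exact Subgroup.eq_of_le_of_card_ge hle
    (Nat.card_congr (P.equivMapOfInjective _ (MulAut.conj g).injective).toEquiv).le

theorem img_eq_of_card_le [Finite H] {P : Subgroup G} {R : Subgroup H} {f : G → H}
    (h : IsEmb P f) (hQ : img P f ≤ R) (hc : Nat.card R ≤ Nat.card P) : img P f = R :=
  Subgroup.eq_of_le_of_card_ge hQ (by rwa [h.card_img])

/-- The elements whose conjugation action on `P` agrees with that of an element of `M` lie in `M`
as soon as `M` contains the centraliser of `P`. -/
theorem mem_of_conj_eq {P M : Subgroup G} (hC : Subgroup.centralizer (P : Set G) ≤ M) {a b : G}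
    (hb : b ∈ M) (h : ∀ x ∈ P, a * x * a⁻¹ = b * x * b⁻¹) : a ∈ M := by
  have : b⁻¹ * a ∈ Subgroup.centralizer (P : Set G) := by
    rw [Subgroup.mem_centralizer_iff]
    intro x hx
    have h1 := h x hx
    calc x * (b⁻¹ * a) = b⁻¹ * (b * x * b⁻¹) * a := by group
      _ = b⁻¹ * (a * x * a⁻¹) * a := by rw [h1]
      _ = b⁻¹ * a * x := by group
  have h2 := M.mul_mem hb (hC this)
  rwa [mul_inv_cancel_left] at h2

theorem conj_eq_of_mem_centralizer {P : Subgroup G} {c x : G}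
    (hc : c ∈ Subgroup.centralizer (P : Set G)) (hx : x ∈ P) : c * x * c⁻¹ = x := by
  rw [← Subgroup.mem_centralizer_iff.mp hc x hx, mul_inv_cancel_right]

/-- Proper subgroups of finite `p`-groups are properly contained in their normalisers. -/
theorem IsPGroup.lt_inf_normalizer {p : ℕ} [Fact p.Prime] [Finite G] {R M : Subgroup G}
    (hM : IsPGroup p M) (h : R < M) : R < M ⊓ Subgroup.normalizer (R : Set G) := by
  have hnil : Group.IsNilpotent M := hM.isNilpotent
  have hlt : R.subgroupOf M < ⊤ := by
    rw [lt_top_iff_ne_top, Ne, Subgroup.subgroupOf_eq_top]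
    exact h.not_ge
  have := Group.normalizerCondition_of_isNilpotent _ hlt
  refine lt_of_le_of_ne (le_inf h.le Subgroup.le_normalizer) fun e => this.not_ge fun x hx => ?_
  rw [Subgroup.mem_subgroupOf, e]
  refine ⟨x.2, ?_⟩
  refine Subgroup.mem_normalizer_iff.mpr fun y => ?_
  rw [Subgroup.mem_normalizer_iff] at hx
  constructor
  · intro hy
    exact (hx ⟨y, h.le hy⟩).mp hy
  · intro hy
    have hyM : y ∈ M := by
      have h1 := M.mul_mem (M.mul_mem (M.inv_mem x.2) (h.le hy)) x.2
      have h2 : (x : G)⁻¹ * (x * y * (x : G)⁻¹) * x = y := by group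
      rwa [h2] at h1
    exact (hx ⟨y, hyM⟩).mpr hy

end Embeddings

/-! ### Automorphisms of subgroups, as functions on the ambient group -/

section Automorphisms

variable {G : Type*} {H : Type*} [Group G] [Group H]

/-- The automorphism `a` of the subgroup `P`, as a function on the ambient group. -/
noncomputable def autFun {P : Subgroup G} (a : MulAut P) : G → G :=
  Function.extend Subtype.val (fun x => (a x : G)) id

variable {P : Subgroup G}

theorem autFun_apply (a : MulAut P) {x : G} (hx : x ∈ P) : autFun a x = a ⟨x, hx⟩ :=
  Subtype.val_injective.extend_apply _ _ (⟨x, hx⟩ : P)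

theorem autFun_mem (a : MulAut P) {x : G} (hx : x ∈ P) : autFun a x ∈ P := by
  rw [autFun_apply a hx]
  exact (a _).2

theorem autFun_mul (a b : MulAut P) {x : G} (hx : x ∈ P) :
    autFun (a * b) x = autFun a (autFun b x) := by
  rw [autFun_apply _ (autFun_mem b hx), autFun_apply _ hx]
  simp only [autFun_apply _ hx]
  rfl

theorem autFun_one {x : G} (hx : x ∈ P) : autFun (1 : MulAut P) x = x := by
  rw [autFun_apply _ hx]
  rfl

theorem autFun_inv_self (a : MulAut P) {x : G} (hx : x ∈ P) : autFun a⁻¹ (autFun a x) = x := by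
  rw [← autFun_mul _ _ hx, inv_mul_cancel, autFun_one hx]

theorem autFun_self_inv (a : MulAut P) {x : G} (hx : x ∈ P) : autFun a (autFun a⁻¹ x) = x := by
  rw [← autFun_mul _ _ hx, mul_inv_cancel, autFun_one hx]

theorem autFun_ext {a b : MulAut P} (h : ∀ x ∈ P, autFun a x = autFun b x) : a = b := by
  ext x
  have := h x x.2
  rwa [autFun_apply _ x.2, autFun_apply _ x.2] at this

theorem autFun_isEmb (a : MulAut P) : IsEmb P (autFun a) := by
  refine ⟨fun x hx y hy => ?_, fun x hx y hy e => ?_⟩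
  · rw [autFun_apply a hx, autFun_apply a hy, autFun_apply a (P.mul_mem hx hy), ← Subgroup.coe_mul,
      ← map_mul]
    rfl
  · rw [← autFun_inv_self a hx, e, autFun_inv_self a hy]

theorem img_autFun (a : MulAut P) : img P (autFun a) = P := by
  ext y
  rw [(autFun_isEmb a).mem_img]
  constructor
  · rintro ⟨x, hx, rfl⟩
    exact autFun_mem a hx
  · exact fun hy => ⟨_, autFun_mem a⁻¹ hy, autFun_self_inv a hy⟩

theorem IsEmb.exists_aut {f : G → G} (h : IsEmb P f) (hP : img P f = P) :
    ∃ a : MulAut P, ∀ x ∈ P, autFun a x = f x := by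
  have hm : ∀ x ∈ P, f x ∈ P := fun x hx => hP ▸ mem_img_of_mem f hx
  have hm' : ∀ x ∈ P, pinv P f x ∈ P := fun x hx => h.pinv_mem (hP.symm ▸ hx)
  refine ⟨⟨⟨fun x => ⟨f x, hm x x.2⟩, fun x => ⟨pinv P f x, hm' x x.2⟩, fun x => ?_, fun x => ?_⟩,
    fun x y => ?_⟩, fun x hx => ?_⟩
  · exact Subtype.ext (h.pinv_apply x.2)
  · exact Subtype.ext (h.apply_pinv (hP.symm.le x.2))
  · exact Subtype.ext (h.map_mul x x.2 y y.2)
  · rw [autFun_apply _ hx]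
    rfl

/-- The automorphisms of `P` that the embedding `f` of `P` transports to automorphisms induced by
conjugation by elements of `M`. If `f` is the identity, these are the automorphisms of `P`
induced by conjugation by elements of `M`. -/
def twistAut (M : Subgroup H) (P : Subgroup G) (f : G → H) : Subgroup (MulAut P) where
  carrier := {a | ∃ g ∈ M, ∀ x ∈ P, f (autFun a x) = g * f x * g⁻¹}
  mul_mem' := by
    rintro a b ⟨g, hg, ha⟩ ⟨h, hh, hb⟩
    refine ⟨g * h, M.mul_mem hg hh, fun x hx => ?_⟩
    rw [autFun_mul a b hx, ha _ (autFun_mem b hx), hb x hx]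
    group
  one_mem' := ⟨1, M.one_mem, fun x hx => by rw [autFun_one hx]; group⟩
  inv_mem' := by
    rintro a ⟨g, hg, ha⟩
    refine ⟨g⁻¹, M.inv_mem hg, fun x hx => ?_⟩
    have := ha _ (autFun_mem a⁻¹ hx)
    rw [autFun_self_inv a hx] at this
    rw [this]
    group

theorem isPGroup_twistAut {p : ℕ} (hH : IsPGroup p H) (M : Subgroup H) {f : G → H}
    (hf : IsEmb P f) : IsPGroup p (twistAut M P f) := by
  rintro ⟨a, g, -, ha⟩
  have key : ∀ n : ℕ, ∀ x ∈ P, f (autFun (a ^ n) x) = g ^ n * f x * (g ^ n)⁻¹ := by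
    intro n
    induction n with
    | zero => intro x hx; rw [pow_zero, autFun_one hx]; group
    | succ n ih =>
      intro x hx
      rw [pow_succ, autFun_mul _ _ hx, ih _ (autFun_mem a hx), ha x hx, pow_succ]
      group
  obtain ⟨k, hk⟩ := hH g
  refine ⟨k, Subtype.ext (autFun_ext fun x hx => hf.injOn (autFun_mem _ hx) (autFun_mem _ hx) ?_)⟩
  rw [Subgroup.coe_pow, Subgroup.coe_one, key _ x hx, autFun_one hx, hk]
  group

theorem exists_mem_twistAut {M : Subgroup H} {f : G → H} (hf : IsEmb P f) {g : H} (hg : g ∈ M)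
    (hN : g ∈ Subgroup.normalizer (img P f : Set H)) :
    ∃ a ∈ twistAut M P f, ∀ x ∈ P, f (autFun a x) = g * f x * g⁻¹ := by
  have h1 : IsEmb P fun x => g * f x * g⁻¹ :=
    hf.comp (conj_isEmb g (img P f)) le_rfl
  have hle : img P (fun x => g * f x * g⁻¹) = img P f := by
    ext y
    rw [h1.mem_img]
    constructor
    · rintro ⟨x, hx, rfl⟩
      exact conj_mem_of_mem_normalizer hN (mem_img_of_mem f hx)
    · intro hy
      obtain ⟨x, hx, e⟩ := hf.mem_img.mp (inv_conj_mem_of_mem_normalizer hN hy)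
      exact ⟨x, hx, by rw [e]; group⟩
  have h2 : IsEmb P fun x => pinv P f (g * f x * g⁻¹) := h1.comp hf.pinv hle.le
  have h3 : img P (fun x => pinv P f (g * f x * g⁻¹)) = P := by
    rw [h1.img_comp hf.pinv hle.le, hle, hf.img_pinv le_rfl]
  obtain ⟨a, ha⟩ := h2.exists_aut h3
  have key : ∀ x ∈ P, f (autFun a x) = g * f x * g⁻¹ := fun x hx => by
    rw [ha x hx, hf.apply_pinv (conj_mem_of_mem_normalizer hN (mem_img_of_mem f hx))]
  exact ⟨a, ⟨g, hg, key⟩, key⟩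

theorem exists_mem_twistAut_id {M : Subgroup G} {g : G} (hg : g ∈ M)
    (hN : g ∈ Subgroup.normalizer (P : Set G)) :
    ∃ a ∈ twistAut M P (fun x => x), ∀ x ∈ P, autFun a x = g * x * g⁻¹ :=
  exists_mem_twistAut (id_isEmb P) hg (by rwa [img_id])

/-- The group `N_f` of the extension axiom, for an embedding `f` of `P`: the elements of the
normaliser of `P` whose action on `P` is transported by `f` to conjugation by some element. -/
def transporter (P : Subgroup G) (f : G → H) : Subgroup G where
  carrier := {g | g ∈ Subgroup.normalizer (P : Set G) ∧
    ∃ h, ∀ x ∈ P, f (g * x * g⁻¹) = h * f x * h⁻¹}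
  mul_mem' := by
    rintro a b ⟨ha, h, hh⟩ ⟨hb, k, hk⟩
    refine ⟨mul_mem ha hb, h * k, fun x hx => ?_⟩
    have h1 := hh _ (conj_mem_of_mem_normalizer hb hx)
    rw [hk x hx] at h1
    rw [show a * b * x * (a * b)⁻¹ = a * (b * x * b⁻¹) * a⁻¹ by group, h1]
    group
  one_mem' := ⟨one_mem _, 1, fun x _ => by simp⟩
  inv_mem' := by
    rintro a ⟨ha, h, hh⟩
    refine ⟨inv_mem ha, h⁻¹, fun x hx => ?_⟩
    have h1 := hh _ (inv_conj_mem_of_mem_normalizer ha hx)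
    rw [show a * (a⁻¹ * x * a) * a⁻¹ = x by group] at h1
    rw [h1, inv_inv]
    group

theorem le_transporter {f : G → H} (hf : IsEmb P f) : P ≤ transporter P f :=
  fun g hg => ⟨Subgroup.le_normalizer hg, f g, fun _ hx => hf.map_conj hg hx⟩

/-- Two `p`-subgroups of a finite group `A` can be moved into a common `p`-subgroup. -/
theorem exists_common_pSubgroup {p : ℕ} [Fact p.Prime] [Finite G] {A D D' : Subgroup G}
    (hD : IsPGroup p D) (hD' : IsPGroup p D') (hDA : D ≤ A) (hDA' : D' ≤ A) :
    ∃ T ≤ A, IsPGroup p T ∧ D ≤ T ∧ ∃ a ∈ A, ∀ d ∈ D', a * d * a⁻¹ ∈ T := by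
  obtain ⟨Q, hQ⟩ := (hD.comap_subtype (K := A)).exists_le_sylow
  obtain ⟨Q', hQ'⟩ := (hD'.comap_subtype (K := A)).exists_le_sylow
  obtain ⟨a, ha⟩ := MulAction.exists_smul_eq A Q' Q
  refine ⟨(Q : Subgroup A).map A.subtype, Subgroup.map_subtype_le _, Q.2.map _, fun d hd => ?_,
    a, a.2, fun d hd => ?_⟩
  · exact ⟨⟨d, hDA hd⟩, hQ hd, rfl⟩
  · refine ⟨a * ⟨d, hDA' hd⟩ * a⁻¹, ?_, rfl⟩
    rw [← ha]
    exact Subgroup.smul_mem_pointwise_smul _ (MulAut.conj a) _ (hQ' hd)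

end Automorphisms

/-! ### Morphisms of fusion systems as functions -/

namespace FusionSystem

variable {p : ℕ} {S : Type w} [Group S] (F : FusionSystem p S)

/-- On the subgroup `P`, the function `f` is a morphism from `P` to `S` of the fusion system. -/
def IsMor (P : Subgroup S) (f : S → S) : Prop :=
  ∃ φ ∈ F.Hom P ⊤, ∀ x : P, f x = φ x

variable {F}

theorem inclusion_mem_hom (F : FusionSystem p S) {P Q : Subgroup S} (h : P ≤ Q) :
    Subgroup.inclusion h ∈ F.Hom P Q :=
  F.conj_mem 1 _ fun x => by simp

theorem isMor_of_mem_hom {P Q : Subgroup S} {φ : P →* Q} (hφ : φ ∈ F.Hom P Q) {f : S → S}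
    (hf : ∀ x : P, f x = φ x) : F.IsMor P f :=
  ⟨_, F.comp_mem hφ (F.inclusion_mem_hom le_top), fun x => by rw [hf x]; rfl⟩

theorem IsMor.mem_hom {P Q : Subgroup S} {f : S → S} (h : F.IsMor P f) {φ : P →* Q}
    (hf : ∀ x : P, f x = φ x) : φ ∈ F.Hom P Q := by
  obtain ⟨φ₀, h₀, hf₀⟩ := h
  obtain ⟨R, hR, ψ, hψ, -, rfl⟩ := F.factor h₀
  have hRQ : R ≤ Q := by
    intro r hr
    obtain ⟨x, hx⟩ := ψ.surjective ⟨r, hr⟩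
    have h1 : r = f x := by
      rw [hf₀ x]
      simp [hx]
    rw [h1, hf x]
    exact (φ x).2
  have : φ = (Subgroup.inclusion hRQ).comp ψ.toMonoidHom := by
    ext x
    rw [← hf x, hf₀ x]
    rfl
  rw [this]
  exact F.comp_mem hψ (F.inclusion_mem_hom hRQ)

namespace IsMor

variable {P Q : Subgroup S} {f : S → S}

theorem isEmb (h : F.IsMor P f) : IsEmb P f := by
  obtain ⟨φ, hφ, hf⟩ := h
  refine ⟨fun x hx y hy => ?_, fun x hx y hy e => ?_⟩
  · rw [hf ⟨x, hx⟩, hf ⟨y, hy⟩, hf ⟨x * y, P.mul_mem hx hy⟩, ← Subgroup.coe_mul, ← map_mul]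
    rfl
  · rw [hf ⟨x, hx⟩, hf ⟨y, hy⟩] at e
    exact congrArg Subtype.val (F.injective hφ (Subtype.ext e))

theorem congr (h : F.IsMor P f) {g : S → S} (hg : ∀ x ∈ P, g x = f x) : F.IsMor P g := by
  obtain ⟨φ, hφ, hf⟩ := h
  exact ⟨φ, hφ, fun x => by rw [hg x x.2, hf x]⟩

theorem of_le (h : F.IsMor P f) (hQ : Q ≤ P) : F.IsMor Q f := by
  obtain ⟨φ, hφ, hf⟩ := h
  exact ⟨_, F.comp_mem (F.inclusion_mem_hom hQ) hφ, fun x => hf (Subgroup.inclusion hQ x)⟩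

theorem exists_iso (h : F.IsMor P f) (hQ : img P f = Q) : ∃ e ∈ F.Iso P Q, ∀ x : P, f x = e x := by
  have hE := h.isEmb
  obtain ⟨φ, hφ, hf⟩ := h
  obtain ⟨R, hR, ψ, hψ, hψ', rfl⟩ := F.factor hφ
  have : R = Q := by
    rw [← hQ]
    ext r
    rw [hE.mem_img]
    constructor
    · intro hr
      obtain ⟨x, hx⟩ := ψ.surjective ⟨r, hr⟩
      exact ⟨x, x.2, by rw [hf x]; simp [hx]⟩
    · rintro ⟨x, hx, rfl⟩
      rw [hf ⟨x, hx⟩]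
      exact (ψ ⟨x, hx⟩).2
  subst this
  exact ⟨ψ, ⟨hψ, hψ'⟩, hf⟩

theorem comp (h : F.IsMor P f) {R : Subgroup S} {g : S → S} (hg : F.IsMor R g)
    (hR : img P f ≤ R) : F.IsMor P (fun x => g (f x)) := by
  obtain ⟨e, he, hf⟩ := h.exists_iso rfl
  obtain ⟨ψ, hψ, hgψ⟩ := hg.of_le hR
  exact ⟨_, F.comp_mem he.1 hψ, fun x => by
    simp only [hf x]
    exact hgψ (e x)⟩

protected theorem pinv (h : F.IsMor P f) : F.IsMor (img P f) (pinv P f) := by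
  obtain ⟨e, he, hf⟩ := h.exists_iso rfl
  refine isMor_of_mem_hom he.2 fun y => ?_
  obtain ⟨x, rfl⟩ := e.surjective y
  rw [← hf x, h.isEmb.pinv_apply x.2]
  simp

end IsMor

theorem isMor_conj (F : FusionSystem p S) (P : Subgroup S) (s : S) :
    F.IsMor P fun x => s * x * s⁻¹ :=
  ⟨((MulAut.conj s).toMonoidHom.comp P.subtype).codRestrict ⊤ fun _ => trivial,
    F.conj_mem s _ fun _ => rfl, fun _ => rfl⟩

theorem isMor_id (F : FusionSystem p S) (P : Subgroup S) : F.IsMor P fun x => x :=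
  (F.isMor_conj P 1).congr fun x _ => by simp

theorem conj_iff {P Q : Subgroup S} : F.Conj P Q ↔ ∃ f, F.IsMor P f ∧ img P f = Q := by
  constructor
  · rintro ⟨e, he⟩
    have hext : ∀ x : P, Function.extend Subtype.val (fun x => (e x : S)) id x = e x :=
      fun x => Subtype.val_injective.extend_apply _ _ x
    have hm : F.IsMor P _ := isMor_of_mem_hom he.1 hext
    refine ⟨_, hm, ?_⟩
    ext y
    rw [hm.isEmb.mem_img]
    constructor
    · rintro ⟨x, hx, rfl⟩
      rw [hext ⟨x, hx⟩]
      exact (e _).2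
    · intro hy
      exact ⟨e.symm ⟨y, hy⟩, (e.symm ⟨y, hy⟩).2, by rw [hext]; simp⟩
  · rintro ⟨f, hf, hQ⟩
    obtain ⟨e, he, -⟩ := hf.exists_iso hQ
    exact ⟨e, he⟩

theorem mem_aut_iff {P : Subgroup S} {a : MulAut P} : a ∈ F.aut P ↔ F.IsMor P (autFun a) := by
  constructor
  · intro h
    exact isMor_of_mem_hom h.1 fun x => autFun_apply a x.2
  · intro h
    refine ⟨h.mem_hom fun x => autFun_apply a x.2, h.pinv.of_le (img_autFun a).ge |>.mem_hom ?_⟩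
    intro x
    have h1 : autFun a (autFun a⁻¹ x) = x := autFun_self_inv a x.2
    have h2 := h.isEmb.pinv_apply (autFun_mem a⁻¹ x.2)
    rw [h1] at h2
    rw [h2, autFun_apply _ x.2]
    rfl

theorem twistAut_le_aut {P : Subgroup S} {f : S → S} (hf : F.IsMor P f) (M : Subgroup S) :
    twistAut M P f ≤ F.aut P := by
  rintro a ⟨g, -, ha⟩
  rw [mem_aut_iff]
  have h1 := hf.comp (F.isMor_conj (img P f) g) le_rfl
  have hi : img P (fun x => g * f x * g⁻¹) ≤ img P f := by
    rw [img_le_iff]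
    intro x hx
    rw [← ha x hx]
    exact mem_img_of_mem f (autFun_mem a hx)
  refine (h1.comp hf.pinv hi).congr fun x hx => ?_
  rw [← ha x hx, hf.isEmb.pinv_apply (autFun_mem a hx)]

end FusionSystem

section Transport

variable {G : Type*} {H : Type*} [Group G] [Group H]

/-- A group of automorphisms of `P` is transported by an embedding of `P` to a group of
automorphisms of the image of `P`. -/
theorem IsEmb.exists_transported {P : Subgroup G} {f : G → H} (hf : IsEmb P f) {p : ℕ}
    {T : Subgroup (MulAut P)} (hT : IsPGroup p T) {Q : Subgroup H} (hQ : img P f = Q) :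
    ∃ T' : Subgroup (MulAut Q), IsPGroup p T' ∧
      (∀ t' ∈ T', ∃ t ∈ T, ∀ x ∈ P, autFun t' (f x) = f (autFun t x)) ∧
      ∀ t ∈ T, ∃ t' ∈ T', ∀ x ∈ P, autFun t' (f x) = f (autFun t x) := by
  subst hQ
  let e : P ≃* img P f :=
    { toFun := fun x => ⟨f x, mem_img_of_mem f x.2⟩
      invFun := fun y => ⟨_root_.pinv P f y, hf.pinv_mem y.2⟩
      left_inv := fun x => Subtype.ext (hf.pinv_apply x.2)
      right_inv := fun y => Subtype.ext (hf.apply_pinv y.2)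
      map_mul' := fun x y => Subtype.ext (hf.map_mul x x.2 y y.2) }
  have key : ∀ t : MulAut P, ∀ x ∈ P, autFun (MulAut.congr e t) (f x) = f (autFun t x) := by
    intro t x hx
    rw [autFun_apply _ (mem_img_of_mem f hx), autFun_apply _ hx]
    change f (t (e.symm (e ⟨x, hx⟩))) = _
    rw [e.symm_apply_apply]
  refine ⟨T.map (MulAut.congr e).toMonoidHom, hT.map _, ?_, fun t ht => ⟨_, ⟨t, ht, rfl⟩, key t⟩⟩
  rintro _ ⟨t, ht, rfl⟩
  exact ⟨t, ht, key t⟩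

end Transport

/-! ### Saturation at a conjugacy class of subgroups -/

namespace FusionSystem

variable {p : ℕ} {S : Type w} [Group S] (F : FusionSystem p S)

/-- Every `p`-group of automorphisms of `Q` in `F` is moved by some element of `Aut_F(Q)` into
`Aut_S(Q)`; in other words, `Q` is fully automised. -/
def Automised (Q : Subgroup S) : Prop :=
  ∀ T : Subgroup (MulAut Q), T ≤ F.aut Q → IsPGroup p T →
    ∃ f, F.IsMor Q f ∧ img Q f = Q ∧ T ≤ twistAut ⊤ Q f

/-- Every isomorphism `f` onto `Q` of the fusion system extends to `N_f`. -/
def Receptive (Q : Subgroup S) : Prop :=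
  ∀ (P : Subgroup S) (f : S → S), F.IsMor P f → img P f = Q →
    ∃ f', F.IsMor (transporter P f) f' ∧ ∀ x ∈ P, f' x = f x

/-- The conjugacy class of `P` contains a fully automised and receptive subgroup. A fusion system
is saturated if and only if this holds for all its subgroups. -/
def SaturatedAt (P : Subgroup S) : Prop :=
  ∃ Q, (∃ f, F.IsMor P f ∧ img P f = Q) ∧ F.Automised Q ∧ F.Receptive Q

variable {F}

theorem IsMor.map_aut {P : Subgroup S} {f : S → S} (hf : F.IsMor P f) {Q : Subgroup S}
    (hQ : img P f = Q) {t : MulAut P} (ht : t ∈ F.aut P) {t' : MulAut Q}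
    (h : ∀ x ∈ P, autFun t' (f x) = f (autFun t x)) : t' ∈ F.aut Q := by
  subst hQ
  rw [mem_aut_iff] at ht ⊢
  have h1 := hf.pinv.comp ht (hf.isEmb.img_pinv le_rfl).le
  refine (h1.comp hf ?_).congr fun y hy => ?_
  · rw [img_le_iff]
    intro y hy
    exact autFun_mem t (hf.isEmb.pinv_mem hy)
  · obtain ⟨x, hx, rfl⟩ := hf.isEmb.mem_img.mp hy
    rw [h x hx, hf.isEmb.pinv_apply hx]

/-- A `p`-group of automorphisms of a conjugate `P` of `Q` can be moved into `Aut_S(Q)` if `Q` is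
fully automised. -/
theorem Automised.exists_lift {Q : Subgroup S} (hQ : F.Automised Q) {P : Subgroup S} {f : S → S}
    (hf : F.IsMor P f) (hfQ : img P f = Q) {T : Subgroup (MulAut P)} (hT : T ≤ F.aut P)
    (hTp : IsPGroup p T) : ∃ τ, F.IsMor P τ ∧ img P τ = Q ∧ T ≤ twistAut ⊤ P τ := by
  obtain ⟨T', hT', h1, h2⟩ := hf.isEmb.exists_transported hTp hfQ
  obtain ⟨g, hg, hgQ, hgT⟩ := hQ T' (fun t' ht' => by
    obtain ⟨t, ht, h⟩ := h1 t' ht'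
    exact hf.map_aut hfQ (hT ht) h) hT'
  refine ⟨_, hf.comp hg hfQ.le, ?_, fun t ht => ?_⟩
  · rw [hf.isEmb.img_comp hg.isEmb hfQ.le, hfQ, hgQ]
  · obtain ⟨t', ht', h⟩ := h2 t ht
    obtain ⟨s, hs, hst⟩ := hgT ht'
    refine ⟨s, hs, fun x hx => ?_⟩
    dsimp only
    rw [← h x hx]
    exact hst _ (hfQ ▸ mem_img_of_mem f hx)

theorem exists_normalizer_map {Q : Subgroup S} (hQ : F.Automised Q) (hQ' : F.Receptive Q)
    {P : Subgroup S} {f : S → S} (hf : F.IsMor P f) (hfQ : img P f = Q) :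
    ∃ α, F.IsMor (Subgroup.normalizer (P : Set S)) α ∧ img P α = Q := by
  obtain ⟨τ, hτ, hτQ, hT⟩ := hQ.exists_lift hf hfQ (twistAut_le_aut (F.isMor_id P) ⊤)
    (isPGroup_twistAut F.isPGroup ⊤ (id_isEmb P))
  obtain ⟨α, hα, h⟩ := hQ' P τ hτ hτQ
  refine ⟨α, hα.of_le fun g hg => ⟨hg, ?_⟩, by rw [img_congr h, hτQ]⟩
  obtain ⟨a, ha, hag⟩ := exists_mem_twistAut_id (M := ⊤) trivial hg
  obtain ⟨s, -, hs⟩ := hT ha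
  exact ⟨s, fun x hx => by rw [← hag x hx, hs x hx]⟩

/-- Let `A` be a group of automorphisms of `R` in `F` containing the automorphisms induced by `M`
and those that the isomorphism `f : R → R'` transports to automorphisms induced by `M'`. Then, up to
an element `a` of `A`, the isomorphism `f` is the composite of a morphism
on the group generated by `R` and `M` and the inverse of a morphism on the group generated by
`R'` and `M'`. This follows from the theorem of Sylow for `A`. -/
theorem SaturatedAt.exists_common_extension [Fact p.Prime] {R : Subgroup S} (hR : F.SaturatedAt R)
    {A : Subgroup (MulAut R)} (hA : A ≤ F.aut R) {f : S → S} (hf : F.IsMor R f)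
    {M M' : Subgroup S} (hM : M ≤ Subgroup.normalizer (R : Set S))
    (hM' : M' ≤ Subgroup.normalizer (img R f : Set S))
    (hMA : twistAut M R (fun x => x) ≤ A) (hMA' : twistAut M' R f ≤ A) :
    ∃ τ τ', ∃ a ∈ A, F.IsMor (R ⊔ M) τ ∧ F.IsMor (img R f ⊔ M') τ' ∧
      ∀ x ∈ R, τ' (f x) = τ (autFun a x) := by
  have := F.finite
  obtain ⟨Q, ⟨g, hg, hgQ⟩, hQ, hQ'⟩ := hR
  obtain ⟨T, hTA, hTp, hDT, a, ha, hT⟩ := exists_common_pSubgroup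
    (isPGroup_twistAut F.isPGroup M (id_isEmb R)) (isPGroup_twistAut F.isPGroup M' hf.isEmb)
    hMA hMA'
  obtain ⟨τ, hτ, hτQ, hτT⟩ := hQ.exists_lift hg hgQ (hTA.trans hA) hTp
  have haR := mem_aut_iff.mp (hA ha)
  have himg : img (img R f) (pinv R f) = R := hf.isEmb.img_pinv le_rfl
  have h1 := hf.pinv.comp haR himg.le
  have hi1 : img (img R f) (fun y => autFun a (pinv R f y)) = R := by
    rw [hf.isEmb.pinv.img_comp haR.isEmb himg.le, himg, img_autFun]
  have h2 := h1.comp hτ hi1.le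
  have hi2 : img (img R f) (fun y => τ (autFun a (pinv R f y))) = Q := by
    rw [h1.isEmb.img_comp hτ.isEmb hi1.le, hi1, hτQ]
  obtain ⟨τ₁, hτ₁, e₁⟩ := hQ' R τ hτ hτQ
  obtain ⟨τ₂, hτ₂, e₂⟩ := hQ' _ _ h2 hi2
  refine ⟨τ₁, τ₂, a, ha, hτ₁.of_le (sup_le (le_transporter hτ.isEmb) fun g hg => ⟨hM hg, ?_⟩),
    hτ₂.of_le (sup_le (le_transporter h2.isEmb) fun g hg => ⟨hM' hg, ?_⟩), fun x hx => ?_⟩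
  · obtain ⟨d, hd, hdg⟩ := exists_mem_twistAut_id hg (hM hg)
    obtain ⟨s, -, hs⟩ := hτT (hDT hd)
    exact ⟨s, fun x hx => by rw [← hdg x hx, hs x hx]⟩
  · obtain ⟨d, hd, hdg⟩ := exists_mem_twistAut hf.isEmb hg (hM' hg)
    obtain ⟨s, -, hs⟩ := hτT (hT d hd)
    refine ⟨s, fun y hy => ?_⟩
    obtain ⟨x, hx, rfl⟩ := hf.isEmb.mem_img.mp hy
    have h3 := hs _ (autFun_mem a hx)
    have h4 : autFun (a * d * a⁻¹) (autFun a x) = autFun a (autFun d x) := by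
      rw [← autFun_mul _ _ hx, ← autFun_mul _ _ hx, inv_mul_cancel_right]
    rw [h4] at h3
    dsimp only
    rw [← hdg x hx, hf.isEmb.pinv_apply hx, hf.isEmb.pinv_apply (autFun_mem d hx), h3]
  · rw [e₂ _ (mem_img_of_mem f hx), hf.isEmb.pinv_apply hx, e₁ _ (autFun_mem a hx)]

/-- If `f` and `g` are morphisms on `P` and `M`, and the image of `f` lies in that of `g`, then
`f` followed by the inverse of `g` is a morphism. -/
theorem IsMor.comp_pinv {P M : Subgroup S} {f g : S → S} (hf : F.IsMor P f) (hg : F.IsMor M g)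
    (h : img P f ≤ img M g) : F.IsMor P fun x => pinv M g (f x) :=
  hf.comp hg.pinv h

theorem IsMor.map_normalizer {P Q M : Subgroup S} {f : S → S} (hf : F.IsMor M f) (hPM : P ≤ M)
    (hM : M ≤ Subgroup.normalizer (P : Set S)) (hQ : img P f = Q) :
    img M f ≤ Subgroup.normalizer (Q : Set S) :=
  hQ ▸ hf.isEmb.img_le_normalizer hPM hM

theorem centralizer_le_normalizer (P : Subgroup S) :
    Subgroup.centralizer (P : Set S) ≤ Subgroup.normalizer (P : Set S) :=
  Subgroup.centralizer_le_normalizer _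

/-- A subgroup `P` with a receptive conjugate `Q` is itself receptive if its normaliser maps to that
of `Q` in such a way that the centraliser of `Q` is contained in the image. -/
theorem Receptive.of_normalizer_map {P Q : Subgroup S} (hQ : F.Receptive Q) {α : S → S}
    (hα : F.IsMor (Subgroup.normalizer (P : Set S)) α) (hαQ : img P α = Q)
    (hC : Subgroup.centralizer (Q : Set S) ≤ img (Subgroup.normalizer (P : Set S)) α) :
    F.Receptive P := by
  intro R f hf hfP
  have hαP := hα.of_le (Subgroup.le_normalizer (H := P))
  have hN := hα.map_normalizer Subgroup.le_normalizer le_rfl hαQ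
  have h1 := hf.comp hαP hfP.le
  have hi1 : img R (fun x => α (f x)) = Q := by
    rw [hf.isEmb.img_comp hαP.isEmb hfP.le, hfP, hαQ]
  obtain ⟨χ, hχ, e⟩ := hQ _ _ h1 hi1
  have hfm : ∀ x ∈ R, f x ∈ P := fun x hx => hfP ▸ mem_img_of_mem f hx
  have key : ∀ g ∈ transporter R f, ∃ h ∈ Subgroup.normalizer (P : Set S),
      ∀ x ∈ R, f (g * x * g⁻¹) = h * f x * h⁻¹ := by
    have := F.finite
    rintro g ⟨hg, h, hh⟩
    refine ⟨h, mem_normalizer_of_forall_conj_mem fun y hy => ?_, hh⟩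
    obtain ⟨x, hx, rfl⟩ := hf.isEmb.mem_img.mp (hfP.symm ▸ hy)
    rw [← hh x hx]
    exact hfm _ (conj_mem_of_mem_normalizer hg hx)
  have hα2 : ∀ g ∈ transporter R f, ∀ h ∈ Subgroup.normalizer (P : Set S),
      (∀ x ∈ R, f (g * x * g⁻¹) = h * f x * h⁻¹) →
      ∀ x ∈ R, α (f (g * x * g⁻¹)) = α h * α (f x) * (α h)⁻¹ := fun g hg h hh hgh x hx => by
    rw [hgh x hx, hα.isEmb.map_conj hh (Subgroup.le_normalizer (hfm x hx))]
  have hle : transporter R f ≤ transporter R fun x => α (f x) := by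
    intro g hg
    obtain ⟨h, hh, hgh⟩ := key g hg
    exact ⟨hg.1, α h, hα2 g hg h hh hgh⟩
  have hRt := le_transporter hf.isEmb
  have himg : img (transporter R f) χ ≤ img (Subgroup.normalizer (P : Set S)) α := by
    rw [img_le_iff]
    intro g hg
    obtain ⟨h, hh, hgh⟩ := key g hg
    refine mem_of_conj_eq hC (mem_img_of_mem α hh) fun y hy => ?_
    rw [← hi1, h1.isEmb.mem_img] at hy
    obtain ⟨x, hx, rfl⟩ := hy
    rw [← hα2 g hg h hh hgh x hx, ← e _ (conj_mem_of_mem_normalizer hg.1 hx), ← e x hx,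
      hχ.isEmb.map_conj (hle hg) (hle (hRt hx))]
  refine ⟨_, (hχ.of_le hle).comp_pinv hα himg, fun x hx => ?_⟩
  rw [e x hx, hα.isEmb.pinv_apply (Subgroup.le_normalizer (hfm x hx))]

theorem IsMor.map_centralizer {P Q : Subgroup S} {α : S → S}
    (hα : F.IsMor (Subgroup.normalizer (P : Set S)) α) (hαQ : img P α = Q) :
    img (Subgroup.centralizer (P : Set S)) α ≤ Subgroup.centralizer (Q : Set S) := by
  rw [img_le_iff]
  intro c hc
  subst hαQ
  exact hα.isEmb.map_mem_centralizer Subgroup.le_normalizer (centralizer_le_normalizer P hc) hc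

theorem IsMor.card_centralizer_le {P Q : Subgroup S} {α : S → S}
    (hα : F.IsMor (Subgroup.normalizer (P : Set S)) α) (hαQ : img P α = Q) :
    Nat.card (Subgroup.centralizer (P : Set S)) ≤ Nat.card (Subgroup.centralizer (Q : Set S)) := by
  have := F.finite
  rw [← (hα.of_le (centralizer_le_normalizer P)).isEmb.card_img]
  exact Subgroup.card_le_of_le (hα.map_centralizer hαQ)

theorem IsMor.img_centralizer {P Q : Subgroup S} {α : S → S}
    (hα : F.IsMor (Subgroup.normalizer (P : Set S)) α) (hαQ : img P α = Q)
    (h : Nat.card (Subgroup.centralizer (Q : Set S)) ≤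
      Nat.card (Subgroup.centralizer (P : Set S))) :
    img (Subgroup.centralizer (P : Set S)) α = Subgroup.centralizer (Q : Set S) := by
  have := F.finite
  exact img_eq_of_card_le (hα.of_le (centralizer_le_normalizer P)).isEmb (hα.map_centralizer hαQ) h

theorem Receptive.of_card_centralizer_le {P Q : Subgroup S} (hQ : F.Receptive Q) {α : S → S}
    (hα : F.IsMor (Subgroup.normalizer (P : Set S)) α) (hαQ : img P α = Q)
    (h : Nat.card (Subgroup.centralizer (Q : Set S)) ≤
      Nat.card (Subgroup.centralizer (P : Set S))) :
    F.Receptive P := by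
  refine hQ.of_normalizer_map hα hαQ ?_
  rw [← hα.img_centralizer hαQ h]
  exact img_mono (centralizer_le_normalizer P) α

theorem image_eq_img {P : Subgroup S} {f : S → S} {φ : P →* (⊤ : Subgroup S)}
    (h : ∀ x : P, f x = φ x) : image φ = img P f := by
  unfold image img
  rw [← Subgroup.closure_eq (MonoidHom.range _)]
  congr 1
  ext y
  constructor
  · rintro ⟨x, rfl⟩
    exact ⟨x, x.2, h x⟩
  · rintro ⟨x, hx, rfl⟩
    exact ⟨⟨x, hx⟩, (h ⟨x, hx⟩).symm⟩

theorem extender_eq_transporter {P : Subgroup S} {f : S → S} (hf : F.IsMor P f)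
    {φ : P →* (⊤ : Subgroup S)} (h : ∀ x : P, f x = φ x) : extender φ = transporter P f := by
  have hcoe : ∀ g (hg : g ∈ Subgroup.normalizer (P : Set S)), ∀ x : P,
      (φ (P.normalizerMonoidHom ⟨g, hg⟩ x) : S) = f (g * x * g⁻¹) := fun g hg x => (h _).symm
  have := F.finite
  ext g
  constructor
  · rintro ⟨hg, k, -, hk⟩
    refine ⟨hg, k, fun x hx => ?_⟩
    have := hk ⟨x, hx⟩
    rw [hcoe] at this
    rw [this, h ⟨x, hx⟩]
  · rintro ⟨hg, k, hk⟩
    refine ⟨hg, k, ?_, fun x => ?_⟩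
    · rw [image_eq_img h]
      refine mem_normalizer_of_forall_conj_mem fun y hy => ?_
      obtain ⟨x, hx, rfl⟩ := hf.isEmb.mem_img.mp hy
      rw [← hk x hx]
      exact mem_img_of_mem f (conj_mem_of_mem_normalizer hg hx)
    · rw [hcoe, hk x x.2, h x]

theorem autAmbient_eq_twistAut (P : Subgroup S) :
    autAmbient P = twistAut ⊤ P (fun x => x) := by
  ext a
  constructor
  · rintro ⟨g, rfl⟩
    refine ⟨g, trivial, fun x hx => ?_⟩
    rw [autFun_apply _ hx]
    rfl
  · rintro ⟨g, -, hg⟩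
    have hN : ∀ x ∈ P, g * x * g⁻¹ ∈ P := fun x hx => by
      rw [← hg x hx]
      exact autFun_mem a hx
    have hN' : ∀ x ∈ P, g⁻¹ * x * g ∈ P := fun x hx => by
      have h1 := hg _ (autFun_mem a⁻¹ hx)
      simp only [autFun_self_inv a hx] at h1
      have h2 : autFun a⁻¹ x = g⁻¹ * x * g := by
        conv_rhs => rw [h1]
        group
      rw [← h2]
      exact autFun_mem a⁻¹ hx
    refine ⟨⟨g, Subgroup.mem_normalizer_iff.mpr fun x => ⟨hN x, fun hx => ?_⟩⟩, ?_⟩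
    · have := hN' _ hx
      rwa [show g⁻¹ * (g * x * g⁻¹) * g = x by group] at this
    · refine autFun_ext fun x hx => ?_
      refine Eq.trans ?_ (hg x hx).symm
      rw [autFun_apply _ hx]
      rfl

theorem Automised.of_fullyAutomised [Fact p.Prime] {Q : Subgroup S} (h : F.FullyAutomised Q) :
    F.Automised Q := by
  have := F.finite
  intro T hT hTp
  obtain ⟨Z, hZ⟩ := h
  obtain ⟨Z', hZ'⟩ := (hTp.comap_subtype (K := F.aut Q)).exists_le_sylow
  obtain ⟨a, ha⟩ := MulAction.exists_smul_eq (F.aut Q) Z' Z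
  have haM := mem_aut_iff.mp a.2
  refine ⟨autFun (a : MulAut Q), haM, img_autFun _, fun t ht => ?_⟩
  have h1 : ((a * ⟨t, hT ht⟩ * a⁻¹ : F.aut Q) : MulAut Q) ∈ autAmbient Q := by
    rw [← hZ, ← ha]
    exact ⟨_, Subgroup.smul_mem_pointwise_smul _ (MulAut.conj a) _
      (hZ' (show (⟨t, hT ht⟩ : F.aut Q) ∈ _ from ht)), rfl⟩
  rw [autAmbient_eq_twistAut] at h1
  obtain ⟨g, hg, h2⟩ := h1
  refine ⟨g, hg, fun x hx => ?_⟩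
  rw [← h2 _ (autFun_mem _ hx), ← autFun_mul _ _ hx, ← autFun_mul _ _ hx]
  simp

theorem Automised.fullyAutomised {Q : Subgroup S} (h : F.Automised Q) :
    F.FullyAutomised Q := by
  have := F.finite
  have hle : autAmbient Q ≤ F.aut Q := by
    rw [autAmbient_eq_twistAut]
    exact twistAut_le_aut (F.isMor_id Q) ⊤
  have hp : IsPGroup p (autAmbient Q) := by
    rw [autAmbient_eq_twistAut]
    exact isPGroup_twistAut F.isPGroup ⊤ (id_isEmb Q)
  obtain ⟨Z, hZ⟩ := (hp.comap_subtype (K := F.aut Q)).exists_le_sylow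
  refine ⟨Z, ?_⟩
  obtain ⟨f, hf, hfQ, hT⟩ := h ((Z : Subgroup (F.aut Q)).map (F.aut Q).subtype)
    (Subgroup.map_subtype_le _) (Z.2.map _)
  obtain ⟨a, ha⟩ := hf.isEmb.exists_aut hfQ
  symm
  refine Subgroup.eq_of_le_of_card_ge (fun t ht => ⟨⟨t, hle ht⟩, hZ ht, rfl⟩) ?_
  -- conjugation by `a` embeds the Sylow subgroup in `Aut_S(Q)`
  refine (Nat.card_le_card_of_injective (fun t : (Z : Subgroup (F.aut Q)).map (F.aut Q).subtype =>
    (⟨a * t * a⁻¹, ?_⟩ : autAmbient Q)) fun t t' e => ?_)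
  · rw [autAmbient_eq_twistAut]
    obtain ⟨s, hs, hst⟩ := hT t.2
    refine ⟨s, hs, fun x hx => ?_⟩
    have h1 := hst _ (autFun_mem a⁻¹ hx)
    rw [← ha _ (autFun_mem _ (autFun_mem _ hx)), ← ha _ (autFun_mem _ hx),
      autFun_self_inv a hx] at h1
    rw [autFun_mul _ _ hx, autFun_mul _ _ (autFun_mem _ hx), h1]
  · have := congrArg Subtype.val e
    simpa using this

/-- A fully normalised subgroup of a saturated fusion system is fully automised and receptive. -/
theorem IsSaturated.saturatedAt [Fact p.Prime] (h : F.IsSaturated) (P : Subgroup S) :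
    F.SaturatedAt P := by
  have := F.finite
  obtain ⟨Q, hQ, hmax⟩ := Set.exists_max_image {Q : Subgroup S | F.Conj P Q}
    (fun Q => Nat.card (Subgroup.normalizer (Q : Set S))) (Set.toFinite _)
    ⟨P, ⟨_, F.refl_mem_iso P⟩⟩
  have hn : F.FullyNormalised Q := fun R hR => by
    obtain ⟨γ, hγ⟩ := hQ
    obtain ⟨δ, hδ⟩ := hR
    exact hmax R ⟨_, F.trans_mem_iso hγ hδ⟩
  obtain ⟨hc, ha⟩ := h.sylow Q hn
  refine ⟨Q, conj_iff.mp hQ, .of_fullyAutomised ha, fun R f hf hfQ => ?_⟩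
  obtain ⟨φ, hφ, hfφ⟩ := hf
  have hf : F.IsMor R f := ⟨φ, hφ, hfφ⟩
  obtain ⟨ψ, hψ, hψφ⟩ := h.extension R φ hφ (by rwa [image_eq_img hfφ, hfQ])
  obtain ⟨f', hext⟩ : ∃ f' : S → S, ∀ x : extender φ, f' x = ψ x :=
    ⟨_, fun x => Subtype.val_injective.extend_apply (fun x => (ψ x : S)) id x⟩
  have hm := isMor_of_mem_hom hψ hext
  rw [extender_eq_transporter hf hfφ] at hm
  refine ⟨_, hm, fun x hx => ?_⟩
  have hx' : x ∈ extender φ := by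
    rw [extender_eq_transporter hf hfφ]
    exact le_transporter hf.isEmb hx
  rw [hext ⟨x, hx'⟩, hψφ x hx hx', hfφ ⟨x, hx⟩]

/-- A fusion system in which every conjugacy class contains a fully automised and receptive subgroup
is saturated. -/
theorem isSaturated_of_saturatedAt [Fact p.Prime] (h : ∀ P : Subgroup S, F.SaturatedAt P) :
    F.IsSaturated := by
  have := F.finite
  constructor
  · intro P hP
    obtain ⟨Q, ⟨f, hf, hfQ⟩, hQa, hQr⟩ := h P
    obtain ⟨α, hα, hαQ⟩ := exists_normalizer_map hQa hQr hf hfQ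
    have hN : img (Subgroup.normalizer (P : Set S)) α = Subgroup.normalizer (Q : Set S) :=
      img_eq_of_card_le hα.isEmb (hα.map_normalizer Subgroup.le_normalizer le_rfl hαQ)
        (hP Q (conj_iff.mpr ⟨f, hf, hfQ⟩))
    have hαP := hα.of_le (Subgroup.le_normalizer (H := P))
    constructor
    · intro R hR
      obtain ⟨γ, hγ⟩ := hR
      obtain ⟨g, hg, hgP⟩ := conj_iff.mp ⟨_, F.symm_mem_iso hγ⟩
      obtain ⟨β, hβ, hβQ⟩ := exists_normalizer_map hQa hQr (hg.comp hf hgP.le)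
        (by rw [hg.isEmb.img_comp hf.isEmb hgP.le, hgP, hfQ])
      refine (hβ.card_centralizer_le hβQ).trans ?_
      have hle : Subgroup.centralizer (Q : Set S) ≤ img (Subgroup.normalizer (P : Set S)) α := by
        rw [hN]
        exact centralizer_le_normalizer Q
      rw [← (hα.pinv.of_le hle).isEmb.card_img]
      refine Subgroup.card_le_of_le ?_
      rw [img_le_iff]
      intro c hc
      have h1 := hα.pinv.isEmb.map_mem_centralizer (Q := Q)
        (hαQ ▸ img_mono Subgroup.le_normalizer α)
        (hle hc) hc
      have h2 : img Q (pinv (Subgroup.normalizer (P : Set S)) α) = P := by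
        rw [← hαQ, hα.isEmb.img_pinv Subgroup.le_normalizer]
      rwa [h2] at h1
    · apply Automised.fullyAutomised
      intro T hT hTp
      obtain ⟨τ, hτ, hτQ, hTτ⟩ := hQa.exists_lift hf hfQ hT hTp
      have hle : img P τ ≤ img P α := by rw [hτQ, hαQ]
      refine ⟨_, hτ.comp_pinv hαP hle, ?_, fun t ht => ?_⟩
      · rw [hτ.isEmb.img_comp hαP.isEmb.pinv hle, hτQ, ← hαQ, hαP.isEmb.img_pinv le_rfl]
      · obtain ⟨s, -, hs⟩ := hTτ ht
        have hsN : s ∈ Subgroup.normalizer (Q : Set S) :=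
          mem_normalizer_of_forall_conj_mem fun y hy => by
            rw [← hτQ, hτ.isEmb.mem_img] at hy
            obtain ⟨x, hx, rfl⟩ := hy
            rw [← hs x hx, ← hτQ]
            exact mem_img_of_mem τ (autFun_mem t hx)
        rw [← hN] at hsN
        obtain ⟨n, hn, rfl⟩ := hα.isEmb.mem_img.mp hsN
        refine ⟨n, trivial, fun x hx => ?_⟩
        have h1 : τ x ∈ img P α := hle (mem_img_of_mem τ hx)
        obtain ⟨y, hy, hyx⟩ := hαP.isEmb.mem_img.mp h1
        dsimp only
        rw [hs x hx, ← hyx, hαP.isEmb.pinv_apply hy,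
          ← hα.isEmb.map_conj hn (Subgroup.le_normalizer hy),
          hαP.isEmb.pinv_apply (conj_mem_of_mem_normalizer hn hy)]
  · intro R φ hφ hc
    obtain ⟨f, hfφ⟩ : ∃ f : S → S, ∀ x : R, f x = φ x :=
      ⟨_, fun x => Subtype.val_injective.extend_apply (fun x => (φ x : S)) id x⟩
    have hf : F.IsMor R f := ⟨φ, hφ, hfφ⟩
    rw [image_eq_img hfφ] at hc
    obtain ⟨Q, ⟨g, hg, hgQ⟩, hQa, hQr⟩ := h (img R f)
    obtain ⟨α, hα, hαQ⟩ := exists_normalizer_map hQa hQr hg hgQ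
    obtain ⟨f', hf', e⟩ := hQr.of_card_centralizer_le hα hαQ
      (hc Q (conj_iff.mpr ⟨g, hg, hgQ⟩)) R f hf rfl
    rw [← extender_eq_transporter hf hfφ] at hf'
    obtain ⟨ψ, hψ, hψf⟩ := hf'
    exact ⟨ψ, hψ, fun x hx hx' => by rw [← hψf ⟨x, hx'⟩, e x hx, hfφ ⟨x, hx⟩]⟩

end FusionSystem

/-! ### Composites of restrictions of given maps -/

section Gen

variable {S : Type w} [Group S]

/-- The function `f` is, on `P`, a composite of restrictions of the maps `g` on subgroups `R` with
`B R g`. -/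
inductive Gen (B : Subgroup S → (S → S) → Prop) (P : Subgroup S) : (S → S) → Prop
  | id : Gen B P fun x => x
  | step {R : Subgroup S} {f g : S → S} : Gen B P f → B R g → img P f ≤ R →
      Gen B P fun x => g (f x)
  | congr {f g : S → S} : Gen B P f → (∀ x ∈ P, g x = f x) → Gen B P g

namespace Gen

variable {B : Subgroup S → (S → S) → Prop} {P : Subgroup S} {f : S → S}

theorem of_mem {R : Subgroup S} (h : B R f) (hP : P ≤ R) : Gen B P f :=
  .step (f := fun x => x) .id h (by rwa [img_id])

theorem isEmb (hB : ∀ R g, B R g → IsEmb R g) (h : Gen B P f) : IsEmb P f := by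
  induction h with
  | id => exact id_isEmb P
  | step _ hg hR ih => exact ih.comp (hB _ _ hg) hR
  | congr _ e ih => exact ih.congr e

theorem of_le (h : Gen B P f) {Q : Subgroup S} (hQ : Q ≤ P) : Gen B Q f := by
  induction h with
  | id => exact .id
  | step _ hg hR ih => exact .step ih hg ((img_mono hQ _).trans hR)
  | congr _ e ih => exact .congr ih fun x hx => e x (hQ hx)

theorem comp (hB : ∀ R g, B R g → IsEmb R g) (h : Gen B P f) {R : Subgroup S} {g : S → S}
    (hg : Gen B R g) (hR : img P f ≤ R) : Gen B P fun x => g (f x) := by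
  induction hg with
  | id => exact h
  | step hg hk hk' ih =>
    refine .step ih hk ?_
    rw [(h.isEmb hB).img_comp (hg.isEmb hB) hR]
    exact (img_mono hR _).trans hk'
  | congr _ e ih => exact .congr ih fun x hx => e _ (hR (mem_img_of_mem f hx))

protected theorem pinv (hB : ∀ R g, B R g → IsEmb R g)
    (hB' : ∀ R g, B R g → B (img R g) (pinv R g)) (h : Gen B P f) :
    Gen B (img P f) (pinv P f) := by
  induction h with
  | id =>
    refine .congr .id fun x hx => ?_
    rw [img_id] at hx
    exact (id_isEmb P).pinv_apply hx
  | @step R f g hf hg hR ih =>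
    have hfE := hf.isEmb hB
    have hgE := hB _ _ hg
    rw [hfE.img_comp hgE hR]
    have h1 : Gen B (img (img P f) g) (pinv R g) := of_mem (hB' _ _ hg) (img_mono hR g)
    have hi : img (img (img P f) g) (pinv R g) = img P f := hgE.img_pinv hR
    refine .congr (h1.comp hB ih hi.le) fun y hy => ?_
    obtain ⟨z, hz, rfl⟩ := (hgE.of_le hR).mem_img.mp hy
    obtain ⟨x, hx, rfl⟩ := hfE.mem_img.mp hz
    rw [hgE.pinv_apply (hR hz), hfE.pinv_apply hx]
    exact (hfE.comp hgE hR).pinv_apply hx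
  | congr h e ih =>
    rw [img_congr e]
    refine .congr ih fun y hy => ?_
    have hE := h.isEmb hB
    obtain ⟨x, hx, rfl⟩ := hE.mem_img.mp hy
    rw [hE.pinv_apply hx, ← e x hx, (hE.congr e).pinv_apply hx]

theorem trans {B' : Subgroup S → (S → S) → Prop} (hB' : ∀ R g, B' R g → IsEmb R g)
    (hBB' : ∀ R g, B R g → Gen B' R g) (h : Gen B P f) : Gen B' P f := by
  induction h with
  | id => exact .id
  | step _ hg hR ih => exact ih.comp hB' (hBB' _ _ hg) hR
  | congr _ e ih => exact .congr ih e

end Gen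

end Gen

/-! ### Centric subgroups -/

namespace FusionSystem

variable {p : ℕ} {S : Type w} [Group S] {F : FusionSystem p S}

theorem isCentric_iff {P : Subgroup S} : F.IsCentric P ↔
    ∀ f, F.IsMor P f → Subgroup.centralizer (img P f : Set S) ≤ img P f := by
  have key : ∀ Q : Subgroup S, Subgroup.centralizer (Q : Set S) ≤ Q →
      Subgroup.centralizer (Q : Set S) = (Subgroup.center Q).map Q.subtype := by
    intro Q hQ
    ext c
    constructor
    · intro hc
      exact ⟨⟨c, hQ hc⟩, Subgroup.mem_center_iff.mpr fun y => Subtype.ext (hc y y.2), rfl⟩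
    · rintro ⟨c, hc, rfl⟩
      refine Subgroup.mem_centralizer_iff.mpr fun y hy => ?_
      exact congrArg Subtype.val (Subgroup.mem_center_iff.mp hc ⟨y, hy⟩)
  constructor
  · intro h f hf
    rw [h _ (conj_iff.mpr ⟨f, hf, rfl⟩)]
    exact Subgroup.map_subtype_le _
  · intro h Q hQ
    obtain ⟨f, hf, rfl⟩ := conj_iff.mp hQ
    exact key _ (h f hf)

theorem IsCentric.centralizer_le {P : Subgroup S} (h : F.IsCentric P) :
    Subgroup.centralizer (P : Set S) ≤ P := by
  have := isCentric_iff.mp h _ (F.isMor_id P)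
  rwa [img_id] at this

theorem IsCentric.img {P : Subgroup S} (h : F.IsCentric P) {f : S → S} (hf : F.IsMor P f) :
    F.IsCentric (img P f) := by
  rw [isCentric_iff] at h ⊢
  intro g hg
  have := h _ (hf.comp hg le_rfl)
  rwa [hf.isEmb.img_comp hg.isEmb le_rfl] at this

theorem IsCentric.of_img {P : Subgroup S} {f : S → S} (hf : F.IsMor P f)
    (h : F.IsCentric (_root_.img P f)) : F.IsCentric P := by
  have := h.img hf.pinv
  rwa [hf.isEmb.img_pinv le_rfl] at this

theorem IsCentric.of_le {P Q : Subgroup S} (h : F.IsCentric P) (hPQ : P ≤ Q) : F.IsCentric Q := by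
  rw [isCentric_iff] at h ⊢
  intro f hf
  have h1 := h f (hf.of_le hPQ)
  have h2 := img_mono hPQ f
  exact (Subgroup.centralizer_le h2).trans (h1.trans h2)

/-- A centric subgroup with a fully automised receptive conjugate is receptive. -/
theorem IsCentric.receptive {P : Subgroup S} (hP : F.IsCentric P) (h : F.SaturatedAt P) :
    F.Receptive P := by
  obtain ⟨Q, ⟨f, hf, hfQ⟩, hQa, hQr⟩ := h
  obtain ⟨α, hα, hαQ⟩ := exists_normalizer_map hQa hQr hf hfQ
  refine hQr.of_normalizer_map hα hαQ ?_
  have h1 := (hP.img hf).centralizer_le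
  rw [hfQ] at h1
  exact h1.trans (hαQ.symm.le.trans (img_mono Subgroup.le_normalizer α))

/-- If `P` is not centric and the normalisers of all its conjugates map to that of `P`,
then `P` does not contain its centraliser. -/
theorem not_centralizer_le_of_not_isCentric {P : Subgroup S} (hP : ¬ F.IsCentric P)
    (h : ∀ f, F.IsMor P f →
      ∃ α, F.IsMor (Subgroup.normalizer (img P f : Set S)) α ∧ _root_.img (_root_.img P f) α = P) :
    ¬ Subgroup.centralizer (P : Set S) ≤ P := by
  rw [isCentric_iff] at hP
  push Not at hP
  obtain ⟨f, hf, hc⟩ := hP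
  obtain ⟨α, hα, hαP⟩ := h f hf
  intro hle
  refine hc fun c hc => ?_
  have h1 := hle (hα.map_centralizer hαP (mem_img_of_mem α hc))
  have h2 : α c ∈ _root_.img (_root_.img P f) α := by rwa [hαP]
  rwa [hα.isEmb.mem_img_iff Subgroup.le_normalizer (centralizer_le_normalizer _ hc)] at h2

end FusionSystem

/-! ### Saturation at subgroups that are not centric -/

section Stabilisers

variable {G : Type*} [Group G]

/-- The automorphisms of `R` that stabilise `P`. -/
def stabAut (P R : Subgroup G) : Subgroup (MulAut R) where
  carrier := {a | ∀ x ∈ R, x ∈ P ↔ autFun a x ∈ P}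
  mul_mem' := by
    intro a b ha hb x hx
    rw [autFun_mul a b hx, hb x hx, ha _ (autFun_mem b hx)]
  one_mem' := fun x hx => by rw [autFun_one hx]
  inv_mem' := by
    intro a ha x hx
    rw [ha _ (autFun_mem a⁻¹ hx), autFun_self_inv a hx]

/-- The automorphisms of `R` that act on `P` as conjugation by some element of `M`. -/
def actAut (M : Subgroup G) {P R : Subgroup G} (hPR : P ≤ R) : Subgroup (MulAut R) where
  carrier := {a | ∃ g ∈ M, g ∈ Subgroup.normalizer (P : Set G) ∧
    ∀ x ∈ P, autFun a x = g * x * g⁻¹}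
  mul_mem' := by
    rintro a b ⟨g, hg, hgN, ha⟩ ⟨h, hh, hhN, hb⟩
    refine ⟨g * h, M.mul_mem hg hh, mul_mem hgN hhN, fun x hx => ?_⟩
    rw [autFun_mul a b (hPR hx), hb x hx, ha _ (conj_mem_of_mem_normalizer hhN hx)]
    group
  one_mem' := ⟨1, M.one_mem, one_mem _, fun x hx => by rw [autFun_one (hPR hx)]; group⟩
  inv_mem' := by
    rintro a ⟨g, hg, hgN, ha⟩
    refine ⟨g⁻¹, M.inv_mem hg, inv_mem hgN, fun x hx => ?_⟩
    have h1 := ha _ (inv_conj_mem_of_mem_normalizer hgN hx)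
    rw [show g * (g⁻¹ * x * g) * g⁻¹ = x by group] at h1
    have h2 := autFun_inv_self a (hPR (inv_conj_mem_of_mem_normalizer hgN hx))
    rw [h1] at h2
    rw [h2, inv_inv]

theorem IsEmb.img_sup_le {H : Type*} [Group H] {P Q : Subgroup G} {f : G → H}
    (h : IsEmb (P ⊔ Q) f) {T : Subgroup H} (hP : img P f ≤ T) (hQ : img Q f ≤ T) :
    img (P ⊔ Q) f ≤ T := by
  rw [img_le_iff] at hP hQ ⊢
  intro x hx
  rw [Subgroup.sup_eq_closure] at hx
  induction hx using Subgroup.closure_induction with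
  | mem x hx => exact hx.elim (hP x) (hQ x)
  | one => rw [h.map_one]; exact T.one_mem
  | mul a b ha hb iha ihb =>
    rw [← Subgroup.sup_eq_closure] at ha hb
    rw [h.map_mul a ha b hb]
    exact T.mul_mem iha ihb
  | inv a ha iha =>
    rw [← Subgroup.sup_eq_closure] at ha
    rw [h.map_inv ha]
    exact T.inv_mem iha

end Stabilisers

namespace FusionSystem

variable {p : ℕ} {S : Type w} [Group S] {F : FusionSystem p S}

/-- The normaliser of `Q` maps to that of `P` by a morphism of `F` that maps `Q` onto `P`. -/
def NormalizerMapsTo (F : FusionSystem p S) (Q P : Subgroup S) : Prop :=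
  ∃ α, F.IsMor (Subgroup.normalizer (Q : Set S)) α ∧ img Q α = P

theorem normalizerMapsTo_self (P : Subgroup S) : F.NormalizerMapsTo P P :=
  ⟨_, F.isMor_id _, img_id P⟩

theorem lt_of_le_of_card_lt {P Q : Subgroup S} (h : P ≤ Q) (hc : Nat.card P < Nat.card Q) :
    P < Q :=
  lt_of_le_of_ne h fun e => by rw [e] at hc; exact hc.false

theorem card_lt_of_lt [Finite S] {P Q : Subgroup S} (h : P < Q) : Nat.card P < Nat.card Q :=
  lt_of_not_ge fun hc => h.ne (Subgroup.eq_of_le_of_card_ge h.le hc)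

/-- Let `P` have a normaliser of maximal order in its conjugacy class. If the
normaliser of `Q` maps to that of `P`, then so does the normaliser of the image of `Q` under every
morphism `f` on a subgroup `R` of the normaliser of `Q` that properly contains `Q`. -/
theorem NormalizerMapsTo.img [Fact p.Prime] {P : Subgroup S}
    (hbig : ∀ R : Subgroup S, Nat.card P < Nat.card R → F.SaturatedAt R)
    (hmax : ∀ f, F.IsMor P f → Nat.card (Subgroup.normalizer (img P f : Set S)) ≤
      Nat.card (Subgroup.normalizer (P : Set S))) {R Q : Subgroup S} {f : S → S} (hQR : Q < R)
    (hRN : R ≤ Subgroup.normalizer (Q : Set S)) (hf : F.IsMor R f)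
    (hQ : F.NormalizerMapsTo Q P) : F.NormalizerMapsTo (img Q f) P := by
  have := F.finite
  -- downward induction on the order of `R`
  induction hn : Nat.card S - Nat.card R using Nat.strong_induction_on generalizing R Q f with
  | _ n ih =>
  obtain ⟨α, hα, hαP⟩ := hQ
  -- the morphism `f`, seen on the subgroup `R₁` of the normaliser of `P` that corresponds to `R`
  have hαR := hα.of_le hRN
  have hi : _root_.img (_root_.img R α) (pinv R α) = R := hαR.isEmb.img_pinv le_rfl
  set R₁ := _root_.img R α with hR₁
  have hf₁ : F.IsMor R₁ fun y => f (pinv R α y) := hαR.pinv.comp hf hi.le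
  have hPR₁ : P < R₁ := hαP ▸ hαR.isEmb.img_lt hQR
  have hR₁N : R₁ ≤ Subgroup.normalizer (P : Set S) := by
    have := hαR.isEmb.img_le_normalizer hQR.le hRN
    rwa [hαP] at this
  have hcard : Nat.card R₁ = Nat.card R := hαR.isEmb.card_img
  have hPQ : _root_.img P (fun y => f (pinv R α y)) = _root_.img Q f := by
    have h1 : _root_.img P (pinv R α) = Q := by rw [← hαP, hαR.isEmb.img_pinv hQR.le]
    rw [(hαR.pinv.of_le hPR₁.le).isEmb.img_comp (hf.of_le hQR.le).isEmb h1.le, h1]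
  generalize (fun y => f (pinv R α y)) = f₁ at hf₁ hPQ
  rw [← hPQ]
  have hR'N := hf₁.map_normalizer hPR₁.le hR₁N rfl
  by_cases hle : Subgroup.normalizer (_root_.img P f₁ : Set S) ≤ _root_.img R₁ f₁
  · exact ⟨_, hf₁.pinv.of_le hle, hf₁.isEmb.img_pinv hPR₁.le⟩
  have hR'lt : _root_.img R₁ f₁ < Subgroup.normalizer (_root_.img P f₁ : Set S) :=
    lt_of_le_not_ge hR'N hle
  have hR₁lt : R₁ < Subgroup.normalizer (P : Set S) := by
    refine lt_of_le_of_card_lt hR₁N ?_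
    rw [← hf₁.isEmb.card_img]
    exact (card_lt_of_lt hR'lt).trans_le (hmax f₁ (hf₁.of_le hPR₁.le))
  have hM := (F.isPGroup.to_subgroup _).lt_inf_normalizer hR₁lt
  have hM' := (F.isPGroup.to_subgroup _).lt_inf_normalizer hR'lt
  set M := Subgroup.normalizer (P : Set S) ⊓ Subgroup.normalizer (R₁ : Set S)
  set M' := Subgroup.normalizer (_root_.img P f₁ : Set S) ⊓
    Subgroup.normalizer (_root_.img R₁ f₁ : Set S)
  obtain ⟨τ, τ', a, ha, hτ, hτ', hττ'⟩ := (hbig R₁ (card_lt_of_lt hPR₁)).exists_common_extension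
    (A := F.aut R₁ ⊓ stabAut P R₁) inf_le_left hf₁ (M := M) (M' := M') inf_le_right inf_le_right
    (le_inf (twistAut_le_aut (F.isMor_id R₁) M) (by
      rintro a ⟨g, hg, hga⟩ x hx
      refine (Subgroup.mem_normalizer_iff.mp hg.1 x).trans ?_
      rw [← hga x hx]))
    (le_inf (twistAut_le_aut hf₁ M') (by
      rintro a ⟨g, hg, hga⟩ x hx
      rw [← hf₁.isEmb.mem_img_iff hPR₁.le hx, ← hf₁.isEmb.mem_img_iff hPR₁.le (autFun_mem a hx),
        hga x hx]
      exact Subgroup.mem_normalizer_iff.mp hg.1 _))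
  rw [sup_eq_right.mpr hM.le] at hτ
  rw [sup_eq_right.mpr hM'.le] at hτ'
  have hdec : ∀ {N : Subgroup S}, Nat.card R₁ < Nat.card N → Nat.card S - Nat.card N < n := by
    intro N hN
    have := Subgroup.card_le_card_group N
    omega
  have hτP : _root_.img (_root_.img P f₁) τ' = _root_.img P τ := by
    ext y
    rw [hτ'.isEmb.mem_img_of_le ((img_mono hPR₁.le f₁).trans hM'.le),
      hτ.isEmb.mem_img_of_le (hPR₁.le.trans hM.le)]
    constructor
    · rintro ⟨_, hz, rfl⟩
      obtain ⟨x, hx, rfl⟩ := (hf₁.isEmb.mem_img_of_le hPR₁.le).mp hz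
      exact ⟨_, (ha.2 x (hPR₁.le hx)).mp hx, (hττ' x (hPR₁.le hx)).symm⟩
    · rintro ⟨x, hx, rfl⟩
      have hx' : autFun a⁻¹ x ∈ P := ((stabAut P R₁).inv_mem ha.2 x (hPR₁.le hx)).mp hx
      refine ⟨_, mem_img_of_mem f₁ hx', ?_⟩
      rw [hττ' _ (hPR₁.le hx'), autFun_self_inv a (hPR₁.le hx)]
  have h1 : F.NormalizerMapsTo (_root_.img P τ) P :=
    ih _ (hdec (card_lt_of_lt hM)) (hPR₁.trans hM) inf_le_left hτ (normalizerMapsTo_self P) rfl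
  have hlt : _root_.img P f₁ < M' := (hf₁.isEmb.img_lt hPR₁).trans hM'
  have h2 := ih _ (hdec (N := _root_.img M' τ') (by
      rw [hτ'.isEmb.card_img, ← hf₁.isEmb.card_img]
      exact card_lt_of_lt hM')) (R := _root_.img M' τ') (Q := _root_.img P τ) (f := pinv M' τ')
    (hτP ▸ hτ'.isEmb.img_lt hlt)
    (hτ'.map_normalizer hlt.le inf_le_left hτP) hτ'.pinv h1 rfl
  rwa [← hτP, hτ'.isEmb.img_pinv hlt.le] at h2

/-- Let `P` have a normaliser of maximal order in its conjugacy class, and assume that it is not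
centric but that its conjugations in `F` come from centric subgroups. Then the
normalisers of all conjugates of `P` map to that of `P`. -/
theorem normalizerMapsTo_of_gen [Fact p.Prime] {P : Subgroup S} (hP : ¬ F.IsCentric P)
    (hbig : ∀ R : Subgroup S, Nat.card P < Nat.card R → F.SaturatedAt R)
    (hmax : ∀ f, F.IsMor P f → Nat.card (Subgroup.normalizer (img P f : Set S)) ≤
      Nat.card (Subgroup.normalizer (P : Set S))) {f : S → S}
    (hf : Gen (fun R g => F.IsMor R g ∧ F.IsCentric R) P f) :
    F.IsMor P f ∧ F.NormalizerMapsTo (img P f) P := by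
  induction hf with
  | id => exact ⟨F.isMor_id P, by rw [img_id]; exact normalizerMapsTo_self P⟩
  | @step R f g hf hg hR ih =>
    obtain ⟨ih, ihN⟩ := ih
    refine ⟨ih.comp hg.1 hR, ?_⟩
    rw [ih.isEmb.img_comp hg.1.isEmb hR]
    have hlt : img P f < R := lt_of_le_of_ne hR fun e => hP (.of_img ih (e ▸ hg.2))
    have := F.finite
    exact ihN.img hbig hmax ((F.isPGroup.to_subgroup _).lt_inf_normalizer hlt) inf_le_right
      (hg.1.of_le inf_le_left)
  | congr _ e ih => exact ⟨ih.1.congr e, by rw [img_congr e]; exact ih.2⟩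

/-- The automorphism `f` of `P` extends to the group generated by `P` and its centraliser. -/
def ExtendsToCentralizer (F : FusionSystem p S) (P : Subgroup S) (f : S → S) : Prop :=
  F.IsMor P f ∧ img P f = P ∧
    ∃ f', F.IsMor (P ⊔ Subgroup.centralizer (P : Set S)) f' ∧ ∀ x ∈ P, f' x = f x

theorem sup_centralizer_le_normalizer (P : Subgroup S) :
    P ⊔ Subgroup.centralizer (P : Set S) ≤ Subgroup.normalizer (P : Set S) :=
  sup_le Subgroup.le_normalizer (centralizer_le_normalizer P)

theorem normalizer_le_normalizer_centralizer (P : Subgroup S) :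
    Subgroup.normalizer (P : Set S) ≤
      Subgroup.normalizer (Subgroup.centralizer (P : Set S) : Set S) := by
  rw [Subgroup.le_normalizer_iff]
  intro g hg c hc
  refine Subgroup.mem_centralizer_iff.mpr fun x hx => ?_
  have h1 := Subgroup.mem_centralizer_iff.mp hc _ (inv_conj_mem_of_mem_normalizer hg hx)
  calc x * (g * c * g⁻¹) = g * ((g⁻¹ * x * g) * c) * g⁻¹ := by group
    _ = g * (c * (g⁻¹ * x * g)) * g⁻¹ := by rw [h1]
    _ = g * c * g⁻¹ * x := by group

theorem img_sup_centralizer {P : Subgroup S} {f : S → S}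
    (hf : F.IsMor (P ⊔ Subgroup.centralizer (P : Set S)) f) (hP : img P f = P) :
    img (P ⊔ Subgroup.centralizer (P : Set S)) f = P ⊔ Subgroup.centralizer (P : Set S) := by
  have := F.finite
  refine img_eq_of_card_le hf.isEmb ?_ le_rfl
  refine hf.isEmb.img_sup_le (hP.le.trans le_sup_left) (le_trans ?_ le_sup_right)
  rw [img_le_iff]
  intro c hc
  have := hf.isEmb.map_mem_centralizer (Q := P) le_sup_left (le_sup_right (a := P) hc) hc
  rwa [hP] at this

/-- If `f` and `g` extend to the group generated by `P` and its centraliser and `g ∘ ψ = f` on `P`,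
then `ψ` extends as well. -/
theorem ExtendsToCentralizer.of_comp {P : Subgroup S} {f g ψ : S → S}
    (hf : F.ExtendsToCentralizer P f) (hg : F.ExtendsToCentralizer P g)
    (hψ : ∀ x ∈ P, ψ x ∈ P) (h : ∀ x ∈ P, g (ψ x) = f x) : F.ExtendsToCentralizer P ψ := by
  obtain ⟨hf, hfP, f', hf', ef⟩ := hf
  obtain ⟨hg, hgP, g', hg', eg⟩ := hg
  have hfi := img_sup_centralizer hf' ((img_congr ef).trans hfP)
  have hgi := img_sup_centralizer hg' ((img_congr eg).trans hgP)
  have hle := hfi.trans hgi.symm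
  have key : ∀ x ∈ P, pinv (P ⊔ Subgroup.centralizer (P : Set S)) g' (f' x) = ψ x := by
    intro x hx
    rw [ef x hx, ← h x hx, ← eg _ (hψ x hx), hg'.isEmb.pinv_apply (Subgroup.mem_sup_left (hψ x hx))]
  have hm := hf'.comp_pinv hg' hle.le
  have hmP : F.IsMor P ψ := (hm.of_le le_sup_left).congr fun x hx => (key x hx).symm
  have := F.finite
  exact ⟨hmP, img_eq_of_card_le hmP.isEmb (img_le_iff.mpr hψ) le_rfl, _, hm, key⟩

theorem extendsToCentralizer_id (P : Subgroup S) : F.ExtendsToCentralizer P fun x => x :=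
  ⟨F.isMor_id P, img_id P, _, F.isMor_id _, fun _ _ => rfl⟩

theorem ExtendsToCentralizer.symm {P : Subgroup S} {f ψ : S → S}
    (hf : F.ExtendsToCentralizer P f) (hψ : ∀ x ∈ P, ψ x ∈ P) (h : ∀ x ∈ P, f (ψ x) = x) :
    F.ExtendsToCentralizer P ψ :=
  (extendsToCentralizer_id P).of_comp hf hψ h

theorem ExtendsToCentralizer.comp {P : Subgroup S} {f g : S → S}
    (hf : F.ExtendsToCentralizer P f) (hg : F.ExtendsToCentralizer P g) :
    F.ExtendsToCentralizer P fun x => g (f x) := by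
  have hgE := hg.1.isEmb
  have hinv : F.ExtendsToCentralizer P (pinv P g) :=
    hg.symm (fun x hx => hgE.pinv_mem (hg.2.1.ge hx)) fun x hx => hgE.apply_pinv (hg.2.1.ge hx)
  have hfm : ∀ x ∈ P, f x ∈ P := fun x hx => hf.2.1.le (mem_img_of_mem f hx)
  refine hf.of_comp hinv (fun x hx => hg.2.1.le (mem_img_of_mem g (hfm x hx))) fun x hx => ?_
  exact hgE.pinv_apply (hfm x hx)

theorem extendsToCentralizer_of_le {P M : Subgroup S} {f : S → S} (hf : F.IsMor M f)
    (hM : P ⊔ Subgroup.centralizer (P : Set S) ≤ M) (hfP : img P f = P) :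
    F.ExtendsToCentralizer P f :=
  ⟨hf.of_le (le_sup_left.trans hM), hfP, f, hf.of_le hM, fun _ _ => rfl⟩

/-- If the normalisers of all conjugates of `P` map to that of `P`, then every automorphism of `P`
that extends to a larger subgroup of the normaliser of `P` also extends to the group generated by
`P` and its centraliser. -/
theorem extendsToCentralizer_of_lt [Fact p.Prime] {P : Subgroup S}
    (hbig : ∀ R : Subgroup S, Nat.card P < Nat.card R → F.SaturatedAt R)
    (hN : ∀ f, F.IsMor P f → F.NormalizerMapsTo (img P f) P) {R : Subgroup S} {ψ : S → S}
    (hPR : P < R) (hRN : R ≤ Subgroup.normalizer (P : Set S)) (hψ : F.IsMor R ψ)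
    (hψP : img P ψ = P) : F.ExtendsToCentralizer P ψ := by
  have := F.finite
  -- downward induction on the order of `R`
  induction hn : Nat.card S - Nat.card R using Nat.strong_induction_on generalizing R ψ with
  | _ n ih =>
  set C := Subgroup.centralizer (P : Set S) with hC
  have hψm : ∀ x ∈ P, ψ x ∈ P := fun x hx => hψP.le (mem_img_of_mem ψ hx)
  by_cases hCR : C ≤ R
  · exact extendsToCentralizer_of_le hψ (sup_le hPR.le hCR) hψP
  set R' := img R ψ
  have hPR' : P < R' := by
    have := hψ.isEmb.img_lt hPR
    rwa [hψP] at this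
  have hR'N : R' ≤ Subgroup.normalizer (P : Set S) := hψ.map_normalizer hPR.le hRN hψP
  have hcard : Nat.card R' = Nat.card R := hψ.isEmb.card_img
  by_cases hCR' : C ≤ R'
  · have h1 : img P (pinv R ψ) = P := by
      conv_lhs => rw [← hψP]
      exact hψ.isEmb.img_pinv hPR.le
    exact (extendsToCentralizer_of_le hψ.pinv (sup_le hPR'.le hCR') h1).symm hψm
      fun x hx => hψ.isEmb.pinv_apply (hPR.le hx)
  -- the group generated by `R` and `M = N_C(R)` is larger than `R`, because `C` is not
  -- contained in `R`
  have key : ∀ R : Subgroup S, P < R → R ≤ Subgroup.normalizer (P : Set S) → ¬ C ≤ R →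
      R < R ⊔ (C ⊓ Subgroup.normalizer (R : Set S)) ∧
        R ⊔ (C ⊓ Subgroup.normalizer (R : Set S)) ≤ Subgroup.normalizer (P : Set S) := by
    intro R hPR hRN hCR
    refine ⟨lt_sup_of_not_le fun hle => ?_,
      sup_le hRN (inf_le_left.trans (centralizer_le_normalizer P))⟩
    have hlt := (F.isPGroup.to_subgroup _).lt_inf_normalizer (lt_sup_of_not_le hCR)
    obtain ⟨g, hg, hgR⟩ := SetLike.exists_of_lt hlt
    have hRC : R ≤ Subgroup.normalizer (C : Set S) :=
      hRN.trans (normalizer_le_normalizer_centralizer P)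
    have hgs : g ∈ ((R ⊔ C : Subgroup S) : Set S) := hg.1
    rw [Subgroup.coe_mul_of_left_le_normalizer_right _ _ hRC] at hgs
    obtain ⟨r, hr, c, hc, rfl⟩ := hgs
    refine hgR (R.mul_mem hr (hle ⟨hc, ?_⟩))
    have := mul_mem (inv_mem (Subgroup.le_normalizer hr)) hg.2
    rwa [inv_mul_cancel_left] at this
  obtain ⟨hRM, hRMN⟩ := key R hPR hRN hCR
  obtain ⟨hRM', hRMN'⟩ := key R' hPR' hR'N hCR'
  set M := C ⊓ Subgroup.normalizer (R : Set S)
  set M' := C ⊓ Subgroup.normalizer (R' : Set S)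
  have hone : ∀ c ∈ C, ∀ x ∈ P, c * x * c⁻¹ = x := fun c hc x hx =>
    conj_eq_of_mem_centralizer hc hx
  obtain ⟨τ, τ', a, ha, hτ, hτ', hττ'⟩ := (hbig R (card_lt_of_lt hPR)).exists_common_extension
    (A := F.aut R ⊓ actAut ⊥ hPR.le) inf_le_left hψ (M := M) (M' := M') inf_le_right inf_le_right
    (le_inf (twistAut_le_aut (F.isMor_id R) M) (by
      rintro a ⟨g, hg, hga⟩
      refine ⟨1, one_mem _, one_mem _, fun x hx => ?_⟩
      have h1 := hga x (hPR.le hx)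
      rw [hone g hg.1 x hx] at h1
      simpa using h1))
    (le_inf (twistAut_le_aut hψ M') (by
      rintro a ⟨g, hg, hga⟩
      refine ⟨1, one_mem _, one_mem _, fun x hx => ?_⟩
      have h1 := hga x (hPR.le hx)
      rw [hone g hg.1 _ (hψm x hx)] at h1
      rw [hψ.isEmb.injOn (autFun_mem a (hPR.le hx)) (hPR.le hx) h1]
      simp))
  have haP : ∀ x ∈ P, autFun a x = x := by
    obtain ⟨g, hg, -, h⟩ := ha.2
    intro x hx
    rw [h x hx, Subgroup.mem_bot.mp hg]
    simp
  have hττ'P : ∀ x ∈ P, τ' (ψ x) = τ x := fun x hx => by rw [hττ' x (hPR.le hx), haP x hx]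
  have hdec : ∀ {N : Subgroup S}, Nat.card R < Nat.card N → Nat.card S - Nat.card N < n := by
    intro N hN
    have := Subgroup.card_le_card_group N
    omega
  have hPM := hPR.trans hRM
  have hPM' := hPR'.trans hRM'
  obtain ⟨α, hα, hαP⟩ := hN τ (hτ.of_le hPM.le)
  have himg : img P τ' = img P τ := by
    conv_lhs => rw [← hψP]
    rw [← (hψ.of_le hPR.le).isEmb.img_comp (hτ'.of_le hPM'.le).isEmb hψP.le]
    exact img_congr hττ'P
  have hτN := hτ.map_normalizer hPM.le hRMN rfl
  have hτN' := hτ'.map_normalizer hPM'.le hRMN' himg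
  have h1 : F.ExtendsToCentralizer P fun x => α (τ x) :=
    ih _ (hdec (card_lt_of_lt hRM)) hPM hRMN (hτ.comp hα hτN) (by
      rw [(hτ.of_le hPM.le).isEmb.img_comp (hα.of_le Subgroup.le_normalizer).isEmb le_rfl, hαP]) rfl
  have h2 : F.ExtendsToCentralizer P fun x => α (τ' x) :=
    ih _ (hdec (hcard ▸ card_lt_of_lt hRM')) hPM' hRMN' (hτ'.comp hα hτN') (by
      rw [(hτ'.of_le hPM'.le).isEmb.img_comp (hα.of_le Subgroup.le_normalizer).isEmb himg.le, himg,
        hαP]) rfl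
  exact h1.of_comp h2 hψm fun x hx => by rw [hττ'P x hx]

end FusionSystem

namespace FusionSystem

variable {p : ℕ} {S : Type w} [Group S] {F : FusionSystem p S}

theorem isMor_of_gen {B : Subgroup S → (S → S) → Prop} (hB : ∀ R g, B R g → F.IsMor R g)
    {P : Subgroup S} {f : S → S} (h : Gen B P f) : F.IsMor P f := by
  induction h with
  | id => exact F.isMor_id P
  | step _ hg hR ih => exact ih.comp (hB _ _ hg) hR
  | congr _ e ih => exact ih.congr e

theorem ExtendsToCentralizer.congr {P : Subgroup S} {f g : S → S}
    (hf : F.ExtendsToCentralizer P f) (h : ∀ x ∈ P, g x = f x) : F.ExtendsToCentralizer P g := by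
  obtain ⟨h1, h2, f', hf', e⟩ := hf
  exact ⟨h1.congr h, (img_congr h).trans h2, f', hf', fun x hx => (e x hx).trans (h x hx).symm⟩

/-- Let `f` be a composite of restrictions of morphisms on centric subgroups, and let `α` map the
normaliser of the image of `f` to that of `P`. Then the automorphism `α ∘ f` of `P` extends to the
group generated by `P` and its centraliser: by `extendsToCentralizer_of_lt` this holds for the
automorphism of `P` that corresponds to any one of the factors. -/
theorem extendsToCentralizer_of_gen [Fact p.Prime] {P : Subgroup S} (hP : ¬ F.IsCentric P)
    (hbig : ∀ R : Subgroup S, Nat.card P < Nat.card R → F.SaturatedAt R)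
    (hN : ∀ f, F.IsMor P f → F.NormalizerMapsTo (img P f) P) {f : S → S}
    (hf : Gen (fun R g => F.IsMor R g ∧ F.IsCentric R) P f) {α : S → S}
    (hα : F.IsMor (Subgroup.normalizer (img P f : Set S)) α) (hαP : img (img P f) α = P) :
    F.ExtendsToCentralizer P fun x => α (f x) := by
  have := F.finite
  induction hf generalizing α with
  | id =>
    rw [img_id] at hα hαP
    exact extendsToCentralizer_of_le hα (sup_centralizer_le_normalizer P) hαP
  | @step R f g hf hg hR ih =>
    have hfM := isMor_of_gen (fun _ _ h => h.1) hf
    obtain ⟨β, hβ, hβP⟩ := hN f hfM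
    have hgf : img P (fun x => g (f x)) = img (img P f) g :=
      hfM.isEmb.img_comp hg.1.isEmb hR
    rw [hgf] at hα hαP
    have hQR : img P f < R := lt_of_le_of_ne hR fun e => hP (.of_img hfM (e ▸ hg.2))
    have hQR₀ := (F.isPGroup.to_subgroup _).lt_inf_normalizer hQR
    set R₀ := R ⊓ Subgroup.normalizer (img P f : Set S)
    have hβR₀ := hβ.of_le (inf_le_right : R₀ ≤ _)
    have hgR₀ := hg.1.of_le (inf_le_left : R₀ ≤ R)
    have hi : img (img R₀ β) (pinv R₀ β) = R₀ := hβR₀.isEmb.img_pinv le_rfl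
    have h1 := hβR₀.pinv.comp hgR₀ hi.le
    have h1i : img (img R₀ β) (fun y => g (pinv R₀ β y)) ≤
        Subgroup.normalizer (img (img P f) g : Set S) := by
      rw [hβR₀.pinv.isEmb.img_comp hgR₀.isEmb hi.le, hi]
      exact hgR₀.map_normalizer hQR₀.le inf_le_right rfl
    have h2 := h1.comp hα h1i
    have hPlt : P < img R₀ β := by
      have := hβR₀.isEmb.img_lt hQR₀
      rwa [hβP] at this
    have hval : ∀ x ∈ P, pinv R₀ β (β (f x)) = f x := fun x hx =>
      hβR₀.isEmb.pinv_apply (hQR₀.le (mem_img_of_mem f hx))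
    have himg : img P (fun y => α (g (pinv R₀ β y))) = P := by
      have h3 : img P (pinv R₀ β) = img P f := by
        rw [← hβP, hβR₀.isEmb.img_pinv hQR₀.le, hβP]
      rw [(h1.of_le hPlt.le).isEmb.img_comp hα.isEmb ((img_mono hPlt.le _).trans h1i),
        (hβR₀.pinv.of_le hPlt.le).isEmb.img_comp hg.1.isEmb (h3.trans_le hR), h3, hαP]
    refine ((ih hβ hβP).comp (extendsToCentralizer_of_lt hbig hN hPlt
      (hβR₀.map_normalizer hQR₀.le inf_le_right hβP) h2 himg)).congr fun x hx => ?_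
    dsimp only
    rw [hval x hx]
  | congr h e ih =>
    rw [img_congr e] at hα hαP
    exact (ih hα hαP).congr fun x hx => by rw [e x hx]

/-- If the automorphisms of `P` extend to the group `R` generated by `P` and its centraliser,
and `P` is properly contained in `R`, then `P` is fully automised: a `p`-group of
automorphisms of `P` lifts to a `p`-group of automorphisms of `R`. -/
theorem automised_of_extendsToCentralizer [Fact p.Prime] {P : Subgroup S}
    (hR : F.SaturatedAt (P ⊔ Subgroup.centralizer (P : Set S)))
    (hN : ∀ f, F.IsMor P f → F.NormalizerMapsTo (img P f) P)
    (hE : ∀ f, F.IsMor P f → img P f = P → F.ExtendsToCentralizer P f) : F.Automised P := by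
  have := F.finite
  intro T hT hTp
  set R := P ⊔ Subgroup.centralizer (P : Set S)
  have hPR : P ≤ R := le_sup_left
  let Γ : Subgroup (MulAut R × MulAut P) :=
    { carrier := {c | c.1 ∈ F.aut R ∧ c.2 ∈ T ∧ ∀ x ∈ P, autFun c.1 x = autFun c.2 x}
      mul_mem' := by
        rintro ⟨a, s⟩ ⟨b, t⟩ ⟨ha, hs, has⟩ ⟨hb, ht, hbt⟩
        refine ⟨mul_mem ha hb, mul_mem hs ht, fun x hx => ?_⟩
        dsimp only [Prod.mk_mul_mk] at has hbt ⊢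
        rw [autFun_mul a b (hPR hx), autFun_mul s t hx, hbt x hx, has _ (autFun_mem t hx)]
      one_mem' := ⟨one_mem _, one_mem _, fun x hx => by
        rw [Prod.fst_one, Prod.snd_one, autFun_one hx, autFun_one (hPR hx)]⟩
      inv_mem' := by
        rintro ⟨a, s⟩ ⟨ha, hs, has⟩
        refine ⟨inv_mem ha, inv_mem hs, fun x hx => ?_⟩
        dsimp only [Prod.inv_mk] at has ⊢
        have h1 := has _ (autFun_mem s⁻¹ hx)
        rw [autFun_self_inv s hx] at h1
        conv_lhs => rw [← h1]
        exact autFun_inv_self a (hPR (autFun_mem s⁻¹ hx)) }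
  let π : Γ →* T := ((MonoidHom.snd _ _).comp Γ.subtype).codRestrict T fun c => c.2.2.1
  have hπ : Function.Surjective π := by
    rintro ⟨t, ht⟩
    obtain ⟨-, -, f, hf, e⟩ := hE _ (mem_aut_iff.mp (hT ht)) (img_autFun t)
    obtain ⟨a, ha⟩ := hf.isEmb.exists_aut
      (img_sup_centralizer hf ((img_congr e).trans (img_autFun t)))
    refine ⟨⟨(a, t), mem_aut_iff.mpr (hf.congr ha), ht, fun x hx => ?_⟩, rfl⟩
    rw [ha x (hPR hx), e x hx]
  obtain ⟨Q⟩ : Nonempty (Sylow p Γ) := inferInstance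
  have htop : (Q : Subgroup Γ).map π = ⊤ := by
    rw [← Sylow.coe_mapSurjective hπ Q]
    refine ((Q.mapSurjective hπ).is_maximal' ?_ le_top).symm
    exact hTp.of_equiv Subgroup.topEquiv.symm
  obtain ⟨R₁, ⟨g, hg, hgR⟩, hRa, -⟩ := hR
  obtain ⟨τ, hτ, -, hτT⟩ := hRa.exists_lift hg hgR
    (T := ((Q : Subgroup Γ).map Γ.subtype).map (MonoidHom.fst _ _)) (by
      rintro _ ⟨_, ⟨c, -, rfl⟩, rfl⟩
      exact c.2.1) ((Q.2.map _).map _)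
  have hτP := hτ.of_le hPR
  obtain ⟨α, hα, hαP⟩ := hN τ hτP
  have hαP' := hα.of_le Subgroup.le_normalizer
  refine ⟨_, hτP.comp hαP' le_rfl, (hτP.isEmb.img_comp hαP'.isEmb le_rfl).trans hαP,
    fun t ht => ?_⟩
  obtain ⟨c, hc, hct⟩ : (⟨t, ht⟩ : T) ∈ (Q : Subgroup Γ).map π := htop ▸ trivial
  have hct : (c : MulAut R × MulAut P).2 = t := congrArg Subtype.val hct
  obtain ⟨s, -, hs⟩ := hτT ⟨_, ⟨c, hc, rfl⟩, rfl⟩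
  have hst : ∀ x ∈ P, τ (autFun t x) = s * τ x * s⁻¹ := fun x hx => by
    rw [← hct, ← c.2.2.2 x hx]
    exact hs x (hPR hx)
  have hsN : s ∈ Subgroup.normalizer (img P τ : Set S) :=
    mem_normalizer_of_forall_conj_mem fun y hy => by
      obtain ⟨x, hx, rfl⟩ := hτP.isEmb.mem_img.mp hy
      rw [← hst x hx]
      exact mem_img_of_mem τ (autFun_mem t hx)
  refine ⟨α s, trivial, fun x hx => ?_⟩
  dsimp only
  rw [hst x hx, hα.isEmb.map_conj hsN (Subgroup.le_normalizer (mem_img_of_mem τ hx))]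

/-- If the automorphisms of `P` extend to the group generated by `P` and its centraliser,
then `P` is receptive. -/
theorem receptive_of_extendsToCentralizer [Fact p.Prime] {P : Subgroup S}
    (hR : F.SaturatedAt (P ⊔ Subgroup.centralizer (P : Set S)))
    (hN : ∀ f, F.IsMor P f → F.NormalizerMapsTo (img P f) P)
    (hE : ∀ f, F.IsMor P f → img P f = P → F.ExtendsToCentralizer P f) : F.Receptive P := by
  have := F.finite
  intro Q φ hφ hφP
  set R := P ⊔ Subgroup.centralizer (P : Set S) with hRdef
  have hPR : P ≤ R := le_sup_left
  have hRN : R ≤ Subgroup.normalizer (P : Set S) := sup_centralizer_le_normalizer P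
  have hQP : img P (pinv Q φ) = Q := by rw [← hφP, hφ.isEmb.img_pinv le_rfl]
  -- by means of `α`, replace `φ` by the automorphism `θ` of `P`
  obtain ⟨α, hα, hαP⟩ := hN _ (hφP ▸ hφ.pinv)
  rw [hQP] at hα hαP
  have hαQ := hα.of_le (Subgroup.le_normalizer (H := Q))
  have hiQ : img P (pinv Q α) = Q := by rw [← hαP, hαQ.isEmb.img_pinv le_rfl]
  have hpα : F.IsMor P (pinv Q α) := hαP ▸ hαQ.pinv
  obtain ⟨-, -, θ, hθ, hθα⟩ := hE _ (hpα.comp hφ hiQ.le) (by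
    rw [hpα.isEmb.img_comp hφ.isEmb hiQ.le, hiQ, hφP])
  have hθα : ∀ x ∈ Q, θ (α x) = φ x := fun x hx => by
    rw [hθα _ (hαP.le (mem_img_of_mem α hx))]
    dsimp only
    rw [hαQ.isEmb.pinv_apply hx]
  have hθP : img P θ = P := by
    rw [← hαP, ← hαQ.isEmb.img_comp (hθ.of_le (hαP.le.trans hPR)).isEmb le_rfl, img_congr hθα, hφP,
      hαP]
  have hθ : F.IsMor R θ := hθ
  have hθR : img R θ = R := img_sup_centralizer hθ hθP
  have hpθ : F.IsMor R (pinv R θ) := by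
    have := hθ.pinv
    rwa [hθR] at this
  have hpθR : img R (pinv R θ) = R := by
    have := hθ.isEmb.img_pinv (le_refl R)
    rwa [hθR] at this
  -- the elements `h` of `M` realise the transported action of elements of `N_φ` on `P`
  set D := transporter Q φ
  have hQD : Q ≤ D := le_transporter hφ.isEmb
  have hDN : D ≤ Subgroup.normalizer (Q : Set S) := fun g hg => hg.1
  have hαD := hα.of_le hDN
  let M : Subgroup S :=
    { carrier := {h | h ∈ Subgroup.normalizer (P : Set S) ∧
        ∃ g ∈ D, ∀ x ∈ Q, φ (g * x * g⁻¹) = h * φ x * h⁻¹}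
      mul_mem' := by
        rintro h k ⟨hh, a, ha, hah⟩ ⟨hk, b, hb, hbk⟩
        refine ⟨mul_mem hh hk, a * b, mul_mem ha hb, fun x hx => ?_⟩
        have h1 := hah _ (conj_mem_of_mem_normalizer (hDN hb) hx)
        rw [hbk x hx] at h1
        rw [show a * b * x * (a * b)⁻¹ = a * (b * x * b⁻¹) * a⁻¹ by group, h1]
        group
      one_mem' := ⟨one_mem _, 1, one_mem _, fun x _ => by simp⟩
      inv_mem' := by
        rintro h ⟨hh, a, ha, hah⟩
        refine ⟨inv_mem hh, a⁻¹, inv_mem ha, fun x hx => ?_⟩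
        have h1 := hah _ (inv_conj_mem_of_mem_normalizer (hDN ha) hx)
        rw [show a * (a⁻¹ * x * a) * a⁻¹ = x by group] at h1
        rw [h1, inv_inv]
        group }
  have hMN : M ≤ Subgroup.normalizer (P : Set S) := fun h hh => hh.1
  have hφm : ∀ x ∈ Q, φ x ∈ P := fun x hx => hφP.le (mem_img_of_mem φ hx)
  have hαm : ∀ x ∈ Q, α x ∈ P := fun x hx => hαP.le (mem_img_of_mem α hx)
  have hCM : Subgroup.centralizer (P : Set S) ≤ M := fun c hc =>
    ⟨centralizer_le_normalizer P hc, 1, one_mem _, fun x hx => by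
      rw [conj_eq_of_mem_centralizer hc (hφm x hx)]; simp⟩
  have hPM : P ≤ M := by
    intro y hy
    refine ⟨Subgroup.le_normalizer hy, ?_⟩
    rw [← hφP, hφ.isEmb.mem_img] at hy
    obtain ⟨g, hg, rfl⟩ := hy
    exact ⟨g, hQD hg, fun x hx => hφ.isEmb.map_conj hg hx⟩
  have hRM : R ≤ M := sup_le hPM hCM
  have hNR : Subgroup.normalizer (P : Set S) ≤ Subgroup.normalizer (R : Set S) := by
    rw [Subgroup.le_normalizer_iff]
    intro g hg r hr
    have h1 := (F.isMor_conj R g)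
    have h2 : img P (fun x => g * x * g⁻¹) ≤ P := img_le_iff.mpr fun x hx =>
      conj_mem_of_mem_normalizer hg hx
    have h3 := img_sup_centralizer h1
      (img_eq_of_card_le (h1.of_le hPR).isEmb h2 le_rfl)
    exact h3.le (mem_img_of_mem (fun x => g * x * g⁻¹) hr)
  have hDαN : img D α ≤ Subgroup.normalizer (P : Set S) := hαD.map_normalizer hQD hDN hαP
  obtain ⟨τ, χ, a, ha, hτ, hχ, hττ'⟩ := hR.exists_common_extension
    (A := F.aut R ⊓ actAut M hPR) inf_le_left (f := pinv R θ) hpθ (M := M)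
    (M' := img D α) (hMN.trans hNR) (by
      rw [hpθR]
      exact hDαN.trans hNR)
    (le_inf (twistAut_le_aut (F.isMor_id R) M) (by
      rintro a ⟨g, hg, hga⟩
      exact ⟨g, hg, hMN hg, fun x hx => hga x (hPR hx)⟩))
    (le_inf (twistAut_le_aut hpθ _) (by
      rintro a ⟨g', hg', hga⟩
      obtain ⟨g, hg, rfl⟩ := hαD.isEmb.mem_img.mp hg'
      obtain ⟨hgN, h, hh⟩ := hg
      have hhN : h ∈ Subgroup.normalizer (P : Set S) :=
        mem_normalizer_of_forall_conj_mem fun y hy => by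
          rw [← hφP, hφ.isEmb.mem_img] at hy
          obtain ⟨x, hx, rfl⟩ := hy
          rw [← hh x hx]
          exact hφm _ (conj_mem_of_mem_normalizer hgN hx)
      refine ⟨h, ⟨hhN, g, ⟨hgN, h, hh⟩, hh⟩, hhN, fun y hy => ?_⟩
      rw [← hφP, hφ.isEmb.mem_img] at hy
      obtain ⟨x, hx, rfl⟩ := hy
      have h1 := hga (φ x) (hPR (hφm x hx))
      rw [← hθα x hx, hθ.isEmb.pinv_apply (hPR (hαm x hx)), hθα x hx,
        ← hα.isEmb.map_conj hgN (Subgroup.le_normalizer hx)] at h1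
      have h2 := congrArg θ h1
      rw [hθ.isEmb.apply_pinv (hθR.ge (autFun_mem a (hPR (hφm x hx)))),
        hθα _ (conj_mem_of_mem_normalizer hgN hx), hh x hx] at h2
      exact h2))
  rw [sup_eq_right.mpr hRM] at hτ
  rw [hpθR] at hχ
  obtain ⟨haF, h₀, hh₀, hh₀N, hah₀⟩ := ha
  -- on `P`, the extension `χ` is `θ`, followed by conjugation by `h₀` and by `τ`
  have hχP : ∀ x ∈ Q, χ (α x) = τ (h₀ * φ x * h₀⁻¹) := by
    intro x hx
    have h1 := hττ' _ (hPR (hφm x hx))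
    rw [← hθα x hx, hθ.isEmb.pinv_apply (hPR (hαm x hx)), hθα x hx, hah₀ _ (hφm x hx)] at h1
    exact h1
  have hτP := hτ.of_le hPM
  have hτC : Subgroup.centralizer (img P τ : Set S) ≤ img M τ := by
    obtain ⟨β, hβ, hβP⟩ := hN τ hτP
    have hle := hβ.card_centralizer_le hβP
    have h1 : img (Subgroup.centralizer (P : Set S)) τ = Subgroup.centralizer (img P τ : Set S) :=
      img_eq_of_card_le (hτ.of_le hCM).isEmb (by
        rw [img_le_iff]
        exact fun c hc => hτ.isEmb.map_mem_centralizer hPM (hCM hc) hc) hle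
    rw [← h1]
    exact img_mono hCM τ
  have hχα := hαD.comp hχ le_sup_right
  have himg : img D (fun g => χ (α g)) ≤ img M τ := by
    rw [img_le_iff]
    intro g hg
    obtain ⟨hgN, h, hh⟩ := hg
    have hhN : h ∈ Subgroup.normalizer (P : Set S) :=
      mem_normalizer_of_forall_conj_mem fun y hy => by
        rw [← hφP, hφ.isEmb.mem_img] at hy
        obtain ⟨x, hx, rfl⟩ := hy
        rw [← hh x hx]
        exact hφm _ (conj_mem_of_mem_normalizer hgN hx)
    have hhM : h ∈ M := ⟨hhN, g, ⟨hgN, h, hh⟩, hh⟩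
    have hgD : g ∈ D := ⟨hgN, h, hh⟩
    have hk : h₀ * h * h₀⁻¹ ∈ M := mul_mem (mul_mem hh₀ hhM) (inv_mem hh₀)
    refine mem_of_conj_eq hτC (mem_img_of_mem τ hk) fun y hy => ?_
    -- every element of the image of `P` is of the form `χ (α x)`
    obtain ⟨z, hz, rfl⟩ := hτP.isEmb.mem_img.mp hy
    have hz' := inv_conj_mem_of_mem_normalizer hh₀N hz
    rw [← hφP, hφ.isEmb.mem_img] at hz'
    obtain ⟨x, hx, hxz⟩ := hz'
    have hzx : z = h₀ * φ x * h₀⁻¹ := by rw [hxz]; group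
    have hzM : h₀ * φ x * h₀⁻¹ ∈ M := hPM (hzx ▸ hz)
    rw [hzx, ← hτ.isEmb.map_conj hk hzM, ← hχP x hx, ← hχα.isEmb.map_conj hgD (hQD hx),
      hχP _ (conj_mem_of_mem_normalizer hgN hx), hh x hx]
    congr 1
    group
  have h1 := (hχα.comp_pinv hτ himg).comp (F.isMor_conj ⊤ h₀⁻¹) le_top
  refine ⟨_, h1, fun x hx => ?_⟩
  rw [hχP x hx, hτ.isEmb.pinv_apply (hPM (conj_mem_of_mem_normalizer hh₀N (hφm x hx)))]
  group

/-- A fusion system that is generated by its morphisms on centric subgroups, and in which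
the conjugacy classes of centric subgroups contain fully automised receptive subgroups, is
saturated. -/
theorem saturatedAt_of_centric [Fact p.Prime]
    (hgen : ∀ (P : Subgroup S) (f : S → S), F.IsMor P f →
      Gen (fun R g => F.IsMor R g ∧ F.IsCentric R) P f)
    (hcentric : ∀ P : Subgroup S, F.IsCentric P → F.SaturatedAt P) (P : Subgroup S) :
    F.SaturatedAt P := by
  have := F.finite
  induction hn : Nat.card S - Nat.card P using Nat.strong_induction_on generalizing P with
  | _ n ih =>
  by_cases hP : F.IsCentric P
  · exact hcentric P hP
  -- a conjugate of `P` with a normaliser of maximal order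
  obtain ⟨f₀, hf₀, hmax⟩ := Set.exists_max_image {f : S → S | F.IsMor P f}
    (fun f => Nat.card (Subgroup.normalizer (img P f : Set S))) (Set.toFinite _)
    ⟨fun x => x, F.isMor_id P⟩
  have hf₀ : F.IsMor P f₀ := hf₀
  set Q := img P f₀ with hQ
  have hQc : ¬ F.IsCentric Q := fun h => hP (.of_img hf₀ h)
  have hbig : ∀ R : Subgroup S, Nat.card Q < Nat.card R → F.SaturatedAt R := by
    intro R hR
    rw [hf₀.isEmb.card_img] at hR
    have := Subgroup.card_le_card_group R
    exact ih _ (by omega) R rfl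
  have hmax' : ∀ f, F.IsMor Q f → Nat.card (Subgroup.normalizer (img Q f : Set S)) ≤
      Nat.card (Subgroup.normalizer (Q : Set S)) := by
    intro f hf
    rw [hQ, ← hf₀.isEmb.img_comp hf.isEmb le_rfl]
    exact hmax _ (hf₀.comp hf le_rfl)
  have hN : ∀ f, F.IsMor Q f → F.NormalizerMapsTo (img Q f) Q := fun f hf =>
    (normalizerMapsTo_of_gen hQc hbig hmax' (hgen Q f hf)).2
  have hE : ∀ f, F.IsMor Q f → img Q f = Q → F.ExtendsToCentralizer Q f := fun f hf hfQ =>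
    extendsToCentralizer_of_gen hQc hbig hN (hgen Q f hf) (F.isMor_id _) (by rw [img_id, hfQ])
  have hC := not_centralizer_le_of_not_isCentric hQc hN
  have hR := hbig _ (card_lt_of_lt (lt_sup_of_not_le hC))
  exact ⟨Q, ⟨f₀, hf₀, rfl⟩, automised_of_extendsToCentralizer hR hN hE,
    receptive_of_extendsToCentralizer hR hN hE⟩

end FusionSystem

/-! ### Generation of saturated fusion systems by essential subgroups -/

section Sylow

theorem Sylow.exists_conj_mem_of_le {p : ℕ} [Fact p.Prime] {G : Type*} [Group G] [Finite G]
    (Q : Sylow p G) {H X : Subgroup G} (hQ : (Q : Subgroup G) ≤ H) (hX : IsPGroup p X)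
    (hXH : X ≤ H) : ∃ h ∈ H, ∀ x ∈ X, h * x * h⁻¹ ∈ Q := by
  obtain ⟨Q', hQ'⟩ := (hX.comap_subtype (K := H)).exists_le_sylow
  obtain ⟨h, hh⟩ := MulAction.exists_smul_eq H Q' (Q.subtype hQ)
  refine ⟨h, h.2, fun x hx => ?_⟩
  have h1 : MulAut.conj h (⟨x, hXH hx⟩ : H) ∈ (Q.subtype hQ : Subgroup H) := by
    rw [← hh]
    exact Subgroup.smul_mem_pointwise_smul _ (MulAut.conj h) _ (hQ' hx)
  exact h1

end Sylow

namespace FusionSystem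

variable {p : ℕ} {S : Type w} [Group S] {F : FusionSystem p S}

/-- The morphisms on `S` itself and on the subgroups that are conjugate to essential subgroups. -/
def IsEssentialMor (F : FusionSystem p S) (R : Subgroup S) (g : S → S) : Prop :=
  F.IsMor R g ∧ (R = ⊤ ∨ ∃ h, F.IsMor R h ∧ F.IsEssential (img R h))

theorem IsEssentialMor.isEmb {R : Subgroup S} {g : S → S} (h : F.IsEssentialMor R g) : IsEmb R g :=
  h.1.isEmb

protected theorem IsEssentialMor.pinv {R : Subgroup S} {g : S → S} (h : F.IsEssentialMor R g) :
    F.IsEssentialMor (img R g) (pinv R g) := by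
  have := F.finite
  obtain ⟨hg, rfl | ⟨k, hk, he⟩⟩ := h
  · exact ⟨hg.pinv, .inl (img_eq_of_card_le hg.isEmb le_top le_rfl)⟩
  · refine ⟨hg.pinv, .inr ⟨_, hg.pinv.comp hk (hg.isEmb.img_pinv le_rfl).le, ?_⟩⟩
    rwa [hg.pinv.isEmb.img_comp hk.isEmb (hg.isEmb.img_pinv le_rfl).le, hg.isEmb.img_pinv le_rfl]

/-- If the automorphisms of `Q` with a property `H` do not form the whole of `Aut_F(Q)`, but
contain all those induced by conjugation in `S` and all those that extend to larger
subgroups, then `Q` is essential: the group of these automorphisms defines a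
strongly `p`-embedded subgroup of `Out_F(Q)`. -/
theorem isEssential_of_subgroup [Fact p.Prime] {Q : Subgroup S} (hc : F.IsCentric Q)
    (hQ : F.Automised Q) {H : Subgroup (F.aut Q)} (hH : H ≠ ⊤)
    (hconj : ∀ a : F.aut Q, (a : MulAut Q) ∈ twistAut ⊤ Q (fun x => x) → a ∈ H)
    (hext : ∀ a : F.aut Q, ∀ s ∈ transporter Q (autFun (a : MulAut Q)), s ∉ Q → a ∈ H) :
    F.IsEssential Q := by
  have := F.finite
  have hinn : ∀ a : F.aut Q, a ∈ F.inn Q ↔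
      ∃ s ∈ Q, ∀ x ∈ Q, autFun (a : MulAut Q) x = s * x * s⁻¹ := by
    intro a
    constructor
    · rintro ⟨s, hs⟩
      refine ⟨s, s.2, fun x hx => ?_⟩
      have : (a : MulAut Q) = MulAut.conj s := hs.symm
      rw [this, autFun_apply _ hx]
      rfl
    · rintro ⟨s, hs, h⟩
      refine ⟨⟨s, hs⟩, autFun_ext fun x hx => ?_⟩
      refine Eq.trans ?_ (h x hx).symm
      rw [autFun_apply _ hx]
      rfl
  have hinnH : F.inn Q ≤ H := fun a ha => by
    obtain ⟨s, -, h⟩ := (hinn a).mp ha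
    exact hconj a ⟨s, trivial, h⟩
  set π := QuotientGroup.mk' (F.inn Q)
  have hπ : Function.Surjective π := QuotientGroup.mk'_surjective _
  have hker : π.ker = F.inn Q := QuotientGroup.ker_mk' _
  have hcomap : ∀ a, π a ∈ H.map π ↔ a ∈ H := by
    intro a
    rw [← Subgroup.mem_comap, Subgroup.comap_map_eq_self (hker.le.trans hinnH)]
  obtain ⟨P, hP⟩ := hQ.fullyAutomised
  have hPmem : ∀ a : F.aut Q, a ∈ P ↔ (a : MulAut Q) ∈ twistAut ⊤ Q (fun x => x) := by
    intro a
    rw [← autAmbient_eq_twistAut, ← hP]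
    constructor
    · exact fun h => ⟨a, h, rfl⟩
    · rintro ⟨b, hb, e⟩
      rwa [← Subtype.ext e]
  have hPH : (P : Subgroup (F.aut Q)) ≤ H := fun a ha => hconj a ((hPmem a).mp ha)
  refine ⟨hc, H.map π, lt_top_iff_ne_top.mpr fun h => hH ?_, ⟨P.mapSurjective hπ, ?_⟩, ?_⟩
  · rw [eq_top_iff]
    exact fun a _ => (hcomap a).mp (h ▸ trivial)
  · exact Subgroup.map_mono hPH
  intro g hg hdvd
  obtain ⟨g, rfl⟩ := hπ g
  rw [hcomap] at hg
  obtain ⟨x, hx⟩ := exists_prime_orderOf_dvd_card' p hdvd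
  -- a subgroup of order `p` in the intersection, and its inverse image `X` in `Aut_F(Q)`
  have hxH : (x : F.Out Q) ∈ H.map π := x.2.1
  have hxg : π g * x * (π g)⁻¹ ∈ H.map π := by
    obtain ⟨h, hh, e⟩ := x.2.2
    rw [← e]
    simpa [mul_assoc] using hh
  have hXp : IsPGroup p ((Subgroup.zpowers (x : F.Out Q)).comap π) := by
    refine IsPGroup.comap_of_ker_isPGroup ?_ π ?_
    · refine IsPGroup.of_card (n := 1) ?_
      rw [Nat.card_zpowers, Subgroup.orderOf_coe, hx, pow_one]
    · rw [hker]
      exact P.2.to_le fun a ha => by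
        obtain ⟨s, -, h⟩ := (hinn a).mp ha
        exact (hPmem a).mpr ⟨s, trivial, h⟩
  set X := (Subgroup.zpowers (x : F.Out Q)).comap π
  have hXH : X ≤ H := fun a ha => by
    rw [← hcomap]
    exact (Subgroup.zpowers_le.mpr hxH) ha
  have hXg : X.map (MulAut.conj g).toMonoidHom ≤ H := by
    rintro _ ⟨a, ha, rfl⟩
    rw [← hcomap]
    obtain ⟨n, hn⟩ := ha
    have h1 : π ((MulAut.conj g).toMonoidHom a) = (π g * x * (π g)⁻¹) ^ n := by
      rw [conj_zpow]
      change π (g * a * g⁻¹) = _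
      rw [map_mul, map_mul, map_inv, ← hn]
    rw [h1]
    exact zpow_mem hxg n
  obtain ⟨h₁, hh₁, hX₁⟩ := P.exists_conj_mem_of_le hPH hXp hXH
  obtain ⟨h₂, hh₂, hX₂⟩ := P.exists_conj_mem_of_le hPH (hXp.map _) hXg
  obtain ⟨y, hy⟩ := hπ (x : F.Out Q)
  have hyX : y ∈ X := by
    change π y ∈ Subgroup.zpowers (x : F.Out Q)
    rw [hy]
    exact Subgroup.mem_zpowers _
  have hyinn : y ∉ F.inn Q := by
    rw [← hker, MonoidHom.mem_ker, hy]
    intro h1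
    rw [← Subgroup.orderOf_coe, h1, orderOf_one] at hx
    exact (Fact.out : p.Prime).one_lt.ne hx
  obtain ⟨s, -, hs⟩ := (hPmem _).mp (hX₁ y hyX)
  obtain ⟨u, -, hu⟩ := (hPmem _).mp (hX₂ _ ⟨y, hyX, rfl⟩)
  set k := h₂ * g * h₁⁻¹ with hk
  have hsN : s ∈ Subgroup.normalizer (Q : Set S) :=
    mem_normalizer_of_forall_conj_mem fun z hz => by
      have h1 := hs z hz
      dsimp only at h1
      rw [← h1]
      exact autFun_mem _ hz
  have e : k * (h₁ * y * h₁⁻¹) = h₂ * (MulAut.conj g).toMonoidHom y * h₂⁻¹ * k := by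
    change _ = h₂ * (g * y * g⁻¹) * h₂⁻¹ * k
    rw [hk]
    group
  have hkH : k ∈ H := by
    refine hext k s ⟨hsN, u, fun z hz => ?_⟩ fun hsQ => hyinn ?_
    · have h1 := hu _ (autFun_mem (k : MulAut Q) hz)
      have h2 := hs z hz
      dsimp only at h1 h2
      rw [← h2, ← h1, ← autFun_mul _ _ hz, ← autFun_mul _ _ hz, ← Subgroup.coe_mul,
        ← Subgroup.coe_mul, e]
    · have h1 : h₁ * y * h₁⁻¹ ∈ F.inn Q := (hinn _).mpr ⟨s, hsQ, hs⟩
      have h2 := (F.inn_normal Q).conj_mem _ h1 h₁⁻¹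
      rwa [show h₁⁻¹ * (h₁ * y * h₁⁻¹) * h₁⁻¹⁻¹ = y by group] at h2
  refine hg ?_
  rw [show g = h₂⁻¹ * k * h₁ by rw [hk]; group]
  exact H.mul_mem (H.mul_mem (H.inv_mem hh₂) hkH) hh₁

/-- Alperin's fusion theorem: a saturated fusion system is generated by its morphisms on `S` and on
essential subgroups. -/
theorem gen_isEssentialMor [Fact p.Prime] (hsat : ∀ P : Subgroup S, F.SaturatedAt P)
    (P : Subgroup S) (f : S → S) (hf : F.IsMor P f) : Gen F.IsEssentialMor P f := by
  have := F.finite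
  induction hn : Nat.card S - Nat.card P using Nat.strong_induction_on generalizing P f with
  | _ n ih =>
  have hB : ∀ R g, F.IsEssentialMor R g → IsEmb R g := fun _ _ h => h.isEmb
  have hB' : ∀ R g, F.IsEssentialMor R g → F.IsEssentialMor (img R g) (pinv R g) :=
    fun _ _ h => h.pinv
  have hbig : ∀ (R : Subgroup S) (f : S → S), Nat.card P < Nat.card R → F.IsMor R f →
      Gen F.IsEssentialMor R f := by
    intro R f hR hf
    have := Subgroup.card_le_card_group R
    exact ih _ (by omega) R f hf rfl
  by_cases hPtop : P = ⊤
  · exact .of_mem ⟨hf, .inl hPtop⟩ le_rfl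
  have hlt : ∀ R : Subgroup S, Nat.card R = Nat.card P →
      Nat.card P < Nat.card (Subgroup.normalizer (R : Set S)) := by
    intro R hR
    have hRtop : R < ⊤ := by
      refine lt_top_iff_ne_top.mpr fun h => hPtop ?_
      refine Subgroup.eq_of_le_of_card_ge le_top ?_
      rw [← hR, h]
    have := (F.isPGroup.to_subgroup _).lt_inf_normalizer hRtop
    rw [top_inf_eq] at this
    exact hR ▸ card_lt_of_lt this
  obtain ⟨Q, ⟨g, hg, hgQ⟩, hQa, hQr⟩ := hsat P
  have hQP : Nat.card Q = Nat.card P := hgQ ▸ hg.isEmb.card_img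
  obtain ⟨α, hα, hαQ⟩ := exists_normalizer_map hQa hQr hg hgQ
  have hfP := hf.isEmb.img_pinv (le_refl P)
  obtain ⟨β, hβ, hβQ⟩ := exists_normalizer_map hQa hQr (hf.pinv.comp hg hfP.le)
    (by rw [hf.pinv.isEmb.img_comp hg.isEmb hfP.le, hfP, hgQ])
  have hαP := hα.of_le (Subgroup.le_normalizer (H := P))
  have hβP := hβ.of_le (Subgroup.le_normalizer (H := img P f))
  have hGα : Gen F.IsEssentialMor P α :=
    (hbig _ _ (hlt P rfl) hα).of_le Subgroup.le_normalizer
  have hGβ : Gen F.IsEssentialMor (img P f) β :=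
    (hbig _ _ (hlt _ hf.isEmb.card_img) hβ).of_le Subgroup.le_normalizer
  -- an automorphism of `Q` that extends to a larger subgroup
  have hGext : ∀ θ, F.IsMor Q θ → img Q θ = Q → ∀ s ∈ transporter Q θ, s ∉ Q →
      Gen F.IsEssentialMor Q θ := by
    intro θ hθ hθQ s hs hsQ
    obtain ⟨θ', hθ', e⟩ := hQr Q θ hθ hθQ
    have hle := le_transporter hθ.isEmb
    have hlt' : Q < transporter Q θ := lt_of_le_of_ne hle fun h => hsQ (h.symm ▸ hs)
    exact .congr ((hbig _ _ (hQP ▸ card_lt_of_lt hlt') hθ').of_le hle) fun x hx => (e x hx).symm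
  have hGaut : ∀ θ, F.IsMor Q θ → img Q θ = Q → Gen F.IsEssentialMor Q θ := by
    intro θ hθ hθQ
    by_cases hc : F.IsCentric Q
    · by_cases he : F.IsEssential Q
      · exact .of_mem ⟨hθ, .inr ⟨_, F.isMor_id Q, by rwa [img_id]⟩⟩ le_rfl
      let H : Subgroup (F.aut Q) :=
        { carrier := {a | Gen F.IsEssentialMor Q (autFun (a : MulAut Q))}
          mul_mem' := by
            intro a b ha hb
            exact .congr (Gen.comp hB hb ha (img_autFun _).le) fun x hx => autFun_mul _ _ hx
          one_mem' := .congr .id fun x hx => autFun_one hx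
          inv_mem' := by
            intro a ha
            have h1 := Gen.pinv hB hB' ha
            rw [img_autFun] at h1
            refine .congr h1 fun x hx => ?_
            have h2 := (autFun_isEmb (a : MulAut Q)).pinv_apply (autFun_mem (a : MulAut Q)⁻¹ hx)
            rw [autFun_self_inv _ hx] at h2
            exact h2.symm }
      by_cases hH : H = ⊤
      · obtain ⟨a, ha⟩ := hθ.isEmb.exists_aut hθQ
        have haF : a ∈ F.aut Q := mem_aut_iff.mpr (hθ.congr ha)
        have : (⟨a, haF⟩ : F.aut Q) ∈ H := hH ▸ trivial
        exact .congr this fun x hx => (ha x hx).symm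
      · refine absurd (isEssential_of_subgroup hc hQa hH ?_ ?_) he
        · rintro a ⟨s, -, hs⟩
          exact .congr (.of_mem ⟨F.isMor_conj ⊤ s, .inl rfl⟩ le_top) hs
        · exact fun a s hs hsQ => hGext _ (mem_aut_iff.mp a.2) (img_autFun _) s hs hsQ
    · have hC := not_centralizer_le_of_not_isCentric hc fun k hk =>
        exists_normalizer_map hQa hQr hk.pinv (hk.isEmb.img_pinv le_rfl)
      obtain ⟨c, hc, hcQ⟩ := SetLike.not_le_iff_exists.mp hC
      refine hGext θ hθ hθQ c ⟨centralizer_le_normalizer Q hc, 1, fun x hx => ?_⟩ hcQ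
      rw [conj_eq_of_mem_centralizer hc hx]
      group
  -- `f` is the composite of `α`, an automorphism of `Q`, and the inverse of `β`
  have hiα : img Q (pinv P α) = P := by rw [← hαQ, hαP.isEmb.img_pinv le_rfl]
  have hpα : F.IsMor Q (pinv P α) := hαQ ▸ hαP.pinv
  have h1 := hpα.comp hf hiα.le
  have hi1 : img Q (fun x => f (pinv P α x)) = img P f := by
    rw [hpα.isEmb.img_comp hf.isEmb hiα.le, hiα]
  have h2 := h1.comp hβP hi1.le
  have hi2 : img Q (fun x => β (f (pinv P α x))) = Q := by
    rw [h1.isEmb.img_comp hβP.isEmb hi1.le, hi1, hβQ]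
  have h3 := hGα.comp hB (hGaut _ h2 hi2) hαQ.le
  have hi3 : img P (fun x => β (f (pinv P α (α x)))) = Q := by
    rw [hαP.isEmb.img_comp h2.isEmb hαQ.le, hαQ, hi2]
  have h4 := h3.comp hB (hGβ.pinv hB hB') (hi3.trans hβQ.symm).le
  refine .congr h4 fun x hx => ?_
  rw [hαP.isEmb.pinv_apply hx, hβP.isEmb.pinv_apply (mem_img_of_mem f hx)]

end FusionSystem

/-! ### Group actions on trees -/

namespace SimpleGraph

variable {X : Type*} {G : SimpleGraph X}

theorem IsAcyclic.walk_eq (hG : G.IsAcyclic) {x y : X} {q r : G.Walk x y} (hq : q.IsPath)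
    (hr : r.IsPath) : q = r :=
  congrArg Subtype.val ((hG.subsingleton_path x y).elim ⟨q, hq⟩ ⟨r, hr⟩)

/-- An injective endomorphism of a forest that fixes the ends of a path fixes all its vertices. -/
theorem IsAcyclic.fixed_of_mem_support (hG : G.IsAcyclic) (f : G →g G)
    (hf : Function.Injective f) {x y : X} {q : G.Walk x y} (hq : q.IsPath) (hx : f x = x)
    (hy : f y = y) {z : X} (hz : z ∈ q.support) : f z = z := by
  have h1 : ((q.map f).copy hx hy).IsPath := by
    rw [Walk.isPath_copy]
    exact hq.map hf
  have h2 := congrArg Walk.support (hG.walk_eq h1 hq)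
  rw [Walk.support_copy, Walk.support_map] at h2
  rw [← List.map_id q.support, List.map_map] at h2
  exact List.map_inj_left.mp h2 z hz

/-- Two distinct vertices of a forest have at most one common neighbour. -/
theorem IsAcyclic.eq_of_adj (hG : G.IsAcyclic) {a b c d : X} (hab : a ≠ b) (hac : G.Adj a c)
    (hcb : G.Adj c b) (had : G.Adj a d) (hdb : G.Adj d b) : c = d := by
  have key : ∀ {e : X} (h : G.Adj a e) (h' : G.Adj e b), (Walk.cons h h'.toWalk).IsPath := by
    intro e h h'
    simp [Walk.cons_isPath_iff, h.ne, hab, h'.ne]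
  have := congrArg Walk.support (hG.walk_eq (key hac hcb) (key had hdb))
  simpa using this

/-- In a tree with root `r`, one of two adjacent vertices `v`, `w` follows the other on its path to
the root. -/
theorem IsAcyclic.cons_isPath_or (hG : G.IsAcyclic) {v w r : X} (h : G.Adj v w) {q : G.Walk w r}
    (hq : q.IsPath) : (Walk.cons h q).IsPath ∨
      ∃ q' : G.Walk v r, q'.IsPath ∧ q = Walk.cons h.symm q' := by
  classical
  by_cases hv : v ∈ q.support
  · right
    refine ⟨q.dropUntil v hv, hq.dropUntil hv, ?_⟩
    have h1 : (Walk.cons h.symm (Walk.nil : G.Walk v v)).IsPath := by simp [h.ne']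
    have h2 := hG.walk_eq (hq.takeUntil hv) h1
    conv_lhs => rw [← q.take_spec hv, h2]
    rfl
  · left
    rw [Walk.cons_isPath_iff]
    exact ⟨hq, hv⟩

/-- A vertex between `x` and `y` in a tree is closer to any given vertex than `x` or `y`. -/
theorem IsTree.dist_lt_or_dist_lt (hG : G.IsTree) {x y z o : X} {q : G.Walk x y} (hq : q.IsPath)
    (hz : z ∈ q.support) (hzx : z ≠ x) (hzy : z ≠ y) :
    G.dist z o < G.dist x o ∨ G.dist z o < G.dist y o := by
  classical
  have key : ∀ {a : X} (r : G.Walk a o), r.length = G.dist a o → z ∈ r.support → z ≠ a →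
      G.dist z o < G.dist a o := by
    intro a r hr hzr hza
    have h1 := congrArg Walk.length (r.take_spec hzr)
    rw [Walk.length_append] at h1
    have h2 : (r.takeUntil z hzr).length ≠ 0 := fun h => hza (Walk.eq_of_length_eq_zero h).symm
    have h3 := dist_le (r.dropUntil z hzr)
    omega
  obtain ⟨r₁, h₁⟩ := hG.connected.exists_walk_length_eq_dist x o
  obtain ⟨r₂, h₂⟩ := hG.connected.exists_walk_length_eq_dist y o
  have h3 : q = (r₁.append r₂.reverse).bypass :=
    hG.isAcyclic.walk_eq hq (Walk.bypass_isPath _)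
  rw [h3] at hz
  have h4 := Walk.support_bypass_subset_support _ hz
  rw [Walk.mem_support_append_iff, Walk.support_reverse, List.mem_reverse] at h4
  exact h4.imp (fun h => key r₁ h₁ h hzx) fun h => key r₂ h₂ h hzy

/-- A finite group acting on a tree and preserving the classes of a bipartition
fixes a vertex: a vertex at minimal maximal distance from the vertices of an orbit. -/
theorem IsTree.exists_fixed_vertex (hG : G.IsTree) {T : Type*} [Group T] [Finite T]
    [MulAction T X] (hadj : ∀ (t : T) (x y : X), G.Adj x y → G.Adj (t • x) (t • y)) {c : X → Prop}
    (hc : ∀ x y, G.Adj x y → ¬ (c x ↔ c y)) (hcT : ∀ (t : T) (x : X), c (t • x) ↔ c x) :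
    ∃ x : X, ∀ t : T, t • x = x := by
  classical
  have := Fintype.ofFinite T
  obtain ⟨x₀⟩ := hG.connected.nonempty
  have hdist : ∀ (t : T) (x y : X), G.dist (t • x) (t • y) ≤ G.dist x y := by
    intro t x y
    obtain ⟨r, hr⟩ := hG.connected.exists_walk_length_eq_dist x y
    let φ : G →g G := ⟨fun x => t • x, fun h => hadj t _ _ h⟩
    have := dist_le (r.map φ)
    rw [Walk.length_map, hr] at this
    exact this
  let f : X → ℕ := fun x => Finset.univ.sup fun t : T => G.dist x (t • x₀)
  have hf : ∀ (x : X) (t : T), G.dist x (t • x₀) ≤ f x := fun x t =>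
    Finset.le_sup (f := fun t : T => G.dist x (t • x₀)) (Finset.mem_univ t)
  have hfT : ∀ (s : T) (x : X), f (s • x) ≤ f x := by
    intro s x
    refine Finset.sup_le fun t _ => ?_
    have h1 := hdist s x ((s⁻¹ * t) • x₀)
    rw [smul_smul, mul_inv_cancel_left] at h1
    exact h1.trans (hf x _)
  obtain ⟨x, hx⟩ : ∃ x, ∀ y, f x ≤ f y := by
    obtain ⟨m, ⟨x, rfl⟩, hm⟩ :=
      WellFounded.has_min (wellFounded_lt (α := ℕ)) (Set.range f) ⟨_, x₀, rfl⟩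
    exact ⟨x, fun y => not_lt.mp (hm _ ⟨y, rfl⟩)⟩
  refine ⟨x, fun s => by_contra fun hs => ?_⟩
  obtain ⟨q, hq⟩ := hG.connected.exists_isPath x (s • x)
  -- as `x` and `s • x` are of the same class, they are not adjacent
  obtain ⟨z, hz, hzx, hzy⟩ : ∃ z ∈ q.support, z ≠ x ∧ z ≠ s • x := by
    have hn : ¬ G.Adj x (s • x) := fun h => hc _ _ h (hcT s x).symm
    clear hq
    generalize s • x = y at q hs hn
    cases q with
    | nil => exact absurd rfl hs
    | @cons _ z _ h r => exact ⟨z, by simp, h.ne', fun e => hn (e ▸ h)⟩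
  have hlt : ∀ t : T, G.dist z (t • x₀) < f x := fun t =>
    (hG.dist_lt_or_dist_lt hq hz hzx hzy (o := t • x₀)).elim (fun h => h.trans_le (hf x t))
      fun h => h.trans_le ((hf _ t).trans (hfT s x))
  refine (hx z).not_gt ((Finset.sup_lt_iff ?_).mpr fun t _ => hlt t)
  exact (Nat.zero_le _).trans_lt (hlt 1)

end SimpleGraph

/-! ### Morphisms of a fusion system on a subgroup -/

namespace FusionSystem

variable {p : ℕ} {G K : Type w} [Group G] [Group K]

theorem IsMorphism.exists_isMor {F : FusionSystem p G} {E : FusionSystem p K} {φ : G →* K}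
    (h : F.IsMorphism E φ) {P : Subgroup G} {f : G → G} (hf : F.IsMor P f) :
    ∃ g, E.IsMor (P.map φ) g ∧ ∀ x ∈ P, g (φ x) = φ (f x) := by
  obtain ⟨α, hα, hfα⟩ := hf
  obtain ⟨β, hβ, hβα⟩ := h _ _ α hα
  obtain ⟨g, hg⟩ : ∃ g : K → K, ∀ x : P.map φ, g x = β x :=
    ⟨_, fun x => Subtype.val_injective.extend_apply (fun x => (β x : K)) id x⟩
  refine ⟨g, isMor_of_mem_hom hβ hg, fun x hx => ?_⟩
  have h1 := congrArg Subtype.val (DFunLike.congr_fun hβα ⟨x, hx⟩)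
  refine (hg ⟨φ x, x, hx, rfl⟩).trans (h1.symm.trans ?_)
  rw [hfα ⟨x, hx⟩]
  rfl

theorem isMorphism_of_exists_isMor {F : FusionSystem p G} {E : FusionSystem p K} {φ : G →* K}
    (h : ∀ (P : Subgroup G) (f : G → G), F.IsMor P f →
      ∃ g, E.IsMor (P.map φ) g ∧ ∀ x ∈ P, g (φ x) = φ (f x)) : F.IsMorphism E φ := by
  intro P R α hα
  obtain ⟨f, hf⟩ : ∃ f : G → G, ∀ x : P, f x = α x :=
    ⟨_, fun x => Subtype.val_injective.extend_apply (fun x => (α x : G)) id x⟩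
  obtain ⟨g, hg, e⟩ := h P f (isMor_of_mem_hom hα hf)
  have hval : ∀ x : P, g (φ x) = φ (α x) := fun x => by rw [e x x.2, hf x]
  have hmem : ∀ y ∈ P.map φ, g y ∈ R.map φ := by
    rintro _ ⟨x, hx, rfl⟩
    exact ⟨α ⟨x, hx⟩, (α _).2, (hval ⟨x, hx⟩).symm⟩
  refine ⟨⟨⟨fun y => ⟨g y, hmem y y.2⟩, Subtype.ext hg.isEmb.map_one⟩,
    fun x y => Subtype.ext (hg.isEmb.map_mul x x.2 y y.2)⟩, hg.mem_hom fun _ => rfl, ?_⟩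
  ext x
  exact (hval x).symm

/-- The function `f` on `K` is, on the subgroup `P`, a morphism of the fusion system `F` on `G`,
where `G` is identified with its image under `j`. -/
def MorAlong (F : FusionSystem p G) (j : G →* K) (P : Subgroup K) (f : K → K) : Prop :=
  P ≤ j.range ∧ ∃ φ, F.IsMor (P.comap j) φ ∧ ∀ x, j x ∈ P → f (j x) = j (φ x)

theorem jinv_apply {j : G →* K} (hj : Function.Injective j) (x : G) :
    pinv (⊤ : Subgroup G) j (j x) = x :=
  (j.isEmb hj ⊤).pinv_apply trivial

theorem jinv_isEmb {j : G →* K} (hj : Function.Injective j) {P : Subgroup K} (hP : P ≤ j.range) :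
    IsEmb P (pinv (⊤ : Subgroup G) j) := by
  refine (j.isEmb hj ⊤).pinv.of_le ?_
  rwa [img_eq_map, ← MonoidHom.range_eq_map]

theorem img_jinv {j : G →* K} (hj : Function.Injective j) {P : Subgroup K} (hP : P ≤ j.range) :
    img P (pinv (⊤ : Subgroup G) j) = P.comap j := by
  ext x
  rw [(jinv_isEmb hj hP).mem_img]
  constructor
  · rintro ⟨y, hy, rfl⟩
    obtain ⟨x, rfl⟩ := hP hy
    rwa [jinv_apply hj]
  · exact fun hx => ⟨j x, hx, jinv_apply hj x⟩

variable {F : FusionSystem p G} {j : G →* K}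

namespace MorAlong

variable {P : Subgroup K} {f : K → K}

theorem congr (h : F.MorAlong j P f) {g : K → K} (hg : ∀ x ∈ P, g x = f x) : F.MorAlong j P g := by
  obtain ⟨hP, φ, hφ, e⟩ := h
  exact ⟨hP, φ, hφ, fun x hx => by rw [hg _ hx, e x hx]⟩

theorem of_le (h : F.MorAlong j P f) {Q : Subgroup K} (hQ : Q ≤ P) : F.MorAlong j Q f := by
  obtain ⟨hP, φ, hφ, e⟩ := h
  exact ⟨hQ.trans hP, φ, hφ.of_le (Subgroup.comap_mono hQ), fun x hx => e x (hQ hx)⟩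

theorem img_le (h : F.MorAlong j P f) : img P f ≤ j.range := by
  obtain ⟨hP, φ, hφ, e⟩ := h
  rw [img_le_iff]
  intro y hy
  obtain ⟨x, rfl⟩ := hP hy
  rw [e x hy]
  exact ⟨_, rfl⟩

theorem isEmb (hj : Function.Injective j) (h : F.MorAlong j P f) : IsEmb P f := by
  obtain ⟨hP, φ, hφ, e⟩ := h
  have h1 := ((jinv_isEmb hj hP).comp hφ.isEmb (img_jinv hj hP).le).comp (j.isEmb hj ⊤) le_top
  refine h1.congr fun y hy => ?_
  obtain ⟨x, rfl⟩ := hP hy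
  rw [e x hy, jinv_apply hj]

theorem comap_img (hj : Function.Injective j) (hP : P ≤ j.range) {φ : G → G}
    (hφ : F.IsMor (P.comap j) φ) (hf : IsEmb P f) (e : ∀ x, j x ∈ P → f (j x) = j (φ x)) :
    (img P f).comap j = img (P.comap j) φ := by
  ext z
  rw [Subgroup.mem_comap, hf.mem_img, hφ.isEmb.mem_img]
  constructor
  · rintro ⟨y, hy, hyz⟩
    obtain ⟨x, rfl⟩ := hP hy
    exact ⟨x, hy, hj (by rw [← e x hy, hyz])⟩
  · rintro ⟨x, hx, rfl⟩
    exact ⟨j x, hx, e x hx⟩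

theorem comp (hj : Function.Injective j) (h : F.MorAlong j P f) {R : Subgroup K} {g : K → K}
    (hg : F.MorAlong j R g) (hR : img P f ≤ R) : F.MorAlong j P fun x => g (f x) := by
  have hf := h.isEmb hj
  obtain ⟨hP, φ, hφ, e⟩ := h
  obtain ⟨-, ψ, hψ, e'⟩ := hg
  refine ⟨hP, _, hφ.comp hψ ?_, fun x hx => ?_⟩
  · rw [← comap_img hj hP hφ hf e]
    exact Subgroup.comap_mono hR
  · have h1 := hR (mem_img_of_mem f hx)
    rw [e x hx] at h1
    dsimp only
    rw [e x hx, e' _ h1]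

protected theorem pinv (hj : Function.Injective j) (h : F.MorAlong j P f) :
    F.MorAlong j (img P f) (pinv P f) := by
  have hf := h.isEmb hj
  have hle := h.img_le
  obtain ⟨hP, φ, hφ, e⟩ := h
  have hi := comap_img hj hP hφ hf e
  refine ⟨hle, _, hi ▸ hφ.pinv, fun z hz => ?_⟩
  obtain ⟨y, hy, hyz⟩ := hf.mem_img.mp hz
  obtain ⟨x, rfl⟩ := hP hy
  rw [← hyz, hf.pinv_apply hy]
  rw [e x hy] at hyz
  rw [← hj hyz, hφ.isEmb.pinv_apply hy]

end MorAlong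

theorem morAlong_conj (F : FusionSystem p G) {P : Subgroup K} (hP : P ≤ j.range) {s : K}
    (hs : s ∈ j.range) : F.MorAlong j P fun x => s * x * s⁻¹ := by
  obtain ⟨s, rfl⟩ := hs
  exact ⟨hP, _, F.isMor_conj _ s, fun x _ => by simp⟩

theorem morAlong_id (F : FusionSystem p G) {P : Subgroup K} (hP : P ≤ j.range) :
    F.MorAlong j P fun x => x :=
  ⟨hP, _, F.isMor_id _, fun _ _ => rfl⟩

theorem morAlong_map (hj : Function.Injective j) {P : Subgroup G} {f : G → G} (hf : F.IsMor P f) :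
    F.MorAlong j (P.map j) fun y => j (f (pinv (⊤ : Subgroup G) j y)) := by
  refine ⟨Subgroup.map_le_range j P, f, ?_, fun x _ => by dsimp only; rw [jinv_apply hj]⟩
  rwa [Subgroup.comap_map_eq_self_of_injective hj]

/-- Morphisms of fusion systems map morphisms to morphisms. -/
theorem IsMorphism.isMor {E : FusionSystem p K} (h : F.IsMorphism E j) {P : Subgroup K} {f : K → K}
    (hf : F.MorAlong j P f) : E.IsMor P f := by
  obtain ⟨hP, φ, hφ, e⟩ := hf
  obtain ⟨g, hg, hgφ⟩ := h.exists_isMor hφ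
  rw [Subgroup.map_comap_eq_self hP] at hg
  refine hg.congr fun y hy => ?_
  obtain ⟨x, rfl⟩ := hP hy
  rw [e x hy, hgφ x hy]

theorem IsMorphism.morAlong {H : Type w} [Group H] {D : FusionSystem p H} {i : H →* G}
    (h : D.IsMorphism F i) (hj : Function.Injective j) {P : Subgroup K} {f : K → K}
    (hf : D.MorAlong (j.comp i) P f) : F.MorAlong j P f := by
  obtain ⟨hP, φ, hφ, e⟩ := hf
  obtain ⟨g, hg, hgφ⟩ := h.exists_isMor hφ
  have hP' : P ≤ j.range := fun y hy => by
    obtain ⟨x, rfl⟩ := hP hy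
    exact ⟨i x, rfl⟩
  have key : ∀ x, j x ∈ P → ∃ z, (j.comp i) z ∈ P ∧ i z = x := fun x hx => by
    obtain ⟨z, hz⟩ := hP hx
    exact ⟨z, hz ▸ hx, hj hz⟩
  refine ⟨hP', g, hg.of_le fun x hx => ?_, fun x hx => ?_⟩
  · obtain ⟨z, hz, rfl⟩ := key x hx
    exact ⟨z, hz, rfl⟩
  · obtain ⟨z, hz, rfl⟩ := key x hx
    rw [hgφ z hz]
    exact e z hz

/-- In a saturated fusion system every `p`-group of automorphisms of a subgroup is moved by some
morphism to a group of automorphisms induced by conjugation. -/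
theorem exists_lift_along (hsat : ∀ P : Subgroup G, F.SaturatedAt P) (hj : Function.Injective j)
    {P : Subgroup K} (hP : P ≤ j.range) {T : Subgroup (MulAut P)} (hT : IsPGroup p T)
    (hTF : ∀ t ∈ T, F.MorAlong j P (autFun t)) :
    ∃ τ, F.MorAlong j P τ ∧ T ≤ twistAut j.range P τ := by
  have hE := jinv_isEmb hj hP
  have hi := img_jinv hj hP
  obtain ⟨T', hT', h1, h2⟩ := hE.exists_transported hT hi
  have hT'F : T' ≤ F.aut (P.comap j) := by
    intro t' ht'
    obtain ⟨t, ht, h⟩ := h1 t' ht'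
    obtain ⟨-, φ, hφ, e⟩ := hTF t ht
    refine mem_aut_iff.mpr (hφ.congr fun x hx => ?_)
    have h3 := h (j x) hx
    rwa [jinv_apply hj, e x hx, jinv_apply hj] at h3
  obtain ⟨Q, ⟨g, hg, hgQ⟩, hQ, -⟩ := hsat (P.comap j)
  obtain ⟨τ, hτ, -, hτT⟩ := hQ.exists_lift hg hgQ hT'F hT'
  refine ⟨fun y => j (τ (pinv (⊤ : Subgroup G) j y)), ⟨hP, τ, hτ, fun x _ => by
    dsimp only; rw [jinv_apply hj]⟩, fun t ht => ?_⟩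
  obtain ⟨t', ht', h⟩ := h2 t ht
  obtain ⟨s, -, hs⟩ := hτT ht'
  refine ⟨j s, ⟨s, rfl⟩, fun y hy => ?_⟩
  dsimp only
  obtain ⟨x, rfl⟩ := hP hy
  rw [← h _ hy, jinv_apply hj, hs x hy, map_mul, map_mul, map_inv]

/-- The extension property for subgroups that are centric in a larger fusion system. -/
theorem exists_extension_along (hsat : ∀ P : Subgroup G, F.SaturatedAt P)
    (hj : Function.Injective j) {E : FusionSystem p K} (hE : F.IsMorphism E j) {P : Subgroup K}
    (hPc : E.IsCentric P) {f : K → K} (hf : F.MorAlong j P f) {M : Subgroup K} (hM : M ≤ j.range)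
    (hMf : ∀ g ∈ M, g ∈ Subgroup.normalizer (P : Set K) ∧
      ∃ h ∈ j.range, ∀ x ∈ P, f (g * x * g⁻¹) = h * f x * h⁻¹) :
    ∃ f', F.MorAlong j M f' ∧ ∀ x ∈ P, f' x = f x := by
  have hfE := hf.isEmb hj
  have hfm := hE.isMor hf
  obtain ⟨hP, φ, hφ, e⟩ := hf
  have hi := MorAlong.comap_img hj hP hφ hfE e
  have hc : F.IsCentric (img (P.comap j) φ) := by
    rw [isCentric_iff]
    intro g hg c hc
    rw [← hi] at hg hc ⊢
    have hle : img P f ≤ j.range := MorAlong.img_le (F := F) ⟨hP, φ, hφ, e⟩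
    have hg' : F.MorAlong j (img P f) fun y => j (g (pinv (⊤ : Subgroup G) j y)) :=
      ⟨hle, g, hg, fun x _ => by dsimp only; rw [jinv_apply hj]⟩
    have hi' := MorAlong.comap_img hj hle hg (hg'.isEmb hj) fun x _ => by
      rw [jinv_apply hj]
    rw [← hi'] at hc ⊢
    refine ((hPc.img hfm).img (hE.isMor hg')).centralizer_le ?_
    refine Subgroup.mem_centralizer_iff.mpr fun y hy => ?_
    obtain ⟨x, rfl⟩ := hg'.img_le hy
    rw [← map_mul, Subgroup.mem_centralizer_iff.mp hc x hy, map_mul]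
  obtain ⟨φ', hφ', e'⟩ := hc.receptive (hsat _) _ φ hφ rfl
  have hle : M.comap j ≤ transporter (P.comap j) φ := by
    intro g hg
    obtain ⟨hgN, h, ⟨h, rfl⟩, hh⟩ := hMf (j g) hg
    refine ⟨Subgroup.mem_normalizer_iff.mpr fun x => ?_, h, fun x hx => hj ?_⟩
    · rw [Subgroup.mem_comap, Subgroup.mem_comap, Subgroup.mem_normalizer_iff.mp hgN (j x)]
      simp
    · have h1 := hh (j x) hx
      have h2 : j (g * x * g⁻¹) ∈ P := by
        simpa using conj_mem_of_mem_normalizer hgN hx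
      rw [← e _ h2]
      simpa [← e x hx] using h1
  refine ⟨fun y => j (φ' (pinv (⊤ : Subgroup G) j y)), ⟨hM, φ', hφ'.of_le hle, fun x _ => by
    dsimp only; rw [jinv_apply hj]⟩, fun y hy => ?_⟩
  obtain ⟨x, rfl⟩ := hP hy
  dsimp only
  rw [jinv_apply hj, e' x hy, e x hy]

end FusionSystem

/-! ### Orbit graphs -/

namespace FusionSystem

variable {p : ℕ} {S : Type w} [Group S] {F : FusionSystem p S}

theorem repRel_iff {P : Type*} [Group P] {α β : P →* S} :
    F.RepRel α β ↔ ∃ c, F.IsMor α.range c ∧ ∀ y, c (α y) = β y := by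
  constructor
  · rintro ⟨γ, hγ, h⟩
    obtain ⟨c, hc⟩ : ∃ c : S → S, ∀ x : α.range, c x = γ x :=
      ⟨_, fun x => Subtype.val_injective.extend_apply (fun x => (γ x : S)) id x⟩
    exact ⟨c, isMor_of_mem_hom hγ.1 hc, fun y =>
      (hc (α.rangeRestrict y)).trans (congrArg Subtype.val (h y))⟩
  · rintro ⟨c, hc, h⟩
    have hi : img α.range c = β.range := by
      ext z
      rw [hc.isEmb.mem_img]
      constructor
      · rintro ⟨_, ⟨y, rfl⟩, rfl⟩
        exact ⟨y, (h y).symm⟩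
      · rintro ⟨y, rfl⟩
        exact ⟨α y, ⟨y, rfl⟩, h y⟩
    obtain ⟨γ, hγ, e⟩ := hc.exists_iso hi
    exact ⟨γ, hγ, fun y => Subtype.ext ((e (α.rangeRestrict y)).symm.trans (h y))⟩

theorem RepRel.comp_right {P : Type*} [Group P] {α β : P →* S} (h : F.RepRel α β) (t : MulAut P) :
    F.RepRel (α.comp t.toMonoidHom) (β.comp t.toMonoidHom) := by
  rw [repRel_iff] at h ⊢
  obtain ⟨c, hc, h⟩ := h
  refine ⟨c, hc.of_le ?_, fun y => h (t y)⟩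
  rintro _ ⟨y, rfl⟩
  exact ⟨t y, rfl⟩

end FusionSystem

namespace TreeOfFusionSystems

variable {p : ℕ} {V : Type u} {𝓣 : TreeOfFusionSystems.{u, w} p V} {K : Type w} [Group K]
  {E : FusionSystem p K} {ι : ∀ r, 𝓣.grp r →* K} {P : Subgroup K}

/-- The function `f`, a morphism of `E` on `P`, represents the point `x` of the `P`-orbit graph. -/
def IsRep (x : Σ r : V ⊕ 𝓣.graph.edgeSet, Rep E ι P r) (f : K → K) : Prop :=
  ∃ α : HomTo E ι P x.1, x.2 = Quotient.mk _ α ∧ ∀ y : P, f y = ι x.1 (α.1 y)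

theorem exists_isRep (x : Σ r : V ⊕ 𝓣.graph.edgeSet, Rep E ι P r) : ∃ f, IsRep x f := by
  obtain ⟨r, x⟩ := x
  induction x using Quotient.inductionOn with
  | h α =>
    exact ⟨_, α, rfl, fun y => Subtype.val_injective.extend_apply (fun y => ι r (α.1 y)) id y⟩

namespace IsRep

variable {x : Σ r : V ⊕ 𝓣.graph.edgeSet, Rep E ι P r} {f g : K → K}

theorem isMor (h : IsRep x f) : E.IsMor P f := by
  obtain ⟨α, -, e⟩ := h
  exact FusionSystem.isMor_of_mem_hom α.2 e

theorem img_le (h : IsRep x f) : img P f ≤ (ι x.1).range := by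
  obtain ⟨α, -, e⟩ := h
  rw [img_le_iff]
  intro y hy
  rw [e ⟨y, hy⟩]
  exact ⟨_, rfl⟩

theorem congr (h : IsRep x f) (hg : ∀ y ∈ P, g y = f y) : IsRep x g := by
  obtain ⟨α, hα, e⟩ := h
  exact ⟨α, hα, fun y => by rw [hg y y.2, e y]⟩

theorem exists_morAlong (hinj : ∀ r, Function.Injective (ι r)) (h : IsRep x f) (h' : IsRep x g) :
    ∃ δ, (𝓣.fus x.1).MorAlong (ι x.1) (img P f) δ ∧ ∀ y ∈ P, δ (f y) = g y := by
  obtain ⟨α, hα, e⟩ := h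
  obtain ⟨β, hβ, e'⟩ := h'
  obtain ⟨c, hc, hcα⟩ := FusionSystem.repRel_iff.mp (Quotient.exact (hα.symm.trans hβ))
  refine ⟨_, (FusionSystem.morAlong_map (hinj x.1) hc).of_le ?_, fun y hy => ?_⟩
  · rw [img_le_iff]
    intro y hy
    rw [e ⟨y, hy⟩]
    exact ⟨_, ⟨_, rfl⟩, rfl⟩
  · rw [e ⟨y, hy⟩, FusionSystem.jinv_apply (hinj x.1), hcα, e' ⟨y, hy⟩]

theorem of_morAlong (hι : 𝓣.IsCocone E ι) (h : IsRep x f)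
    {δ : K → K} (hδ : (𝓣.fus x.1).MorAlong (ι x.1) (img P f) δ) : IsRep x fun y => δ (f y) := by
  have hm := h.isMor.comp ((hι.isMorphism x.1).isMor hδ) le_rfl
  obtain ⟨α, hα, e⟩ := h
  obtain ⟨-, c, hc, hδc⟩ := hδ
  have hmem : ∀ y : P, ι x.1 (α.1 y) ∈ img P f := fun y => e y ▸ mem_img_of_mem f y.2
  have hle : α.1.range ≤ (img P f).comap (ι x.1) := by
    rintro _ ⟨y, rfl⟩
    exact hmem y
  have hcE := hc.isEmb
  let β : P →* 𝓣.grp x.1 := MonoidHom.mk' (fun y => c (α.1 y)) fun y z => by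
    rw [map_mul, hcE.map_mul _ (hmem y) _ (hmem z)]
  have hβ : ∀ y : P, δ (f y) = ι x.1 (β y) := fun y => by
    rw [e y, hδc _ (hmem y)]
    rfl
  refine ⟨⟨β, hm.mem_hom fun y => hβ y⟩, ?_, hβ⟩
  rw [hα]
  exact Quotient.sound (FusionSystem.repRel_iff.mpr ⟨c, hc.of_le hle, fun y => rfl⟩)

theorem unique (hinj : ∀ r, Function.Injective (ι r)) {r : V ⊕ 𝓣.graph.edgeSet}
    {x y : Rep E ι P r} (h : IsRep ⟨r, x⟩ f) (h' : IsRep ⟨r, y⟩ f) : x = y := by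
  obtain ⟨α, hα, e⟩ := h
  obtain ⟨β, hβ, e'⟩ := h'
  have : α = β := Subtype.ext (MonoidHom.ext fun y => hinj r ((e y).symm.trans (e' y)))
  exact hα.trans (this ▸ hβ.symm)

/-- The two ends of a segment have a common representative. -/
theorem repMap (hι : 𝓣.IsCocone E ι) {e : 𝓣.graph.edgeSet} {v : V} (h : v ∈ e.1)
    {y : Rep E ι P (Sum.inr e)} (hf : IsRep ⟨Sum.inr e, y⟩ f) :
    IsRep ⟨Sum.inl v, repMap hι P e v h y⟩ f := by
  obtain ⟨α, hα, e'⟩ := hf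
  refine ⟨homToMap hι P e v h α, ?_, fun y => ?_⟩
  · dsimp only at hα
    rw [hα]
    rfl
  · rw [e' y]
    exact (DFunLike.congr_fun (hι.comm e v h) (α.1 y)).symm

end IsRep

theorem exists_isRep_of_isMor (hinj : ∀ r, Function.Injective (ι r)) {f : K → K}
    (hf : E.IsMor P f) {r : V ⊕ 𝓣.graph.edgeSet} (hr : img P f ≤ (ι r).range) :
    ∃ x : Rep E ι P r, IsRep ⟨r, x⟩ f := by
  have hE := hf.isEmb
  have hmem : ∀ y : P, f y ∈ (ι r).range := fun y => hr (mem_img_of_mem f y.2)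
  have hspec : ∀ y : P, ι r (pinv ⊤ (ι r) (f y)) = f y := by
    intro y
    obtain ⟨z, hz⟩ := hmem y
    rw [← hz, FusionSystem.jinv_apply (hinj r)]
  let α : P →* 𝓣.grp r := MonoidHom.mk' (fun y => pinv ⊤ (ι r) (f y)) fun y z => hinj r (by
    rw [map_mul, hspec, hspec, hspec, Subgroup.coe_mul, hE.map_mul _ y.2 _ z.2])
  let β : HomTo E ι P r := ⟨α, hf.mem_hom fun y => (hspec y).symm⟩
  exact ⟨Quotient.mk _ β, β, rfl, fun y => (hspec y).symm⟩

theorem orbitGraph_adj (hι : 𝓣.IsCocone E ι) {e : 𝓣.graph.edgeSet} {v : V} (h : v ∈ e.1)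
    (y : Rep E ι P (Sum.inr e)) :
    (orbitGraph hι P).Adj ⟨Sum.inr e, y⟩ ⟨Sum.inl v, repMap hι P e v h y⟩ := by
  rw [orbitGraph, SimpleGraph.fromRel_adj]
  exact ⟨fun h => (by simpa using congrArg Sigma.fst h), Or.inl ⟨e, v, h, y, rfl, rfl⟩⟩

theorem orbitGraph_adj_of_isRep (hι : 𝓣.IsCocone E ι) (hinj : ∀ r, Function.Injective (ι r))
    {e : 𝓣.graph.edgeSet} {v : V} (h : v ∈ e.1) {x : Rep E ι P (Sum.inl v)}
    {y : Rep E ι P (Sum.inr e)} {f : K → K} (hx : IsRep ⟨Sum.inl v, x⟩ f)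
    (hy : IsRep ⟨Sum.inr e, y⟩ f) : (orbitGraph hι P).Adj ⟨Sum.inr e, y⟩ ⟨Sum.inl v, x⟩ := by
  rw [hx.unique hinj (hy.repMap hι h)]
  exact orbitGraph_adj hι h y

theorem exists_of_orbitGraph_adj (hι : 𝓣.IsCocone E ι)
    {a b : Σ r : V ⊕ 𝓣.graph.edgeSet, Rep E ι P r} (hab : (orbitGraph hι P).Adj a b) :
    ∃ (e : 𝓣.graph.edgeSet) (v : V) (h : v ∈ e.1) (y : Rep E ι P (Sum.inr e)),
      a = ⟨Sum.inr e, y⟩ ∧ b = ⟨Sum.inl v, repMap hι P e v h y⟩ ∨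
      b = ⟨Sum.inr e, y⟩ ∧ a = ⟨Sum.inl v, repMap hι P e v h y⟩ := by
  rw [orbitGraph, SimpleGraph.fromRel_adj] at hab
  obtain ⟨-, ⟨e, v, h, y, h1⟩ | ⟨e, v, h, y, h1⟩⟩ := hab
  · exact ⟨e, v, h, y, Or.inl h1⟩
  · exact ⟨e, v, h, y, Or.inr h1⟩

/-- Precomposition with an automorphism of `P` in `E`, on `Rep_E(P, F(r))`. -/
def repPrecomp (t : E.aut P) {r : V ⊕ 𝓣.graph.edgeSet} : Rep E ι P r → Rep E ι P r :=
  Quotient.map (fun α : HomTo E ι P r => ⟨α.1.comp t.1.toMonoidHom, E.comp_mem t.2.1 α.2⟩)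
    fun _ _ h => FusionSystem.RepRel.comp_right h t.1

/-- Precomposition with an automorphism of `P` in `E`, on the `P`-orbit graph. -/
def precomp (t : E.aut P) (x : Σ r : V ⊕ 𝓣.graph.edgeSet, Rep E ι P r) :
    Σ r : V ⊕ 𝓣.graph.edgeSet, Rep E ι P r :=
  ⟨x.1, repPrecomp t x.2⟩

theorem IsRep.precomp {x : Σ r : V ⊕ 𝓣.graph.edgeSet, Rep E ι P r} {f : K → K} (h : IsRep x f)
    (t : E.aut P) : IsRep (precomp t x) fun y => f (autFun t.1 y) := by
  obtain ⟨α, hα, e⟩ := h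
  refine ⟨⟨α.1.comp t.1.toMonoidHom, E.comp_mem t.2.1 α.2⟩, congrArg (repPrecomp t) hα,
    fun y => ?_⟩
  exact (congrArg f (autFun_apply t.1 y.2)).trans (e (t.1 y))

/-- The action of the automorphisms of `P` in `E` on the `P`-orbit graph; as precomposition is an
action on the right, `t` acts as precomposition with `t⁻¹`. -/
@[reducible] def repAction (E : FusionSystem p K) (ι : ∀ r, 𝓣.grp r →* K) (P : Subgroup K) :
    MulAction (E.aut P) (Σ r : V ⊕ 𝓣.graph.edgeSet, Rep E ι P r) where
  smul t x := precomp t⁻¹ x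
  one_smul := by
    rintro ⟨r, x⟩
    induction x using Quotient.inductionOn with
    | h α => rfl
  mul_smul := by
    rintro s t ⟨r, x⟩
    induction x using Quotient.inductionOn with
    | h α =>
      change precomp (s * t)⁻¹ _ = precomp s⁻¹ (precomp t⁻¹ _)
      rw [mul_inv_rev]
      rfl

theorem precomp_adj (hι : 𝓣.IsCocone E ι) (t : E.aut P)
    {a b : Σ r : V ⊕ 𝓣.graph.edgeSet, Rep E ι P r} (hab : (orbitGraph hι P).Adj a b) :
    (orbitGraph hι P).Adj (precomp t a) (precomp t b) := by
  obtain ⟨e, v, h, y, ⟨rfl, rfl⟩ | ⟨rfl, rfl⟩⟩ := exists_of_orbitGraph_adj hι hab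
  · induction y using Quotient.inductionOn with
    | h α => exact orbitGraph_adj hι h (repPrecomp t (Quotient.mk _ α))
  · induction y using Quotient.inductionOn with
    | h α => exact (orbitGraph_adj hι h (repPrecomp t (Quotient.mk _ α))).symm

end TreeOfFusionSystems

/-! ### Automorphisms of centric subgroups -/

theorem isPGroup_zpowers {p : ℕ} {G : Type*} [Group G] {g : G} {k : ℕ} (hg : g ^ p ^ k = 1) :
    IsPGroup p (Subgroup.zpowers g) := by
  rintro ⟨_, n, rfl⟩
  refine ⟨k, Subtype.ext ?_⟩
  change (g ^ n) ^ p ^ k = 1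
  rw [← zpow_natCast, zpow_comm, zpow_natCast, hg, one_zpow]

theorem FusionSystem.exists_pow_eq_one {p : ℕ} {S : Type w} [Group S] (E : FusionSystem p S) :
    ∃ k : ℕ, ∀ z : S, z ^ p ^ k = 1 := by
  have := E.finite
  have := Fintype.ofFinite S
  choose k hk using E.isPGroup
  refine ⟨Finset.univ.sup k, fun z => ?_⟩
  obtain ⟨c, hc⟩ := pow_dvd_pow p (Finset.le_sup (f := k) (Finset.mem_univ z))
  rw [hc, pow_mul, hk, one_pow]

namespace TreeOfFusionSystems

variable {p : ℕ} {V : Type u} {𝓣 : TreeOfFusionSystems.{u, w} p V} {K : Type w} [Group K]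
  {E : FusionSystem p K} {ι : ∀ r, 𝓣.grp r →* K}

/-- A cocone under a tree of fusion systems which consists of injective maps, with saturated
fusion systems at the vertices, such that the orbit graphs of the centric subgroups are trees, and
such that every edge group is all of the group of one of the ends of the edge. -/
structure HasOrbitTrees (hι : 𝓣.IsCocone E ι) : Prop where
  injective : ∀ r, Function.Injective (ι r)
  saturatedAt : ∀ v P, (𝓣.fus (Sum.inl v)).SaturatedAt P
  isTree : ∀ P, E.IsCentric P → (orbitGraph hι P).IsTree
  surjective : ∀ e : 𝓣.graph.edgeSet, ∃ (v : V) (h : v ∈ e.1), Function.Surjective (𝓣.map e v h)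

theorem IsCocone.morAlong_of_edge (hι : 𝓣.IsCocone E ι) (hinj : ∀ r, Function.Injective (ι r))
    {e : 𝓣.graph.edgeSet} {v : V} (h : v ∈ e.1) {P : Subgroup K} {f : K → K}
    (hf : (𝓣.fus (Sum.inr e)).MorAlong (ι (Sum.inr e)) P f) :
    (𝓣.fus (Sum.inl v)).MorAlong (ι (Sum.inl v)) P f := by
  rw [← hι.comm e v h] at hf
  exact (𝓣.map_isInjectiveMorphism e v h).1.morAlong (hinj _) hf

theorem exists_mem_edge (e : 𝓣.graph.edgeSet) : ∃ v, v ∈ e.1 := by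
  obtain ⟨e, he⟩ := e
  induction e using Sym2.ind with
  | h v w => exact ⟨v, Sym2.mem_mk_left v w⟩

variable {hι : 𝓣.IsCocone E ι}

/-- A `p`-group of automorphisms of a centric subgroup `P` fixes a point of the tree
`Rep_E(P, F)`, so it acts on a conjugate of `P` by automorphisms in `F(v)` for some vertex `v`. -/
theorem HasOrbitTrees.exists_lift (h : HasOrbitTrees hι) {P : Subgroup K} (hP : E.IsCentric P)
    {T : Subgroup (MulAut P)} (hTA : T ≤ E.aut P) (hT : IsPGroup p T) :
    ∃ f, E.IsMor P f ∧ T ≤ twistAut ⊤ P f := by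
  have := E.finite
  let _ : MulAction T (Σ r : V ⊕ 𝓣.graph.edgeSet, Rep E ι P r) :=
    @MulAction.compHom _ _ _ _ (repAction E ι P) _ (Subgroup.inclusion hTA)
  have hsmul : ∀ (t : T) (x : Σ r : V ⊕ 𝓣.graph.edgeSet, Rep E ι P r),
    t • x = precomp (Subgroup.inclusion hTA t)⁻¹ x := fun _ _ => rfl
  obtain ⟨x, hx⟩ := (h.isTree P hP).exists_fixed_vertex (T := T) (c := fun x => x.1.isLeft = true)
    (fun t x y hxy => precomp_adj hι _ hxy)
    (fun x y hxy => by
      obtain ⟨e, v, hv, z, ⟨rfl, rfl⟩ | ⟨rfl, rfl⟩⟩ := exists_of_orbitGraph_adj hι hxy <;> simp)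
    (fun t x => Iff.rfl)
  obtain ⟨f, hf⟩ := exists_isRep x
  have hfix : ∀ t ∈ T, ∃ δ, (𝓣.fus x.1).MorAlong (ι x.1) (img P f) δ ∧
      ∀ y ∈ P, δ (f y) = f (autFun t y) := by
    intro t ht
    have h1 := hsmul ⟨t, ht⟩⁻¹ x
    rw [hx, map_inv, inv_inv] at h1
    have h2 := hf.precomp (Subgroup.inclusion hTA ⟨t, ht⟩)
    rw [← h1] at h2
    exact hf.exists_morAlong h.injective h2
  have hfm := hf.isMor
  obtain ⟨v, hv, hfix⟩ : ∃ v, img P f ≤ (ι (Sum.inl v)).range ∧ ∀ t ∈ T, ∃ δ,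
      (𝓣.fus (Sum.inl v)).MorAlong (ι (Sum.inl v)) (img P f) δ ∧
      ∀ y ∈ P, δ (f y) = f (autFun t y) := by
    have hle := hf.img_le
    obtain ⟨v | e, x⟩ := x
    · exact ⟨v, hle, hfix⟩
    · obtain ⟨v, hv⟩ := exists_mem_edge e
      refine ⟨v, (hf.repMap hι hv).img_le, fun t ht => ?_⟩
      obtain ⟨δ, hδ, e⟩ := hfix t ht
      exact ⟨δ, hι.morAlong_of_edge h.injective hv hδ, e⟩
  obtain ⟨T', hT', h1, h2⟩ := hfm.isEmb.exists_transported hT rfl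
  obtain ⟨τ, hτ, hτT⟩ := FusionSystem.exists_lift_along (h.saturatedAt v) (h.injective _) hv hT'
    fun t' ht' => by
      obtain ⟨t, ht, e⟩ := h1 t' ht'
      obtain ⟨δ, hδ, e'⟩ := hfix t ht
      refine hδ.congr fun y hy => ?_
      obtain ⟨z, hz, rfl⟩ := hfm.isEmb.mem_img.mp hy
      rw [e z hz, e' z hz]
  refine ⟨_, hfm.comp ((hι.isMorphism _).isMor hτ) le_rfl, fun t ht => ?_⟩
  obtain ⟨t', ht', e⟩ := h2 t ht
  obtain ⟨s, -, hs⟩ := hτT ht'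
  refine ⟨s, trivial, fun y hy => ?_⟩
  dsimp only
  rw [← e y hy, hs _ (mem_img_of_mem f hy)]

/-- Centric subgroups have fully automised conjugates. -/
theorem HasOrbitTrees.exists_automised [Fact p.Prime] (h : HasOrbitTrees hι) {P : Subgroup K}
    (hP : E.IsCentric P) : ∃ f, E.IsMor P f ∧ E.Automised (img P f) := by
  have := E.finite
  obtain ⟨⟨D, hD, hmax⟩⟩ : Nonempty (Sylow p (E.aut P)) := inferInstance
  have hDA : D.map (E.aut P).subtype ≤ E.aut P := Subgroup.map_subtype_le _
  obtain ⟨f, hf, hfD⟩ := h.exists_lift hP hDA (hD.map _)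
  have hE := hf.isEmb
  refine ⟨f, hf, fun U hU hUp => ?_⟩
  have hi : img (img P f) (pinv P f) = P := hE.img_pinv le_rfl
  obtain ⟨U', hU', h1, h2⟩ := hE.pinv.exists_transported hUp hi
  have hUA : U' ≤ E.aut P := by
    intro u' hu'
    obtain ⟨u, hu, e⟩ := h1 u' hu'
    exact hf.pinv.map_aut hi (hU hu) e
  obtain ⟨T, hTA, hT, hDT, a, ha, haT⟩ := exists_common_pSubgroup (hD.map _) hU' hDA hUA
  have hTD : T ≤ D.map (E.aut P).subtype := by
    have h3 : T.subgroupOf (E.aut P) = D := by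
      refine hmax (hT.comap_subtype (K := E.aut P)) fun d hd => ?_
      exact hDT ⟨d, hd, rfl⟩
    intro t ht
    rw [← h3]
    exact ⟨⟨t, hTA ht⟩, ht, rfl⟩
  have ham := FusionSystem.mem_aut_iff.mp ha
  have hcomp : E.IsMor (img P f) fun y => f (autFun a (pinv P f y)) :=
    (hf.pinv.comp (ham.of_le hi.le) le_rfl).comp hf (by
      rw [hE.pinv.img_comp ham.isEmb hi.le, hi, img_autFun])
  refine ⟨_, hcomp, ?_, fun u hu => ?_⟩
  · refine img_eq_of_card_le hcomp.isEmb (img_le_iff.mpr fun y hy => ?_) le_rfl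
    exact mem_img_of_mem f (autFun_mem a (hE.pinv_mem hy))
  · obtain ⟨u', hu', e⟩ := h2 u hu
    obtain ⟨s, -, hs⟩ := hfD (hTD (haT u' hu'))
    refine ⟨s, trivial, fun y hy => ?_⟩
    have hy' := hE.pinv_mem hy
    dsimp only
    rw [← e y hy]
    have h3 := hs _ (autFun_mem a hy')
    rwa [autFun_mul _ _ (autFun_mem a hy'), autFun_inv_self a hy', autFun_mul _ _ hy'] at h3

/-- An automorphism that is trivial on a centric subgroup `Q` is conjugation by an element
of `Q`. -/
theorem HasOrbitTrees.exists_conj (h : HasOrbitTrees hι) {Q M : Subgroup K} (hQ : E.IsCentric Q)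
    (hQM : Q ≤ M) (hMN : M ≤ Subgroup.normalizer (Q : Set K)) {θ : MulAut M} (hθ : θ ∈ E.aut M)
    (hθQ : ∀ x ∈ Q, autFun θ x = x) : ∃ q ∈ Q, ∀ m ∈ M, autFun θ m = q * m * q⁻¹ := by
  have hE := autFun_isEmb θ
  -- `θ m` and `m` act in the same way on `Q`
  have hz : ∀ m ∈ M, ∃ z ∈ Q, autFun θ m = m * z := by
    intro m hm
    refine ⟨m⁻¹ * autFun θ m, hQ.centralizer_le ?_, by group⟩
    refine Subgroup.mem_centralizer_iff.mpr fun x hx => ?_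
    have h1 := hE.map_conj hm (hQM hx)
    rw [hθQ _ (conj_mem_of_mem_normalizer (hMN hm) hx), hθQ x hx] at h1
    calc x * (m⁻¹ * autFun θ m) = m⁻¹ * (m * x * m⁻¹) * autFun θ m := by group
      _ = m⁻¹ * autFun θ m * x := by rw [h1]; group
  have hpow : ∀ (n : ℕ) (m z : K), m ∈ M → z ∈ Q → autFun θ m = m * z →
      autFun (θ ^ n) m = m * z ^ n := by
    intro n m z hm hz e
    induction n with
    | zero => rw [pow_zero, autFun_one hm, pow_zero, mul_one]
    | succ n ih =>
      rw [pow_succ', autFun_mul _ _ hm, ih, hE.map_mul _ hm _ (M.pow_mem (hQM hz) n), e,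
        hθQ _ (Q.pow_mem hz n), pow_succ', mul_assoc]
  have hT : IsPGroup p (Subgroup.zpowers θ) := by
    obtain ⟨k, hk⟩ := E.exists_pow_eq_one
    refine isPGroup_zpowers (k := k) (autFun_ext fun m hm => ?_)
    obtain ⟨z, hz, e⟩ := hz m hm
    rw [hpow _ m z hm hz e, hk, mul_one, autFun_one hm]
  obtain ⟨f, hf, hfT⟩ := h.exists_lift (hQ.of_le hQM) (Subgroup.zpowers_le.mpr hθ) hT
  obtain ⟨s, -, hs⟩ := hfT (Subgroup.mem_zpowers θ)
  have hfE := hf.isEmb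
  have hsC : s ∈ Subgroup.centralizer (img Q f : Set K) := by
    refine Subgroup.mem_centralizer_iff.mpr fun y hy => ?_
    obtain ⟨x, hx, rfl⟩ := (hfE.mem_img_of_le hQM).mp hy
    have h1 := hs x (hQM hx)
    rw [hθQ x hx] at h1
    conv_lhs => rw [h1]
    group
  obtain ⟨q, hq, rfl⟩ := (hfE.mem_img_of_le hQM).mp
    ((hQ.img (hf.of_le hQM)).centralizer_le hsC)
  refine ⟨q, hq, fun m hm => hfE.injOn (autFun_mem θ hm) ?_ ?_⟩
  · exact M.mul_mem (M.mul_mem (hQM hq) hm) (M.inv_mem (hQM hq))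
  · rw [hs m hm, hfE.map_conj (hQM hq) hm]

end TreeOfFusionSystems

/-! ### Automorphisms in the fusion systems of edges -/

namespace FusionSystem

variable {p : ℕ} {G K : Type w} [Group G] [Group K] (F : FusionSystem p G) {j : G →* K}

/-- `Aut_F(P)` for a subgroup `P` of the image of `G` under `j`. -/
def autAlong (hj : Function.Injective j) {P : Subgroup K} (hP : P ≤ j.range) :
    Subgroup (MulAut P) where
  carrier := {a | F.MorAlong j P (autFun a)}
  mul_mem' {a b} ha hb := (hb.comp hj ha (img_autFun b).le).congr fun _ hx => autFun_mul a b hx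
  one_mem' := (F.morAlong_id hP).congr fun _ hx => autFun_one hx
  inv_mem' {a} ha := by
    have h := ha.pinv hj
    rw [img_autFun] at h
    refine h.congr fun x hx => ?_
    have h1 := (autFun_isEmb a).pinv_apply (autFun_mem a⁻¹ hx)
    rw [autFun_self_inv a hx] at h1
    exact h1.symm

end FusionSystem

namespace TreeOfFusionSystems

variable {p : ℕ} {V : Type u} {𝓣 : TreeOfFusionSystems.{u, w} p V} {K : Type w} [Group K]
  {E : FusionSystem p K} {ι : ∀ r, 𝓣.grp r →* K} {hι : 𝓣.IsCocone E ι}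

/-- Let `Q` be a centric subgroup of an edge group `S(e)`. An automorphism of `Q` in `F(e)` that
normalises the automorphisms of `Q` induced by `S(e)` extends in `F(e)` to the normaliser `M` of `Q`
in `S(e)`: it extends in both `F(v)` and `F(w)`, where `v` and `w` are the ends of `e`, and as the
`M`-orbit graph has no cycles the extension belongs to `F(e)`. -/
theorem HasOrbitTrees.exists_edge_extension (h : HasOrbitTrees hι) {e : 𝓣.graph.edgeSet}
    {Q M : Subgroup K} (hQ : E.IsCentric Q) (hQM : Q ≤ M)
    (hM : M = (ι (Sum.inr e)).range ⊓ Subgroup.normalizer (Q : Set K)) {x : MulAut Q}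
    (hx : (𝓣.fus (Sum.inr e)).MorAlong (ι (Sum.inr e)) Q (autFun x))
    (hxM : ∀ g ∈ M, ∃ s ∈ M, ∀ y ∈ Q, autFun x (g * y * g⁻¹) = s * autFun x y * s⁻¹) :
    ∃ θ ∈ E.aut M, (𝓣.fus (Sum.inr e)).MorAlong (ι (Sum.inr e)) M (autFun θ) ∧
      ∀ y ∈ Q, autFun θ y = autFun x y := by
  have := E.finite
  have hMe : M ≤ (ι (Sum.inr e)).range := hM.le.trans inf_le_left
  have hMN : M ≤ Subgroup.normalizer (Q : Set K) := hM.le.trans inf_le_right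
  have hMv : ∀ v, v ∈ e.1 → M ≤ (ι (Sum.inl v)).range := by
    intro v hv
    refine hMe.trans ?_
    rw [← hι.comm e v hv]
    rintro _ ⟨y, rfl⟩
    exact ⟨_, rfl⟩
  have key : ∀ v, v ∈ e.1 → ∃ θ : MulAut M,
      (𝓣.fus (Sum.inl v)).MorAlong (ι (Sum.inl v)) M (autFun θ) ∧
      ∀ y ∈ Q, autFun θ y = autFun x y := by
    intro v hv
    obtain ⟨f, hf, hfx⟩ := FusionSystem.exists_extension_along (h.saturatedAt v) (h.injective _)
      (hι.isMorphism _) hQ (hι.morAlong_of_edge h.injective hv hx) (hMv v hv) fun g hg => by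
        obtain ⟨s, hs, e⟩ := hxM g hg
        exact ⟨hMN hg, s, hMv v hv hs, e⟩
    have hfE := hf.isEmb (h.injective _)
    have hfM : img M f = M := by
      refine img_eq_of_card_le hfE (img_le_iff.mpr fun g hg => ?_) le_rfl
      obtain ⟨s, hs, e⟩ := hxM g hg
      refine mem_of_conj_eq (hQ.centralizer_le.trans hQM) hs fun y hy => ?_
      have hy' := autFun_mem x⁻¹ hy
      have h1 := hfE.map_conj hg (hQM hy')
      rw [hfx _ (conj_mem_of_mem_normalizer (hMN hg) hy'), hfx _ hy', e _ hy',
        autFun_self_inv x hy] at h1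
      exact h1.symm
    obtain ⟨θ, hθ⟩ := hfE.exists_aut hfM
    exact ⟨θ, hf.congr hθ, fun y hy => by rw [hθ y (hQM hy), hfx y hy]⟩
  obtain ⟨v, w, hv, hw, hvw⟩ : ∃ v w, v ∈ e.1 ∧ w ∈ e.1 ∧ v ≠ w := by
    obtain ⟨e, he⟩ := e
    induction e using Sym2.ind with
    | h v w => exact ⟨v, w, Sym2.mem_mk_left v w, Sym2.mem_mk_right v w, he.ne⟩
  obtain ⟨θ, hθ, hθx⟩ := key v hv
  obtain ⟨θ', hθ', hθx'⟩ := key w hw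
  have hθE : θ ∈ E.aut M := FusionSystem.mem_aut_iff.mpr ((hι.isMorphism _).isMor hθ)
  have hθE' : θ' ∈ E.aut M := FusionSystem.mem_aut_iff.mpr ((hι.isMorphism _).isMor hθ')
  -- the two extensions of `x` differ by an inner automorphism
  obtain ⟨q, hq, hqθ⟩ := h.exists_conj hQ hQM hMN (mul_mem (inv_mem hθE') hθE) fun y hy => by
    rw [autFun_mul _ _ (hQM hy), hθx y hy, ← hθx' y hy, autFun_inv_self _ (hQM hy)]
  have hθw : (𝓣.fus (Sum.inl w)).MorAlong (ι (Sum.inl w)) M (autFun θ) := by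
    have hqM : img M (fun m => q * m * q⁻¹) ≤ M := img_le_iff.mpr fun m hm =>
      M.mul_mem (M.mul_mem (hQM hq) hm) (M.inv_mem (hQM hq))
    refine (((𝓣.fus (Sum.inl w)).morAlong_conj (hMv w hw) (hMv w hw (hQM hq))).comp
      (h.injective _) hθ' hqM).congr fun m hm => ?_
    rw [← hqθ m hm, ← autFun_mul _ _ hm, mul_inv_cancel_left]
  have hid : E.IsMor M fun y => y := E.isMor_id M
  have hMi : img M (fun y => y) = M := img_id M
  obtain ⟨a, ha⟩ := exists_isRep_of_isMor h.injective hid (r := Sum.inl v) (hMi.le.trans (hMv v hv))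
  obtain ⟨b, hb⟩ := exists_isRep_of_isMor h.injective hid (r := Sum.inl w) (hMi.le.trans (hMv w hw))
  obtain ⟨c, hc⟩ := exists_isRep_of_isMor h.injective hid (r := Sum.inr e) (hMi.le.trans hMe)
  obtain ⟨d, hd⟩ := exists_isRep_of_isMor h.injective (FusionSystem.mem_aut_iff.mp hθE)
    (r := Sum.inr e) ((img_autFun θ).le.trans hMe)
  have ha' := ha.of_morAlong hι (δ := autFun θ) (hMi.symm ▸ hθ)
  have hb' := hb.of_morAlong hι (δ := autFun θ) (hMi.symm ▸ hθw)
  -- the identity and `θ` are joined to the same two points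
  have hcd := (h.isTree M (hQ.of_le hQM)).isAcyclic.eq_of_adj
    (fun hab => hvw (Sum.inl_injective (congrArg Sigma.fst hab)))
    (orbitGraph_adj_of_isRep hι h.injective hv ha hc).symm
    (orbitGraph_adj_of_isRep hι h.injective hw hb hc)
    (orbitGraph_adj_of_isRep hι h.injective hv ha' hd).symm
    (orbitGraph_adj_of_isRep hι h.injective hw hb' hd)
  rw [← hcd] at hd
  obtain ⟨δ, hδ, e⟩ := hc.exists_morAlong h.injective hd
  rw [hMi] at hδ
  exact ⟨θ, hθE, hδ.congr fun y hy => (e y hy).symm, hθx⟩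

/-- Let `Q` be a centric subgroup of an edge group `S(e)`. Although `F(e)` need not be saturated,
every `p`-group of automorphisms of `Q` in `F(e)` can be moved into the automorphisms induced by
elements of `S(e)`. -/
theorem HasOrbitTrees.exists_edge_lift [Fact p.Prime] (h : HasOrbitTrees hι) {e : 𝓣.graph.edgeSet}
    {Q : Subgroup K} (hQ : E.IsCentric Q) (hQe : Q ≤ (ι (Sum.inr e)).range)
    {T : Subgroup (MulAut Q)} (hT : IsPGroup p T)
    (hTF : ∀ t ∈ T, (𝓣.fus (Sum.inr e)).MorAlong (ι (Sum.inr e)) Q (autFun t)) :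
    ∃ δ, (𝓣.fus (Sum.inr e)).MorAlong (ι (Sum.inr e)) Q δ ∧
      T ≤ twistAut (ι (Sum.inr e)).range Q δ := by
  have := E.finite
  induction hn : Nat.card K - Nat.card Q using Nat.strong_induction_on generalizing Q with
  | _ n ih =>
  have hj := h.injective (Sum.inr e)
  set j := ι (Sum.inr e) with hjdef
  -- a conjugate of `Q` in `F(e)` with maximal normaliser in `S(e)`
  obtain ⟨δ₁, hδ₁, hmax⟩ := Set.exists_max_image
    {δ : K → K | (𝓣.fus (Sum.inr e)).MorAlong j Q δ}
    (fun δ => Nat.card (j.range ⊓ Subgroup.normalizer (img Q δ : Set K) : Subgroup K))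
    (Set.toFinite _) ⟨fun y => y, (𝓣.fus (Sum.inr e)).morAlong_id hQe⟩
  have hδ₁ : (𝓣.fus (Sum.inr e)).MorAlong j Q δ₁ := hδ₁
  have hE₁ := hδ₁.isEmb hj
  have hδ₁E : E.IsMor Q δ₁ := (hι.isMorphism _).isMor hδ₁
  set Q₁ := img Q δ₁ with hQ₁
  set M := j.range ⊓ Subgroup.normalizer (Q₁ : Set K) with hM
  have hQ₁c : E.IsCentric Q₁ := hQ.img hδ₁E
  have hQ₁e : Q₁ ≤ j.range := hδ₁.img_le
  have hQ₁M : Q₁ ≤ M := le_inf hQ₁e Subgroup.le_normalizer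
  obtain ⟨T', hT', h1, h2⟩ := hE₁.exists_transported hT rfl
  let A := (𝓣.fus (Sum.inr e)).autAlong hj hQ₁e
  let D := twistAut j.range Q₁ fun y => y
  have hD : IsPGroup p D := isPGroup_twistAut E.isPGroup _ (id_isEmb _)
  have hDA : D ≤ A := by
    rintro a ⟨s, hs, ha⟩
    exact ((𝓣.fus (Sum.inr e)).morAlong_conj hQ₁e hs).congr ha
  have hTA : T' ≤ A := by
    intro t' ht'
    obtain ⟨t, ht, e⟩ := h1 t' ht'
    have hi : img Q₁ (pinv Q δ₁) = Q := hE₁.img_pinv le_rfl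
    have h3 := ((hδ₁.pinv hj).comp hj (hTF t ht) hi.le).comp hj hδ₁ (by
      rw [hE₁.pinv.img_comp (autFun_isEmb t) hi.le]
      change img (img Q₁ _) _ ≤ _
      rw [hi, img_autFun])
    refine h3.congr fun y hy => ?_
    obtain ⟨z, hz, rfl⟩ := hE₁.mem_img.mp hy
    rw [e z hz, hE₁.pinv_apply hz]
  obtain ⟨U, hUA, hU, hDU, a, ha, haU⟩ := exists_common_pSubgroup hD hT' hDA hTA
  suffices hUD : U ≤ D by
    refine ⟨_, hδ₁.comp hj ha le_rfl, fun t ht => ?_⟩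
    obtain ⟨t', ht', e⟩ := h2 t ht
    obtain ⟨s, hs, e'⟩ := hUD (haU t' ht')
    refine ⟨s, hs, fun y hy => ?_⟩
    have hy' := mem_img_of_mem δ₁ hy
    have h3 := e' _ (autFun_mem a hy')
    dsimp only at h3 ⊢
    rwa [autFun_mul _ _ (autFun_mem a hy'), autFun_inv_self a hy', autFun_mul _ _ hy', e y hy] at h3
  by_contra hUD
  obtain ⟨x, ⟨hxU, hxN⟩, hxD⟩ := SetLike.exists_of_lt
    (hU.lt_inf_normalizer (lt_of_le_not_ge hDU hUD))
  have hxA := hUA hxU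
  have hxM : ∀ g ∈ M, ∃ s ∈ M, ∀ y ∈ Q₁, autFun x (g * y * g⁻¹) = s * autFun x y * s⁻¹ := by
    intro g hg
    obtain ⟨c, hc, e⟩ := exists_mem_twistAut_id hg.1 hg.2
    obtain ⟨s, hs, e'⟩ := conj_mem_of_mem_normalizer hxN hc
    have e'' : ∀ y ∈ Q₁, autFun x (g * y * g⁻¹) = s * autFun x y * s⁻¹ := fun y hy => by
      have h3 := e' _ (autFun_mem x hy)
      rw [autFun_mul _ _ (autFun_mem x hy), autFun_inv_self x hy, autFun_mul _ _ hy, e y hy] at h3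
      exact h3
    refine ⟨s, ⟨hs, mem_normalizer_of_forall_conj_mem fun y hy => ?_⟩, e''⟩
    have h3 := e'' _ (autFun_mem x⁻¹ hy)
    rw [autFun_self_inv x hy] at h3
    rw [← h3]
    exact autFun_mem x (conj_mem_of_mem_normalizer hg.2 (autFun_mem x⁻¹ hy))
  rcases hQ₁M.eq_or_lt with hQM | hQM
  · -- in this case `Q₁ = S(e) = S(v)` for an end `v` of `e`, and `F(v)` is saturated
    have hQj : Q₁ = j.range := by
      by_contra hne
      have h3 := (E.isPGroup.to_subgroup _).lt_inf_normalizer (lt_of_le_of_ne hQ₁e hne)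
      exact h3.ne hQM
    obtain ⟨v, hv, hsurj⟩ := h.surjective e
    have hvj : (ι (Sum.inl v)).range = Q₁ := by
      rw [hQj, hjdef, ← hι.comm e v hv, MonoidHom.range_comp, MonoidHom.range_eq_top.mpr hsurj,
        ← MonoidHom.range_eq_map]
    obtain ⟨τ, hτ, hτU⟩ := FusionSystem.exists_lift_along (h.saturatedAt v) (h.injective _)
      hvj.ge hU fun t ht => hι.morAlong_of_edge h.injective hv (hUA ht)
    obtain ⟨s, hs, hsτ⟩ := hτU hxU
    have hτE := hτ.isEmb (h.injective _)
    have hτi : img Q₁ τ = Q₁ := img_eq_of_card_le hτE (hτ.img_le.trans hvj.le) le_rfl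
    rw [hvj, ← hτi, hτE.mem_img] at hs
    obtain ⟨q, hq, rfl⟩ := hs
    refine hxD ⟨q, hQ₁e hq, fun y hy => hτE.injOn (autFun_mem x hy) ?_ ?_⟩
    · exact Q₁.mul_mem (Q₁.mul_mem hq hy) (Q₁.inv_mem hq)
    · rw [hsτ y hy, hτE.map_conj hq hy]
  · obtain ⟨θ, hθE, hθ, hθx⟩ := h.exists_edge_extension hQ₁c hQ₁M hM hxA hxM
    have hθp : IsPGroup p (Subgroup.zpowers θ) := by
      obtain ⟨k, hk⟩ := hU ⟨x, hxU⟩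
      obtain ⟨m, hm⟩ := E.exists_pow_eq_one
      have hxk : x ^ p ^ k = 1 := congrArg Subtype.val hk
      have hpow : ∀ n : ℕ, ∀ y ∈ Q₁, autFun (θ ^ n) y = autFun (x ^ n) y := by
        intro n y hy
        induction n with
        | zero => rw [pow_zero, pow_zero, autFun_one hy, autFun_one (hQ₁M hy)]
        | succ n ih =>
          rw [pow_succ', pow_succ', autFun_mul _ _ (hQ₁M hy), autFun_mul _ _ hy, ih,
            hθx _ (autFun_mem _ hy)]
      obtain ⟨q, hq, hqθ⟩ := h.exists_conj hQ₁c hQ₁M inf_le_right (pow_mem hθE (p ^ k))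
        fun y hy => by rw [hpow _ y hy, hxk, autFun_one hy]
      have hqpow : ∀ n : ℕ, ∀ y ∈ M, autFun ((θ ^ p ^ k) ^ n) y = q ^ n * y * (q ^ n)⁻¹ := by
        intro n y hy
        induction n with
        | zero => rw [pow_zero, autFun_one hy]; group
        | succ n ih =>
          rw [pow_succ', autFun_mul _ _ hy, hqθ _ (autFun_mem _ hy), ih, pow_succ' q]
          group
      refine isPGroup_zpowers (k := k + m) (autFun_ext fun y hy => ?_)
      rw [pow_add, pow_mul, hqpow _ y hy, hm, autFun_one hy]
      group
    have hcard : Nat.card Q < Nat.card M := by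
      rw [← hE₁.card_img]
      exact FusionSystem.card_lt_of_lt hQM
    have hcardM := Subgroup.card_le_card_group M
    obtain ⟨δ, hδ, hδT⟩ := ih (Nat.card K - Nat.card M) (by omega) (hQ₁c.of_le hQ₁M) inf_le_left
      hθp (fun t ht => (Subgroup.zpowers_le (H := (𝓣.fus (Sum.inr e)).autAlong hj
        (inf_le_left : M ≤ j.range))).mpr hθ ht) rfl
    obtain ⟨s, hs, hsθ⟩ := hδT (Subgroup.mem_zpowers θ)
    have hδE := hδ.isEmb hj
    have h3 := hmax (fun y => δ (δ₁ y)) (hδ₁.comp hj (hδ.of_le hQ₁M) le_rfl)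
    rw [hE₁.img_comp (hδE.of_le hQ₁M) le_rfl] at h3
    have h4 : img M δ = j.range ⊓ Subgroup.normalizer (img Q₁ δ : Set K) :=
      img_eq_of_card_le hδE (le_inf hδ.img_le (hδE.img_le_normalizer hQ₁M inf_le_right)) h3
    -- now `s` lies in the normaliser of the image of `Q₁`, which is the image of `M`
    have hsM : s ∈ img M δ := by
      rw [h4]
      refine ⟨hs, mem_normalizer_of_forall_conj_mem fun z hz => ?_⟩
      obtain ⟨y, hy, rfl⟩ := (hδE.mem_img_of_le hQ₁M).mp hz
      rw [← hsθ y (hQ₁M hy), hθx y hy]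
      exact mem_img_of_mem δ (autFun_mem x hy)
    obtain ⟨m, hm, rfl⟩ := hδE.mem_img.mp hsM
    refine hxD ⟨m, hm.1, fun y hy => hδE.injOn (hQ₁M (autFun_mem x hy)) ?_ ?_⟩
    · exact M.mul_mem (M.mul_mem hm (hQ₁M hy)) (M.inv_mem hm)
    · rw [← hθx y hy, hsθ y (hQ₁M hy), hδE.map_conj hm (hQ₁M hy)]

end TreeOfFusionSystems

/-! ### Extension of morphisms along paths of an orbit graph -/

namespace TreeOfFusionSystems

variable {p : ℕ} {V : Type u} {𝓣 : TreeOfFusionSystems.{u, w} p V} {K : Type w} [Group K]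
  {E : FusionSystem p K} {ι : ∀ r, 𝓣.grp r →* K} {hι : 𝓣.IsCocone E ι}

theorem precomp_injective {P : Subgroup K} (t : E.aut P) :
    Function.Injective (precomp t : (Σ r : V ⊕ 𝓣.graph.edgeSet, Rep E ι P r) → _) := by
  refine Function.LeftInverse.injective (g := precomp t⁻¹) ?_
  rintro ⟨r, x⟩
  induction x using Quotient.inductionOn with
  | h α =>
    refine congrArg (fun β : HomTo E ι P r => (⟨r, Quotient.mk _ β⟩ : Σ r, Rep E ι P r))
      (Subtype.ext (MonoidHom.ext fun y => congrArg α.1 ?_))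
    exact t.1.apply_symm_apply y

/-- Extension of the composite of a morphism `f` on `M` and a morphism `ε` in `F(v)` on the image
of `P`, by saturation of `F(v)`. -/
theorem HasOrbitTrees.exists_extension (h : HasOrbitTrees hι) {P M : Subgroup K}
    (hP : E.IsCentric P) (hPM : P ≤ M) (hMN : M ≤ Subgroup.normalizer (P : Set K)) {v : V}
    {f ε : K → K} (hf : E.IsMor M f) (hfv : img M f ≤ (ι (Sum.inl v)).range)
    (hε : (𝓣.fus (Sum.inl v)).MorAlong (ι (Sum.inl v)) (img P f) ε)
    (hM : ∀ m ∈ M, ∃ s ∈ (ι (Sum.inl v)).range, ∀ z ∈ P,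
      ε (f (m * z * m⁻¹)) = s * ε (f z) * s⁻¹) :
    ∃ g, E.IsMor M g ∧ ∀ z ∈ P, g z = ε (f z) := by
  have hE := hf.isEmb
  obtain ⟨ε', hε', e⟩ := FusionSystem.exists_extension_along (h.saturatedAt v) (h.injective _)
    (hι.isMorphism _) (hP.img (hf.of_le hPM)) hε hfv fun k hk => by
      refine ⟨hE.img_le_normalizer hPM hMN hk, ?_⟩
      obtain ⟨m, hm, rfl⟩ := hE.mem_img.mp hk
      obtain ⟨s, hs, e⟩ := hM m hm
      refine ⟨s, hs, fun y hy => ?_⟩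
      obtain ⟨z, hz, rfl⟩ := (hE.mem_img_of_le hPM).mp hy
      rw [← hE.map_conj hm (hPM hz), e z hz]
  exact ⟨_, hf.comp ((hι.isMorphism _).isMor hε') le_rfl, fun z hz => e _ (mem_img_of_mem f hz)⟩

/-- If the adjacent points `a` and `b` of the `P`-orbit graph are fixed by `M ≤ N(P)` and `a` is
represented by a morphism that extends to `M`, then so is `b`. -/
theorem HasOrbitTrees.exists_isRep_of_adj [Fact p.Prime] (h : HasOrbitTrees hι) {P M : Subgroup K}
    (hP : E.IsCentric P) (hPM : P ≤ M) (hMN : M ≤ Subgroup.normalizer (P : Set K))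
    {a b : Σ r : V ⊕ 𝓣.graph.edgeSet, Rep E ι P r} (hab : (orbitGraph hι P).Adj a b)
    (hb : ∀ t : E.aut P, t.1 ∈ twistAut M P (fun y => y) → precomp t b = b)
    (ha : ∃ f, IsRep a f ∧ E.IsMor M f ∧ img M f ≤ (ι a.1).range) :
    ∃ f, IsRep b f ∧ E.IsMor M f ∧ img M f ≤ (ι b.1).range := by
  have := E.finite
  obtain ⟨f, hfa, hf, hfi⟩ := ha
  obtain ⟨e, v, hv, y, ⟨rfl, rfl⟩ | ⟨rfl, rfl⟩⟩ := exists_of_orbitGraph_adj hι hab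
  · refine ⟨f, hfa.repMap hι hv, hf, hfi.trans ?_⟩
    rw [← hι.comm e v hv]
    rintro _ ⟨z, rfl⟩
    exact ⟨_, rfl⟩
  obtain ⟨g, hg⟩ := exists_isRep (⟨Sum.inr e, y⟩ : Σ r : V ⊕ 𝓣.graph.edgeSet, Rep E ι P r)
  have hgm := hg.isMor
  have hev : (ι (Sum.inr e)).range ≤ (ι (Sum.inl v)).range := by
    rw [← hι.comm e v hv]
    rintro _ ⟨z, rfl⟩
    exact ⟨_, rfl⟩
  have hTE : twistAut M P (fun y => y) ≤ E.aut P := FusionSystem.twistAut_le_aut (E.isMor_id P) M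
  obtain ⟨T', hT', h1, h2⟩ := hgm.isEmb.exists_transported
    (isPGroup_twistAut E.isPGroup M (id_isEmb P)) rfl
  obtain ⟨δ, hδ, hδT⟩ := h.exists_edge_lift (e := e) (hP.img hgm) hg.img_le hT' fun t' ht' => by
    obtain ⟨t, ht, e⟩ := h1 t' ht'
    have h3 := hg.precomp ⟨t, hTE ht⟩
    rw [hb ⟨t, hTE ht⟩ ht] at h3
    obtain ⟨δ, hδ, e'⟩ := hg.exists_morAlong h.injective h3
    refine hδ.congr fun y hy => ?_
    obtain ⟨z, hz, rfl⟩ := hgm.isEmb.mem_img.mp hy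
    rw [e z hz, e' z hz]
  -- after composition with `δ` the representative `g` transports `M` into the edge group
  have hg₁ := hg.of_morAlong hι hδ
  have key : ∀ m ∈ M, ∃ s ∈ (ι (Sum.inr e)).range, ∀ z ∈ P,
      δ (g (m * z * m⁻¹)) = s * δ (g z) * s⁻¹ := by
    intro m hm
    obtain ⟨t, ht, e⟩ := exists_mem_twistAut_id hm (hMN hm)
    obtain ⟨t', ht', e'⟩ := h2 t ht
    obtain ⟨s, hs, e''⟩ := hδT ht'
    refine ⟨s, hs, fun z hz => ?_⟩
    rw [← e z hz, ← e' z hz, e'' _ (mem_img_of_mem g hz)]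
  obtain ⟨ε, hε, hεf⟩ := hfa.exists_morAlong h.injective (hg₁.repMap hι hv)
  obtain ⟨f', hf', hf'P⟩ := h.exists_extension hP hPM hMN hf hfi hε fun m hm => by
    obtain ⟨s, hs, e⟩ := key m hm
    refine ⟨s, hev hs, fun z hz => ?_⟩
    rw [hεf z hz, hεf _ (conj_mem_of_mem_normalizer (hMN hm) hz), e z hz]
  have hf'g : ∀ z ∈ P, f' z = δ (g z) := fun z hz => by rw [hf'P z hz, hεf z hz]
  refine ⟨f', hg₁.congr hf'g, hf', img_le_iff.mpr fun m hm => ?_⟩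
  obtain ⟨s, hs, e⟩ := key m hm
  refine mem_of_conj_eq ((hP.img hg₁.isMor).centralizer_le.trans hg₁.img_le) hs fun y hy => ?_
  obtain ⟨z, hz, rfl⟩ := hg₁.isMor.isEmb.mem_img.mp hy
  have h3 := hf'.isEmb.map_conj hm (hPM hz)
  rw [hf'g z hz, hf'g _ (conj_mem_of_mem_normalizer (hMN hm) hz), e z hz] at h3
  exact h3.symm

/-- Morphisms `φ` from a centric subgroup `P` extend to `N_φ`: the group `N_φ` fixes the points of
the `P`-orbit graph represented by the inclusion and by `φ`, so it fixes the path between them,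
along which the extension of the inclusion to `N_φ` is carried to an extension of `φ`. -/
theorem HasOrbitTrees.receptive [Fact p.Prime] (h : HasOrbitTrees hι) {v₀ : V}
    (hv₀ : (ι (Sum.inl v₀)).range = ⊤) {Q : Subgroup K} (hQ : E.IsCentric Q) : E.Receptive Q := by
  rintro P φ hφ rfl
  have hP : E.IsCentric P := .of_img hφ hQ
  set M := transporter P φ with hM
  have hPM : P ≤ M := le_transporter hφ.isEmb
  have hMN : M ≤ Subgroup.normalizer (P : Set K) := fun g hg => hg.1
  have htop : ∀ R : Subgroup K, R ≤ (ι (Sum.inl v₀)).range := fun R => hv₀ ▸ le_top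
  obtain ⟨a, ha⟩ := exists_isRep_of_isMor h.injective (E.isMor_id P) (htop _)
  obtain ⟨b, hb⟩ := exists_isRep_of_isMor h.injective hφ (htop _)
  have hfix : ∀ t : E.aut P, t.1 ∈ twistAut M P (fun y => y) →
      precomp t ⟨_, a⟩ = ⟨_, a⟩ ∧ precomp t ⟨_, b⟩ = ⟨_, b⟩ := by
    rintro t ⟨g, hg, e⟩
    obtain ⟨-, s, hs⟩ := hg
    have ha' := ha.of_morAlong hι ((𝓣.fus _).morAlong_conj (htop _) (htop ⊤ (trivial : g ∈ ⊤)))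
    have hb' := hb.of_morAlong hι ((𝓣.fus _).morAlong_conj (htop _) (htop ⊤ (trivial : s ∈ ⊤)))
    have ha'' : IsRep (precomp t ⟨_, a⟩) fun y => g * y * g⁻¹ := (ha.precomp t).congr fun y hy =>
      (e y hy).symm
    have hb'' : IsRep (precomp t ⟨_, b⟩) fun y => s * φ y * s⁻¹ := (hb.precomp t).congr
      fun y hy => by rw [← hs y hy, ← e y hy]
    exact ⟨congrArg (Sigma.mk _) (ha''.unique h.injective ha'),
      congrArg (Sigma.mk _) (hb''.unique h.injective hb')⟩
  have hG := h.isTree P hP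
  obtain ⟨q, hq⟩ := hG.connected.exists_isPath ⟨_, a⟩ ⟨_, b⟩
  have hfixq : ∀ z ∈ q.support, ∀ t : E.aut P, t.1 ∈ twistAut M P (fun y => y) →
      precomp t z = z := fun z hz t ht =>
    hG.isAcyclic.fixed_of_mem_support ⟨precomp t, precomp_adj hι t⟩ (precomp_injective t) hq
      (hfix t ht).1 (hfix t ht).2 hz
  have walk : ∀ {x y} (q : (orbitGraph hι P).Walk x y), (∀ z ∈ q.support, ∀ t : E.aut P,
      t.1 ∈ twistAut M P (fun y => y) → precomp t z = z) →
      (∃ f, IsRep x f ∧ E.IsMor M f ∧ img M f ≤ (ι x.1).range) →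
      ∃ f, IsRep y f ∧ E.IsMor M f ∧ img M f ≤ (ι y.1).range := by
    intro x y q
    induction q with
    | nil => exact fun _ h => h
    | cons hadj q ih =>
      intro hq hx
      rw [SimpleGraph.Walk.support_cons] at hq
      exact ih (fun z hz => hq z (List.mem_cons_of_mem _ hz))
        (h.exists_isRep_of_adj hP hPM hMN hadj
          (hq _ (List.mem_cons_of_mem _ q.start_mem_support)) hx)
  obtain ⟨f, hfb, hf, hfi⟩ := walk q hfixq ⟨_, ha, E.isMor_id M, htop _⟩
  obtain ⟨ε, hε, hεf⟩ := hfb.exists_morAlong h.injective hb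
  obtain ⟨g, hg, e⟩ := h.exists_extension hP hPM hMN hf hfi hε fun m hm => by
    obtain ⟨hmN, s, hs⟩ := hm
    refine ⟨s, htop ⊤ trivial, fun z hz => ?_⟩
    rw [hεf z hz, hεf _ (conj_mem_of_mem_normalizer hmN hz), hs z hz]
  exact ⟨g, hg, fun z hz => by rw [e z hz, hεf z hz]⟩

theorem HasOrbitTrees.saturatedAt_of_isCentric [Fact p.Prime] (h : HasOrbitTrees hι) {v₀ : V}
    (hv₀ : (ι (Sum.inl v₀)).range = ⊤) {P : Subgroup K} (hP : E.IsCentric P) :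
    E.SaturatedAt P := by
  obtain ⟨f, hf, ha⟩ := h.exists_automised hP
  exact ⟨_, ⟨f, hf, rfl⟩, ha, h.receptive hv₀ (hP.img hf)⟩

end TreeOfFusionSystems

/-! ### Generated fusion systems -/

namespace FusionSystem

variable {p : ℕ} {S : Type w} [Group S]

/-- The fusion system on `S` whose morphisms are the composites of restrictions of the given
maps. -/
def generated [hfin : Finite S] (hS : IsPGroup p S) (B : Subgroup S → (S → S) → Prop)
    (hB : ∀ R g, B R g → IsEmb R g) (hB' : ∀ R g, B R g → B (img R g) (pinv R g))
    (hconj : ∀ s, B ⊤ fun x => s * x * s⁻¹) : FusionSystem p S where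
  finite := hfin
  isPGroup := hS
  Hom P Q := {φ | ∃ f, Gen B P f ∧ ∀ x : P, f x = φ x}
  comp_mem := by
    rintro P Q R φ ψ ⟨f, hf, e⟩ ⟨g, hg, e'⟩
    refine ⟨_, hf.comp hB hg (img_le_iff.mpr fun x hx => ?_), fun x => ?_⟩
    · rw [e ⟨x, hx⟩]
      exact (φ _).2
    · simp only [e x, e' (φ x)]
      rfl
  conj_mem s φ h := ⟨_, .of_mem (hconj s) le_top, fun x => (h x).symm⟩
  injective := by
    rintro P Q φ ⟨f, hf, e⟩ x y hxy
    refine Subtype.ext ((hf.isEmb hB).injOn x.2 y.2 ?_)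
    rw [e x, e y, hxy]
  factor := by
    rintro P Q φ ⟨f, hf, e⟩
    have hE := hf.isEmb hB
    have hle : img P f ≤ Q := img_le_iff.mpr fun x hx => by
      rw [e ⟨x, hx⟩]
      exact (φ _).2
    let ψ : P ≃* img P f :=
      { toFun := fun x => ⟨f x, mem_img_of_mem f x.2⟩
        invFun := fun y => ⟨_root_.pinv P f y, hE.pinv_mem y.2⟩
        left_inv := fun x => Subtype.ext (hE.pinv_apply x.2)
        right_inv := fun y => Subtype.ext (hE.apply_pinv y.2)
        map_mul' := fun x y => Subtype.ext (hE.map_mul x x.2 y y.2) }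
    refine ⟨img P f, hle, ψ, ⟨f, hf, fun x => rfl⟩, ⟨_, hf.pinv hB hB', fun x => rfl⟩, ?_⟩
    ext x
    exact (e x).symm

theorem isMor_generated_iff [hfin : Finite S] {hS : IsPGroup p S}
    {B : Subgroup S → (S → S) → Prop} {hB : ∀ R g, B R g → IsEmb R g}
    {hB' : ∀ R g, B R g → B (img R g) (pinv R g)} {hconj : ∀ s, B ⊤ fun x => s * x * s⁻¹}
    {P : Subgroup S} {f : S → S} :
    (generated hS B hB hB' hconj).IsMor P f ↔ Gen B P f := by
  constructor
  · rintro ⟨φ, ⟨g, hg, e⟩, e'⟩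
    exact .congr hg fun x hx => (e' ⟨x, hx⟩).trans (e ⟨x, hx⟩).symm
  · intro hf
    exact isMor_of_mem_hom (F := generated hS B hB hB' hconj) (Q := img P f)
      (φ := MonoidHom.mk' (fun x => ⟨f x, mem_img_of_mem f x.2⟩) fun x y =>
        Subtype.ext ((hf.isEmb hB).map_mul x x.2 y y.2)) ⟨f, hf, fun _ => rfl⟩ fun _ => rfl

end FusionSystem

theorem Gen.map {G K : Type w} [Group G] [Group K] {j : G →* K} (hj : Function.Injective j)
    {B : Subgroup G → (G → G) → Prop} {B' : Subgroup K → (K → K) → Prop}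
    (hBB' : ∀ R g, B R g → B' (R.map j) fun y => j (g (pinv (⊤ : Subgroup G) j y)))
    {P : Subgroup G} {f : G → G} (h : Gen B P f) :
    Gen B' (P.map j) fun y => j (f (pinv (⊤ : Subgroup G) j y)) := by
  induction h with
  | id =>
    refine .congr .id ?_
    rintro _ ⟨x, -, rfl⟩
    rw [FusionSystem.jinv_apply hj]
  | step _ hg hR ih =>
    refine .congr (.step ih (hBB' _ _ hg) (img_le_iff.mpr ?_)) ?_
    · rintro _ ⟨x, hx, rfl⟩
      rw [FusionSystem.jinv_apply hj]
      exact ⟨_, hR (mem_img_of_mem _ hx), rfl⟩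
    · rintro _ ⟨x, -, rfl⟩
      simp only [FusionSystem.jinv_apply hj]
  | congr _ e ih =>
    refine .congr ih ?_
    rintro _ ⟨x, hx, rfl⟩
    simp only [FusionSystem.jinv_apply hj, e x hx]

/-! ### The completion of a tree of fusion systems -/

namespace TreeOfFusionSystems

variable {p : ℕ} {V : Type u} {𝓣 : TreeOfFusionSystems.{u, w} p V} {v₀ : V}

theorem HypothesisH.map_bijective (hH : 𝓣.HypothesisH v₀) {v : V} {c : 𝓣.graph.Walk v v₀}
    (hc : c.IsPath) {e : 𝓣.graph.edgeSet} (he : e.1 ∈ c.edges) (hv : v ∈ e.1) :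
    Function.Bijective (𝓣.map e v hv) := by
  obtain ⟨ψ⟩ := hH v c hc e he hv
  have := (𝓣.fus (Sum.inl v)).finite
  exact (Nat.bijective_iff_injective_and_card _).mpr
    ⟨𝓣.map_injective e v hv, Nat.card_congr ψ.toEquiv⟩

/-- A property of the vertices holds if it holds for `v₀`, and for `v` if it holds for the next
vertex on the path to `v₀`. -/
theorem HypothesisH.induction (hH : 𝓣.HypothesisH v₀) {C : V → Prop} (h₀ : C v₀)
    (h : ∀ (v w : V) (e : 𝓣.graph.edgeSet) (hv : v ∈ e.1), w ∈ e.1 →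
      Function.Bijective (𝓣.map e v hv) → C w → C v) (v : V) : C v := by
  obtain ⟨c, hc⟩ := 𝓣.isTree.connected.exists_isPath v v₀
  induction c with
  | nil => exact h₀
  | @cons v w _ hvw q ih =>
    refine h v w ⟨s(v, w), hvw⟩ (Sym2.mem_mk_left v w) (Sym2.mem_mk_right v w)
      (hH.map_bijective hc (by simp) _) (ih hH h₀ hc.of_cons)

theorem HypothesisH.exists_surjective (hH : 𝓣.HypothesisH v₀) (e : 𝓣.graph.edgeSet) :
    ∃ (v : V) (h : v ∈ e.1), Function.Surjective (𝓣.map e v h) := by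
  obtain ⟨e, he⟩ := e
  induction e using Sym2.ind with
  | h v w =>
    have hvw : 𝓣.graph.Adj v w := he
    obtain ⟨q, hq⟩ := 𝓣.isTree.connected.exists_isPath w v₀
    rcases 𝓣.isTree.isAcyclic.cons_isPath_or hvw hq with hc | ⟨q', -, rfl⟩
    · exact ⟨v, Sym2.mem_mk_left v w, (hH.map_bijective hc (by simp) _).2⟩
    · exact ⟨w, Sym2.mem_mk_right v w, (hH.map_bijective hq (by simp [Sym2.eq_swap]) _).2⟩

open Classical in
/-- The inverse of the homomorphism `S(e) → S(v)`, if it is bijective, and the trivial homomorphism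
otherwise. -/
noncomputable def mapInv (e : 𝓣.graph.edgeSet) (v : V) (h : v ∈ e.1) :
    𝓣.grp (Sum.inl v) →* 𝓣.grp (Sum.inr e) :=
  if hb : Function.Bijective (𝓣.map e v h) then (MulEquiv.ofBijective _ hb).symm.toMonoidHom else 1

theorem mapInv_comp {e : 𝓣.graph.edgeSet} {v : V} {h : v ∈ e.1}
    (hb : Function.Bijective (𝓣.map e v h)) : (mapInv e v h).comp (𝓣.map e v h) = .id _ := by
  ext x
  rw [mapInv, dif_pos hb]
  exact (MulEquiv.ofBijective _ hb).symm_apply_apply x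

/-- The composite of the homomorphisms `S(v) → S(e) → S(w)` for the successive edges `e` of a walk,
where `S(v) → S(e)` is the inverse of `S(e) → S(v)`. -/
noncomputable def homOfWalk : ∀ {v w : V}, 𝓣.graph.Walk v w →
    (𝓣.grp (Sum.inl v) →* 𝓣.grp (Sum.inl w))
  | _, _, .nil => .id _
  | _, _, .cons (u := v) (v := w) h q =>
    (homOfWalk q).comp ((𝓣.map ⟨s(v, w), h⟩ w (Sym2.mem_mk_right v w)).comp
      (mapInv ⟨s(v, w), h⟩ v (Sym2.mem_mk_left v w)))

/-- Under hypothesis (H), all groups of the tree have compatible homomorphisms to `S(v₀)`. -/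
theorem HypothesisH.exists_homs (hH : 𝓣.HypothesisH v₀) :
    ∃ ι : ∀ r, 𝓣.grp r →* 𝓣.grp (Sum.inl v₀), ι (Sum.inl v₀) = .id _ ∧
      ∀ e v h, (ι (Sum.inl v)).comp (𝓣.map e v h) = ι (Sum.inr e) := by
  have hG := 𝓣.isTree
  choose c hc using fun v => hG.connected.exists_isPath v v₀
  choose t ht using exists_mem_edge (𝓣 := 𝓣)
  have key : ∀ (v w : V) (h : 𝓣.graph.Adj v w), (SimpleGraph.Walk.cons h (c w)).IsPath →
      (homOfWalk (c v)).comp (𝓣.map ⟨s(v, w), h⟩ v (Sym2.mem_mk_left v w)) =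
      (homOfWalk (c w)).comp (𝓣.map ⟨s(v, w), h⟩ w (Sym2.mem_mk_right v w)) := by
    intro v w h hp
    have hb := hH.map_bijective hp (e := ⟨s(v, w), h⟩) (by simp) (Sym2.mem_mk_left v w)
    rw [hG.isAcyclic.walk_eq (hc v) hp, homOfWalk, MonoidHom.comp_assoc, MonoidHom.comp_assoc,
      mapInv_comp hb, MonoidHom.comp_id]
  have key' : ∀ (v w : V) (h : 𝓣.graph.Adj v w),
      (homOfWalk (c v)).comp (𝓣.map ⟨s(v, w), h⟩ v (Sym2.mem_mk_left v w)) =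
      (homOfWalk (c w)).comp (𝓣.map ⟨s(v, w), h⟩ w (Sym2.mem_mk_right v w)) := by
    intro v w h
    rcases hG.isAcyclic.cons_isPath_or h (hc w) with hp | ⟨q, hq, hcw⟩
    · exact key v w h hp
    · rw [hG.isAcyclic.walk_eq hq (hc v)] at hcw
      have h1 := key w v h.symm (hcw ▸ hc w)
      have hs : (⟨s(w, v), h.symm⟩ : 𝓣.graph.edgeSet) = ⟨s(v, w), h⟩ := Subtype.ext Sym2.eq_swap
      have h2 : ∀ e : 𝓣.graph.edgeSet, (⟨s(w, v), h.symm⟩ : 𝓣.graph.edgeSet) = e →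
          ∀ (hw : w ∈ e.1) (hv : v ∈ e.1), (homOfWalk (c w)).comp (𝓣.map e w hw) =
            (homOfWalk (c v)).comp (𝓣.map e v hv) := by
        rintro _ rfl _ _
        exact h1
      exact (h2 _ hs _ _).symm
  refine ⟨fun r => match r with
    | .inl v => homOfWalk (c v)
    | .inr e => (homOfWalk (c (t e))).comp (𝓣.map e (t e) (ht e)), ?_, ?_⟩
  · change homOfWalk (c v₀) = _
    rw [hG.isAcyclic.walk_eq (hc v₀) SimpleGraph.Walk.IsPath.nil, homOfWalk]
  · intro e v hv
    suffices h : ∀ (w : V) (hw : w ∈ e.1), (homOfWalk (c v)).comp (𝓣.map e v hv) =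
      (homOfWalk (c w)).comp (𝓣.map e w hw) from h (t e) (ht e)
    intro w hw
    by_cases hvw : v = w
    · subst hvw
      rfl
    · obtain ⟨e, he⟩ := e
      obtain rfl : e = s(v, w) := ((Sym2.mem_and_mem_iff hvw).mp ⟨hv, hw⟩)
      exact key' v w he

section Completion

variable {ι : ∀ r, 𝓣.grp r →* 𝓣.grp (Sum.inl v₀)}

theorem HypothesisH.injective (hH : 𝓣.HypothesisH v₀) (hι₀ : ι (Sum.inl v₀) = .id _)
    (hcomm : ∀ e v h, (ι (Sum.inl v)).comp (𝓣.map e v h) = ι (Sum.inr e)) (r) :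
    Function.Injective (ι r) := by
  have hedge : ∀ e v (h : v ∈ e.1), Function.Injective (ι (Sum.inl v)) →
      Function.Injective (ι (Sum.inr e)) := fun e v h hv => by
    rw [← hcomm e v h, MonoidHom.coe_comp]
    exact hv.comp (𝓣.map_injective e v h)
  have hvert : ∀ v, Function.Injective (ι (Sum.inl v)) := by
    refine hH.induction (hι₀ ▸ Function.injective_id) fun v w e hv hw hb hi => ?_
    have h1 := hedge e w hw hi
    rw [← hcomm e v hv, MonoidHom.coe_comp] at h1
    exact h1.of_comp_right hb.2
  obtain v | e := r
  · exact hvert v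
  · obtain ⟨v, hv⟩ := exists_mem_edge e
    exact hedge e v hv (hvert v)

theorem HypothesisH.comp_eq (hH : 𝓣.HypothesisH v₀) (hι₀ : ι (Sum.inl v₀) = .id _)
    (hcomm : ∀ e v h, (ι (Sum.inl v)).comp (𝓣.map e v h) = ι (Sum.inr e)) {L : Type w} [Group L]
    {j : ∀ r, 𝓣.grp r →* L} (hj : ∀ e v h, (j (Sum.inl v)).comp (𝓣.map e v h) = j (Sum.inr e))
    (r) : (j (Sum.inl v₀)).comp (ι r) = j r := by
  have hvert : ∀ v, (j (Sum.inl v₀)).comp (ι (Sum.inl v)) = j (Sum.inl v) := by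
    refine hH.induction (by rw [hι₀, MonoidHom.comp_id]) fun v w e hv hw hb hi => ?_
    rw [← MonoidHom.cancel_right hb.2, MonoidHom.comp_assoc, hcomm, hj, ← hcomm e w hw,
      ← MonoidHom.comp_assoc, hi, hj]
  obtain v | e := r
  · exact hvert v
  · obtain ⟨v, hv⟩ := exists_mem_edge e
    rw [← hcomm e v hv, ← MonoidHom.comp_assoc, hvert, hj]

/-- Under hypothesis (H), a cocone of homomorphisms to `S(v₀)` is made into a completion by the
fusion system generated by the images of the fusion systems `F(v)`. -/
theorem HypothesisH.exists_isCompletion (hH : 𝓣.HypothesisH v₀) (hι₀ : ι (Sum.inl v₀) = .id _)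
    (hcomm : ∀ e v h, (ι (Sum.inl v)).comp (𝓣.map e v h) = ι (Sum.inr e)) :
    ∃ E : FusionSystem p (𝓣.grp (Sum.inl v₀)), 𝓣.IsCompletion E ι ∧ ∀ P f, E.IsMor P f →
      Gen (fun R g => ∃ v, (𝓣.fus (Sum.inl v)).MorAlong (ι (Sum.inl v)) R g) P f := by
  have hinj := hH.injective hι₀ hcomm
  have := (𝓣.fus (Sum.inl v₀)).finite
  let E : FusionSystem p (𝓣.grp (Sum.inl v₀)) := .generated (𝓣.fus (Sum.inl v₀)).isPGroup
    (fun R g => ∃ v, (𝓣.fus (Sum.inl v)).MorAlong (ι (Sum.inl v)) R g)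
    (fun R g ⟨v, h⟩ => h.isEmb (hinj _)) (fun R g ⟨v, h⟩ => ⟨v, h.pinv (hinj _)⟩)
    fun s => ⟨v₀, FusionSystem.morAlong_conj _ (fun x _ => ⟨x, by rw [hι₀]; rfl⟩)
      ⟨s, by rw [hι₀]; rfl⟩⟩
  have hE : ∀ {P f}, E.IsMor P f ↔
      Gen (fun R g => ∃ v, (𝓣.fus (Sum.inl v)).MorAlong (ι (Sum.inl v)) R g) P f :=
    FusionSystem.isMor_generated_iff
  have hvert : ∀ v, (𝓣.fus (Sum.inl v)).IsMorphism E (ι (Sum.inl v)) := fun v =>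
    FusionSystem.isMorphism_of_exists_isMor fun P f hf =>
      ⟨_, hE.mpr (.of_mem ⟨v, FusionSystem.morAlong_map (hinj _) hf⟩ le_rfl), fun x _ => by
        rw [FusionSystem.jinv_apply (hinj _)]⟩
  refine ⟨E, ⟨⟨fun r => ?_, hcomm⟩, fun L _ D j hj => ?_⟩, fun P f => hE.mp⟩
  · obtain v | e := r
    · exact hvert v
    · obtain ⟨v, hv⟩ := exists_mem_edge e
      refine FusionSystem.isMorphism_of_exists_isMor fun P f hf => ?_
      obtain ⟨g, hg, hgf⟩ := (𝓣.map_isInjectiveMorphism e v hv).1.exists_isMor hf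
      obtain ⟨k, hk, hkg⟩ := (hvert v).exists_isMor hg
      rw [Subgroup.map_map, hcomm] at hk
      refine ⟨k, hk, fun x hx => ?_⟩
      rw [← hcomm e v hv]
      change k (ι (Sum.inl v) (𝓣.map e v hv x)) = _
      rw [hkg _ ⟨x, hx, rfl⟩, hgf x hx]
      rfl
  · have hcomp := hH.comp_eq hι₀ hcomm hj.comm
    refine ⟨j (Sum.inl v₀), ⟨FusionSystem.isMorphism_of_exists_isMor fun P f hf => ?_, hcomp⟩,
      fun φ hφ => ?_⟩
    · replace hf := hE.mp hf
      induction hf with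
      | id => exact ⟨_, D.isMor_id _, fun _ _ => rfl⟩
      | @step R f g hf hg hR ih =>
        obtain ⟨k, hk, hkf⟩ := ih
        obtain ⟨v, hRv, γ, hγ, hγg⟩ := hg
        obtain ⟨l, hl, hlγ⟩ := (hj.isMorphism (Sum.inl v)).exists_isMor hγ
        have hmap : (R.comap (ι (Sum.inl v))).map (j (Sum.inl v)) = R.map (j (Sum.inl v₀)) := by
          rw [← hcomp (Sum.inl v), ← Subgroup.map_map, Subgroup.map_comap_eq_self hRv]
        rw [hmap] at hl
        refine ⟨_, hk.comp hl (img_le_iff.mpr ?_), fun x hx => ?_⟩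
        · rintro _ ⟨x, hx, rfl⟩
          rw [hkf x hx]
          exact ⟨_, hR (mem_img_of_mem f hx), rfl⟩
        · have hfx := hR (mem_img_of_mem f hx)
          obtain ⟨z, hz⟩ := hRv hfx
          rw [← hz] at hfx
          have h1 : ∀ z, j (Sum.inl v₀) (ι (Sum.inl v) z) = j (Sum.inl v) z :=
            DFunLike.congr_fun (hcomp (Sum.inl v))
          dsimp only
          rw [hkf x hx, ← hz, hγg z hfx, h1, h1, hlγ z hfx]
      | @congr f g hf e ih =>
        obtain ⟨k, hk, hkf⟩ := ih
        exact ⟨k, hk, fun x hx => by rw [hkf x hx, e x hx]⟩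
    · rw [← hφ.2 (Sum.inl v₀), hι₀, MonoidHom.comp_id]

/-- All morphisms of a completion on `S(v₀)` are composites of restrictions of morphisms of the
fusion systems `F(v)`, as there is a morphism to the completion that these generate. -/
theorem IsCompletion.gen (hH : 𝓣.HypothesisH v₀) {E : FusionSystem p (𝓣.grp (Sum.inl v₀))}
    (hE : 𝓣.IsCompletion E ι) (hι₀ : ι (Sum.inl v₀) = .id _) {P : Subgroup (𝓣.grp (Sum.inl v₀))}
    {f : 𝓣.grp (Sum.inl v₀) → 𝓣.grp (Sum.inl v₀)} (hf : E.IsMor P f) :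
    Gen (fun R g => ∃ v, (𝓣.fus (Sum.inl v)).MorAlong (ι (Sum.inl v)) R g) P f := by
  obtain ⟨D, hD, hgen⟩ := hH.exists_isCompletion hι₀ hE.comm
  obtain ⟨φ, ⟨hφ, hφι⟩, -⟩ := hE.universal _ D ι hD.toIsCocone
  obtain rfl : φ = .id _ := by
    have h1 := hφι (Sum.inl v₀)
    rwa [hι₀, MonoidHom.comp_id] at h1
  obtain ⟨g, hg, hgf⟩ := hφ.exists_isMor hf
  rw [Subgroup.map_id] at hg
  exact hgen P f (hg.congr fun x hx => (hgf x hx).symm)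

end Completion

end TreeOfFusionSystems

theorem theoremB {p : ℕ} [Fact p.Prime] {V : Type u} (𝓣 : TreeOfFusionSystems.{u, w} p V)
    (v₀ : V) (hH : 𝓣.HypothesisH v₀)
    (hsat : ∀ v : V, (𝓣.fus (Sum.inl v)).IsSaturated) :
    -- the completion exists, as a fusion system on `S = S(v₀)`
    (∃ (E : FusionSystem p (𝓣.grp (Sum.inl v₀))) (ι : ∀ r, 𝓣.grp r →* 𝓣.grp (Sum.inl v₀)),
      ι (Sum.inl v₀) = MonoidHom.id _ ∧ 𝓣.IsCompletion E ι) ∧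
    -- and it is saturated under the two conditions
    ∀ (E : FusionSystem p (𝓣.grp (Sum.inl v₀))) (ι : ∀ r, 𝓣.grp r →* 𝓣.grp (Sum.inl v₀)),
      ι (Sum.inl v₀) = MonoidHom.id _ → ∀ hE : 𝓣.IsCompletion E ι,
      (∀ P : Subgroup (𝓣.grp (Sum.inl v₀)),
        ((∃ (v : V) (R : Subgroup (𝓣.grp (Sum.inl v))), (𝓣.fus (Sum.inl v)).IsEssential R ∧
            E.Conj P (R.map (ι (Sum.inl v)))) ∨
          ∃ v : V, P = (ι (Sum.inl v)).range) → E.IsCentric P) →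
      (∀ P : Subgroup (𝓣.grp (Sum.inl v₀)), E.IsCentric P →
        (TreeOfFusionSystems.orbitGraph hE.toIsCocone P).IsTree) →
      E.IsSaturated := by
  refine ⟨?_, fun E ι hι₀ hE ha hb => ?_⟩
  · obtain ⟨ι, hι₀, hcomm⟩ := hH.exists_homs
    obtain ⟨E, hE, -⟩ := hH.exists_isCompletion hι₀ hcomm
    exact ⟨E, ι, hι₀, hE⟩
  have hinj := hH.injective hι₀ hE.comm
  have h : TreeOfFusionSystems.HasOrbitTrees hE.toIsCocone :=
    ⟨hinj, fun v => (hsat v).saturatedAt, hb, hH.exists_surjective⟩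
  have hrange : (ι (Sum.inl v₀)).range = ⊤ := by
    rw [hι₀]
    exact MonoidHom.range_eq_top.mpr Function.surjective_id
  refine FusionSystem.isSaturated_of_saturatedAt (FusionSystem.saturatedAt_of_centric
    (fun P f hf => ?_) fun P hP => h.saturatedAt_of_isCentric hrange hP)
  refine (hE.gen hH hι₀ hf).trans (fun R g hg => hg.1.isEmb) ?_
  rintro R g ⟨v, hR, γ, hγ, hγg⟩
  have hmor : ∀ {Q : Subgroup (𝓣.grp (Sum.inl v))} {k}, (𝓣.fus (Sum.inl v)).IsMor Q k →
      E.IsMor (Q.map (ι (Sum.inl v))) fun y => ι (Sum.inl v) (k (pinv ⊤ (ι (Sum.inl v)) y)) :=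
    fun hk => (hE.isMorphism _).isMor (FusionSystem.morAlong_map (hinj _) hk)
  have h1 := (FusionSystem.gen_isEssentialMor (hsat v).saturatedAt _ _ hγ).map (hinj (Sum.inl v))
    (B' := fun R g => E.IsMor R g ∧ E.IsCentric R) fun Q k hk => by
      refine ⟨hmor hk.1, ha _ ?_⟩
      obtain rfl | ⟨l, hl, hQ⟩ := hk.2
      · exact Or.inr ⟨v, (MonoidHom.range_eq_map _).symm⟩
      · refine Or.inl ⟨v, _, hQ, FusionSystem.conj_iff.mpr ⟨_, hmor hl, ?_⟩⟩
        ext y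
        rw [(hmor hl).isEmb.mem_img, Subgroup.mem_map]
        constructor
        · rintro ⟨_, ⟨x, hx, rfl⟩, rfl⟩
          exact ⟨l x, mem_img_of_mem l hx, by rw [FusionSystem.jinv_apply (hinj _)]⟩
        · rintro ⟨z, hz, rfl⟩
          obtain ⟨x, hx, rfl⟩ := hl.isEmb.mem_img.mp hz
          exact ⟨_, ⟨x, hx, rfl⟩, by rw [FusionSystem.jinv_apply (hinj _)]⟩
  rw [Subgroup.map_comap_eq_self hR] at h1
  refine .congr h1 fun y hy => ?_
  obtain ⟨x, rfl⟩ := hR hy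
  rw [FusionSystem.jinv_apply (hinj _), hγg x hy]
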